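/- **Data.** Let $R$ be a commutative noetherian ring, $F$ a free $R$-module of rank $n\ge 3$, $F^*=\operatorname{Hom}_R(F,R)$, $X\colon F\to F^*$ an $R$-linear map with dual $X^*\colon F\to F^*$, $X^*(a)(b)=X(b)(a)$, and $u,v\in F$. Each $\alpha\in F^*$ acts on $\bigwedge F$ as the graded derivation $\alpha(a_1\wedge\dots\wedge a_s)=\sum_j(-1)^{j+1}\alpha(a_j)\,a_1\wedge\dots\widehat{a_j}\dots\wedge a_s$, and $\bigwedge F$ is a $\bigwedge F^*$-module by $(\alpha\wedge\beta)(a)=\alpha(\beta(a))$; in the same way $\bigwedge F^*$ is a $\bigwedge F$-module. Fix $\eta\in\bigwedge^nF$ and $\varepsilon\in\bigwedge^nF^*$ with $\eta(\varepsilon)=1$. The component of the comultiplication in $\bigwedge^1\otimes\bigwedge^{s-1}$ is written $\Delta(a)=\sum a_1\otimes a'$ (and likewise for $\alpha,\beta\in\bigwedge F^*$). Put $\bigwedge^t=0$ for $t<0$. For a linear map $g\colon A\to B$ let $I_1(g)$ be the ideal generated by all $\varphi(g(x))$, $x\in A$, $\varphi\in B^*$; for $u\in F$ let $I_1(u)$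 be $I_1$ of the map $R\to F$, $1\mapsto u$. **The complex $\mathbb F$.** For $r\in\mathbb Z$ let $\mathbb F_r=\bigoplus_{i=1}^4\bigoplus_{t\in\mathbb Z}\mathbb F_r(i)^{(t)}$, where $\mathbb F_r(1)^{(t)}=\bigwedge^tF^*\otimes\bigwedge^{r+1-t}F^*$, $\mathbb F_r(2)^{(t)}=\mathbb F_r(3)^{(t)}=\bigwedge^tF\otimes\bigwedge^{r-t}F^*$, $\mathbb F_r(4)^{(t)}=\bigwedge^tF^*\otimes\bigwedge^{r-1-t}F^*$. Writing $[\,\cdot\,]_i$ for an element of the $i$-th summand of $\mathbb F_{r-1}$, the map $f_r\colon\mathbb F_r\to\mathbb F_{r-1}$ is given by: * on $\mathbb F_r(1)$: $\alpha\otimes\beta\mapsto[\alpha\otimes v(\beta)+(-1)^ru(\alpha)\otimes\beta]_1+[\sum(\beta_1\wedge(\bigwedge X^*)(\alpha(\eta)))(\eta)\otimes\beta']_2+[\sum(\alpha_1\wedge(\bigwedge X)(\beta(\eta)))(\eta)\otimes\alpha']_3$; * on $\mathbb F_r(2)$: $a\otimes\beta\mapsto[(-1)^r(\bigwedge X)(a)\otimes\beta]_1+[a\otimes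 v(\beta)+(-1)^{r+1}(X^*(u))(a)\otimes\beta]_2+[\sum(\bigwedge X)(a')\otimes a_1(\beta)]_4$; * on $\mathbb F_r(3)$: $a\otimes\beta\mapsto[(-1)^{r+1}\beta\otimes(\bigwedge X^*)(a)]_1+[(-1)^{r+1}a\otimes u(\beta)+(X(v))(a)\otimes\beta]_3-[\sum a_1(\beta)\otimes(\bigwedge X^*)(a')]_4$; * on $\mathbb F_r(4)$: $\alpha\otimes\beta\mapsto[(-1)^r((\bigwedge X^*)(\alpha(\eta)))(\eta)\otimes\beta]_2+[(-1)^r((\bigwedge X)(\beta(\eta)))(\eta)\otimes\alpha]_3+[\alpha\otimes v(\beta)+(-1)^ru(\alpha)\otimes\beta]_4$. **The modules $\mathbb M_r$ and $\mathbb N_r$.** Let $\mu_s\colon F\otimes\bigwedge^sF^*\to\bigwedge^{s-1}F^*$, $a\otimes\alpha\mapsto a(\alpha)$, and $\sigma_s\colon\bigwedge^sF^*\to\bigwedge^{n-1}F\otimes\bigwedge^{s-1}F^*$, $\alpha\mapsto\sum\alpha_1(\eta)\otimes\alpha'$. Fix maps $\ell_s\colon\bigwedge^sF^*\to F\otimes\bigwedge^{s+1}F^*$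 with $\mu_{s+1}\ell_s=\mathrm{id}$ for $s\ne n$ and $\ell_n=0$, and maps $\lambda_s\colon\bigwedge^{n-1}F\otimes\bigwedge^sF^*\to\bigwedge^{s+1}F^*$ with $\lambda_s\sigma_{s+1}=\mathrm{id}$ for $s\neq-1$ and $\lambda_{-1}=0$. For $i=2,3$ let $\mathbb F_r(i)^{(n-1)\prime}=\ker\lambda_{r+1-n}$, $\mathbb F_r(i)^{(n-1)\prime\prime}=\operatorname{im}\sigma_{r+2-n}$, $\mathbb F_r(i)^{(1)\prime}=\ker\mu_{r-1}$, $\mathbb F_r(i)^{(1)\prime\prime}=\operatorname{im}\ell_{r-2}$. Let $\mathbb M_r\subseteq\mathbb F_r$ be the sum of * $\mathbb F_r(1)^{(t)}$ for $t\notin\{0,n,r+1,r+1-n\}$ and $\mathbb F_r(4)^{(t)}$ for $t\notin\{0,n,r-1,r-1-n\}$; * for $i=2,3$: $\mathbb F_r(i)^{(n-1)\prime}$, $\mathbb F_r(i)^{(1)\prime}$, and $\mathbb F_r(i)^{(t)}$ for $2\le t\le n-2$; * $\mathbb F_0(3)^{(0)}$ if $r=0$, $\mathbb F_2(3)^{(1)\prime\prime}$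 if $r=2$, $\mathbb F_{2n-2}(3)^{(n-1)\prime\prime}$ if $r=2n-2$, and $\mathbb F_{2n}(3)^{(n)}$ if $r=2n$. Let $\widehat{\mathbb N}_r\subseteq\mathbb F_r$ be the sum of $\mathbb F_r(1)^{(n)}$ if $n\le r\le 2n-1$; $\mathbb F_r(1)^{(r+1-n)}$ if $n\le r\le 2n-2$; $\mathbb F_r(2)^{(0)}$ if $0\le r\le n$; $\mathbb F_r(2)^{(1)\prime\prime}$ if $2\le r\le n+1$; $\mathbb F_r(3)^{(0)}$ if $1\le r\le n$; $\mathbb F_r(3)^{(1)\prime\prime}$ if $3\le r\le n+1$; $\mathbb F_r(4)^{(n)}$ if $n+1\le r\le 2n+1$; $\mathbb F_r(4)^{(r-1-n)}$ if $n+1\le r\le 2n$. Put $\mathbb N_r=\widehat{\mathbb N}_r+f_{r+1}(\widehat{\mathbb N}_{r+1})$. Let $\mathbb L_r$ be the sum of the remaining summands of $\mathbb F_r$, so that $\mathbb F_r=\mathbb L_r\oplus\mathbb M_r\oplus\widehat{\mathbb N}_r$, and let $\pi_r\colon\mathbb F_r\to\mathbb M_r$ be the corresponding projection. **The maps $m_r$.**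 Let $\tau_r\colon\mathbb L_r\to\widehat{\mathbb N}_{r+1}$ be given by the following formulas, where $\delta$ is the Kronecker delta and now $[\,\cdot\,]_i$ denotes an element of the $i$-th summand of $\mathbb F_{r+1}$: * $[1\otimes\beta]$ in $\mathbb F_r(1)^{(0)}$ $\mapsto(-1)^{r+1}[1\otimes\beta]_2$ ($-1\le r\le n-1$); $[\alpha\otimes1]$ in $\mathbb F_r(1)^{(r+1)}$ $\mapsto(-1)^r[1\otimes\alpha]_3$ ($0\le r\le n-1$); * $\sigma(\beta)$ in $\mathbb F_r(2)^{(n-1)\prime\prime}$ $\mapsto[\varepsilon\otimes\beta]_1+\delta_{r,n-1}(-1)^n[v(\beta)\otimes\varepsilon]_3$ ($n-1\le r\le 2n-2$); * $\eta\otimes\beta$ in $\mathbb F_r(2)^{(n)}$ $\mapsto(-1)^{r+1}[\varepsilon\otimes\beta]_4+\delta_{r,n}\,\beta\,[\ell_{n-1}(u(\varepsilon))]_3$ ($n\le r\le 2n$); * $\sigma(\beta)$ in $\mathbb F_r(3)^{(n-1)\prime\prime}$ $\mapsto[\beta\otimes\varepsilon]_1-\delta_{r,n-1}[u(\beta)\otimes\varepsilon]_2$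 ($n-1\le r\le 2n-3$); * $\eta\otimes\beta$ in $\mathbb F_r(3)^{(n)}$ $\mapsto(-1)^{r+1}[\beta\otimes\varepsilon]_4+\delta_{r,n}(-1)^n\beta\,[\ell_{n-1}(v(\varepsilon))]_2$ ($n\le r\le 2n-1$); * $1\otimes\beta$ in $\mathbb F_r(4)^{(0)}$ $\mapsto[\ell_{r-1}(\beta)]_2$ ($1\le r\le n$); $\alpha\otimes1$ in $\mathbb F_r(4)^{(r-1)}$ $\mapsto-[\ell_{r-1}(\alpha)]_3$ ($2\le r\le n$). Let $\psi_r\colon\mathbb F_r\to\mathbb M_r$ be the identity on $\mathbb M_r$, zero on $\widehat{\mathbb N}_r$, and $-\pi_r f_{r+1}\tau_r$ on $\mathbb L_r$, and let $m_r=\psi_{r-1}\circ f_r|_{\mathbb M_r}\colon\mathbb M_r\to\mathbb M_{r-1}$. **Theorem.** Then $(\mathbb F,f)$ is a complex, $\mathbb N$ is a split exact subcomplex of it, and the following hold. (a) $(\mathbb M,m)$ is a complex $0\to\mathbb M_{2n}\to\dots\to\mathbb M_r\xrightarrow{m_r}\mathbb M_{r-1}\to\dots\to\mathbb M_0$ of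 finitely generated projective $R$-modules ($\mathbb M_r=0$ for $r<0$ and for $r>2n$). (b) Let $e_1,\dots,e_n$ be a basis of $F$ with dual basis $\varepsilon_1,\dots,\varepsilon_n$ such that $e_1\wedge\dots\wedge e_n=\eta$ and $\varepsilon_n\wedge\dots\wedge\varepsilon_1=\varepsilon$; let $\mathbf u=[u_1,\dots,u_n]$ and $\mathbf v=[v_1,\dots,v_n]^{T}$ be the coordinates of $u$ and $v$, and $\mathbf X=(x_{ij})$ with $X(e_j)=\sum_ix_{ij}\varepsilon_i$. Then $H_0(\mathbb M)\cong R/H$, where, with $\mathbf w=(-1)^{n(n-1)/2}\mathbf v$, $H=I_1(\mathbf u\mathbf X)+I_1(\mathbf X\mathbf w)+I_1(\mathbf w\mathbf u-\operatorname{Adj}\mathbf X)$, $I_1$ of a matrix being the ideal generated by its entries and $\operatorname{Adj}$ the classical adjoint. (c) The maps $\psi_r$ form a map of complexes $\mathbb F\to\mathbb M$ with kernel $\mathbb N$, which is the identity on each $\mathbb M_r$ and induces isomorphisms $H_r(\mathbb F)\cong H_r(\mathbb M)$ for all $r$. (d) $I_1(m_r)\subseteq I_1(u)+I_1(v)+I_1(X)$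 for all $r$. Consequently $m_r(\mathbb M_r)\subseteq\mathfrak m\,\mathbb M_{r-1}$ for all $r$ and every ideal $\mathfrak m\supseteq I_1(u)+I_1(v)+I_1(X)$; in particular $\mathbb M$ is minimal if $R$ is local (or graded) and $\mathfrak m$ is its (homogeneous) maximal ideal. -/

import Mathlib

open scoped TensorProduct

noncomputable section

namespace TwoSequences

universe uR uF uT

/-! ## Exterior algebras, integer degrees, contraction and comultiplication -/

section Exterior

variable (R : Type uR) [CommRing R] (V : Type uF) [AddCommGroup V] [Module R V]

/-- The homogeneous piece of degree `t` of the exterior algebra, for an integer `t`;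
it is zero for negative `t`. -/
def extPow (t : ℤ) : Submodule R (ExteriorAlgebra R V) :=
  if 0 ≤ t then ⋀[R]^t.toNat V else ⊥

/-- The projection of the exterior algebra onto its piece of degree `t`. -/
def extProj (t : ℤ) : ExteriorAlgebra R V →ₗ[R] ExteriorAlgebra R V :=
  if 0 ≤ t then GradedAlgebra.proj (fun i : ℕ => ⋀[R]^i V) t.toNat else 0

/-- The degree zero coefficient of an element of the exterior algebra. -/
def scalarPart : ExteriorAlgebra R V →ₗ[R] R :=
  (ExteriorAlgebra.algebraMapInv : ExteriorAlgebra R V →ₐ[R] R).toLinearMap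

/-- The graded tensor product of the exterior algebra with itself. -/
abbrev ExtSq : Type (max uR uF) :=
  GradedTensorProduct R (fun i : ℕ => ⋀[R]^i V) (fun i : ℕ => ⋀[R]^i V)

/-- The map `a ↦ a ⊗ 1 + 1 ⊗ a` which induces the comultiplication. -/
def diagonal : V →ₗ[R] ExtSq R V :=
  (GradedTensorProduct.includeLeft (R := R) (fun i : ℕ => ⋀[R]^i V)
      (fun i : ℕ => ⋀[R]^i V)).toLinearMap ∘ₗ ExteriorAlgebra.ι R +
  (GradedTensorProduct.includeRight (R := R) (fun i : ℕ => ⋀[R]^i V)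
      (fun i : ℕ => ⋀[R]^i V)).toLinearMap ∘ₗ ExteriorAlgebra.ι R

theorem ι_mem_one (a : V) : ExteriorAlgebra.ι R a ∈ ⋀[R]^1 V := by
  simpa only [pow_one] using LinearMap.mem_range_self (ExteriorAlgebra.ι R) a

theorem diagonal_sq (a : V) : diagonal R V a * diagonal R V a = 0 := by
  let A : ℕ → Submodule R (ExteriorAlgebra R V) := fun i => ⋀[R]^i V
  let x : ExteriorAlgebra R V := ExteriorAlgebra.ι R a
  have h1 : (GradedTensorProduct.tmul R 1 x * GradedTensorProduct.tmul R x 1 :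
      GradedTensorProduct R A A) = -GradedTensorProduct.tmul R x x := by
    have h := GradedTensorProduct.tmul_coe_mul_coe_tmul (R := R) A A (j₁ := 1) (i₂ := 1) 1
      ⟨x, ι_mem_one R V a⟩ ⟨x, ι_mem_one R V a⟩ 1
    refine h.trans ?_
    change (-1 : ℤˣ) ^ (1 * 1) • GradedTensorProduct.tmul R (1 * x) (x * 1) = _
    rw [one_mul x, mul_one x]
    simp
  have h2 : (GradedTensorProduct.tmul R x 1 * GradedTensorProduct.tmul R 1 x :
      GradedTensorProduct R A A) = GradedTensorProduct.tmul R x x :=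
    GradedTensorProduct.tmul_one_mul_one_tmul A A x x
  have h3 : (GradedTensorProduct.tmul R x 1 * GradedTensorProduct.tmul R x 1 :
      GradedTensorProduct R A A) = 0 := by
    have h := (GradedTensorProduct.includeLeft (R := R) A A).map_mul x x
    rw [show x * x = 0 from ExteriorAlgebra.ι_sq_zero a, map_zero] at h
    exact h.symm
  have h4 : (GradedTensorProduct.tmul R 1 x * GradedTensorProduct.tmul R 1 x :
      GradedTensorProduct R A A) = 0 := by
    have h := (GradedTensorProduct.includeRight (R := R) A A).map_mul x x
    rw [show x * x = 0 from ExteriorAlgebra.ι_sq_zero a, map_zero] at h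
    exact h.symm
  have h5 : (GradedTensorProduct.tmul R x 1 + GradedTensorProduct.tmul R 1 x :
      GradedTensorProduct R A A) * (GradedTensorProduct.tmul R x 1 + GradedTensorProduct.tmul R 1 x)
      = 0 := by
    rw [add_mul, mul_add, mul_add, h1, h2, h3, h4]
    abel
  exact h5

/-- The comultiplication `Δ : ⋀V → ⋀V ⊗ ⋀V`, the algebra map induced by the diagonal map. -/
def comul : ExteriorAlgebra R V →ₐ[R] ExtSq R V :=
  ExteriorAlgebra.lift R ⟨diagonal R V, diagonal_sq R V⟩

/-- The component of `Δ` in `V ⊗ ⋀V`; on `⋀^s V` it is the component `⋀^s V → ⋀^1 V ⊗ ⋀^(s-1) V`,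
written `Δ(α) = ∑ α₁ ⊗ α'`. -/
def comulOne : ExteriorAlgebra R V →ₗ[R] V ⊗[R] ExteriorAlgebra R V :=
  LinearMap.rTensor (ExteriorAlgebra R V) ExteriorAlgebra.ιInv ∘ₗ
    (GradedTensorProduct.of R (fun i : ℕ => ⋀[R]^i V) (fun i : ℕ => ⋀[R]^i V)).symm.toLinearMap ∘ₗ
      (comul R V).toLinearMap

end Exterior

section Actions

variable {R : Type uR} [CommRing R] {F : Type uF} [AddCommGroup F] [Module R F]

/-- The module structure of `⋀F^*` on `⋀F`: an element of `F^*` acts as a graded derivation, and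
`(α ∧ β)(a) = α (β a)`. -/
def act : ExteriorAlgebra R (Module.Dual R F) →ₐ[R] Module.End R (ExteriorAlgebra R F) :=
  ExteriorAlgebra.lift R ⟨CliffordAlgebra.contractLeft, fun α => by
    refine LinearMap.ext fun x => ?_
    exact CliffordAlgebra.contractLeft_contractLeft α x⟩

/-- The module structure of `⋀F` on `⋀F^*`, obtained in the analogous manner from `F → F^**`. -/
def coact : ExteriorAlgebra R F →ₐ[R] Module.End R (ExteriorAlgebra R (Module.Dual R F)) :=
  ExteriorAlgebra.lift R ⟨CliffordAlgebra.contractLeft ∘ₗ Module.Dual.eval R F, fun a => by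
    refine LinearMap.ext fun x => ?_
    exact CliffordAlgebra.contractLeft_contractLeft (Module.Dual.eval R F a) x⟩

end Actions

/-! ## The data -/

section Setup

variable (R : Type uR) [CommRing R] (F : Type uF) [AddCommGroup F] [Module R F] (n : ℕ)

/-- A map `X : F → F^*`, elements `u, v` of `F`, and compatible orientation elements
`η ∈ ⋀^n F` and `ε ∈ ⋀^n F^*`, that is, `η(ε) = 1`. -/
structure BasicData where
  X : F →ₗ[R] Module.Dual R F
  u : F
  v : F
  eta : ExteriorAlgebra R F
  eps : ExteriorAlgebra R (Module.Dual R F)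
  eta_mem : eta ∈ extPow R F n
  eps_mem : eps ∈ extPow R (Module.Dual R F) n
  compatible : coact eta eps = 1

end Setup

section Complexes

variable {R : Type uR} [CommRing R] {F : Type uF} [AddCommGroup F] [Module R F] {n : ℕ}

local notation "E" => ExteriorAlgebra R F
local notation "E'" => ExteriorAlgebra R (Module.Dual R F)

variable (R F) in
/-- The ambient module `(⋀F^* ⊗ ⋀F^*) ⊕ (⋀F ⊗ ⋀F^*) ⊕ (⋀F ⊗ ⋀F^*) ⊕ (⋀F^* ⊗ ⋀F^*)`, which contains
all the modules below. -/
abbrev Total : Type (max uR uF) :=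
  (E' ⊗[R] E') × (E ⊗[R] E') × (E ⊗[R] E') × (E' ⊗[R] E')

/-- The four summands of the ambient module, as inclusions. -/
def in1 : E' ⊗[R] E' →ₗ[R] Total R F := LinearMap.inl R _ _
def in2 : E ⊗[R] E' →ₗ[R] Total R F := LinearMap.inr R _ _ ∘ₗ LinearMap.inl R _ _
def in3 : E ⊗[R] E' →ₗ[R] Total R F :=
  LinearMap.inr R _ _ ∘ₗ LinearMap.inr R _ _ ∘ₗ LinearMap.inl R _ _
def in4 : E' ⊗[R] E' →ₗ[R] Total R F :=
  LinearMap.inr R _ _ ∘ₗ LinearMap.inr R _ _ ∘ₗ LinearMap.inr R _ _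

/-- The four summands of the ambient module, as projections. -/
def out1 : Total R F →ₗ[R] E' ⊗[R] E' := LinearMap.fst R _ _
def out2 : Total R F →ₗ[R] E ⊗[R] E' := LinearMap.fst R _ _ ∘ₗ LinearMap.snd R _ _
def out3 : Total R F →ₗ[R] E ⊗[R] E' :=
  LinearMap.fst R _ _ ∘ₗ LinearMap.snd R _ _ ∘ₗ LinearMap.snd R _ _
def out4 : Total R F →ₗ[R] E' ⊗[R] E' :=
  LinearMap.snd R _ _ ∘ₗ LinearMap.snd R _ _ ∘ₗ LinearMap.snd R _ _

/-- `⋀^a F^* ⊗ ⋀^b F^*` inside `⋀F^* ⊗ ⋀F^*`. -/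
def bidegDD (a b : ℤ) : Submodule R (E' ⊗[R] E') :=
  LinearMap.range
    (TensorProduct.mapIncl (extPow R (Module.Dual R F) a) (extPow R (Module.Dual R F) b))

/-- `⋀^a F ⊗ ⋀^b F^*` inside `⋀F ⊗ ⋀F^*`. -/
def bidegFD (a b : ℤ) : Submodule R (E ⊗[R] E') :=
  LinearMap.range (TensorProduct.mapIncl (extPow R F a) (extPow R (Module.Dual R F) b))

/-- The projection of `⋀F^* ⊗ ⋀F^*` onto `⋀^a F^* ⊗ ⋀^b F^*`. -/
def projDD (a b : ℤ) : E' ⊗[R] E' →ₗ[R] E' ⊗[R] E' :=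
  TensorProduct.map (extProj R (Module.Dual R F) a) (extProj R (Module.Dual R F) b)

/-- The projection of `⋀F ⊗ ⋀F^*` onto `⋀^a F ⊗ ⋀^b F^*`. -/
def projFD (a b : ℤ) : E ⊗[R] E' →ₗ[R] E ⊗[R] E' :=
  TensorProduct.map (extProj R F a) (extProj R (Module.Dual R F) b)

/-! ### The modules of the complex `𝔽` -/

variable (R F) in
/-- The summands `𝔽_r(i)^(t)`, for `i = 1, 2, 3, 4`. -/
def F1 (r t : ℤ) : Submodule R (Total R F) := (bidegDD t (r + 1 - t)).map in1
variable (R F) in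
def F2 (r t : ℤ) : Submodule R (Total R F) := (bidegFD t (r - t)).map in2
variable (R F) in
def F3 (r t : ℤ) : Submodule R (Total R F) := (bidegFD t (r - t)).map in3
variable (R F) in
def F4 (r t : ℤ) : Submodule R (Total R F) := (bidegDD t (r - 1 - t)).map in4

variable (R F) in
/-- The module `𝔽_r`. -/
def FF (r : ℤ) : Submodule R (Total R F) :=
  (⨆ t, F1 R F r t) ⊔ (⨆ t, F2 R F r t) ⊔ (⨆ t, F3 R F r t) ⊔ (⨆ t, F4 R F r t)

/-! ### The maps of the complex `𝔽` -/

/-- `a ⊗ β ↦ ∑ (⋀Y)(a') ⊗ a₁(β)`, where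
`Δ(a) = ∑ a₁ ⊗ a'`. -/
def mapC (Y : F →ₗ[R] Module.Dual R F) : E ⊗[R] E' →ₗ[R] E' ⊗[R] E' :=
  TensorProduct.lift <|
    LinearMap.flip
      (LinearMap.mk₂ R
        (fun (β : E') (z : F ⊗[R] E) =>
          (TensorProduct.comm R E' E') (TensorProduct.map
            ((coact : E →ₐ[R] Module.End R E').toLinearMap.flip β ∘ₗ ExteriorAlgebra.ι R)
            (ExteriorAlgebra.map Y).toLinearMap z))
        (fun β β' z => by
          rw [map_add, LinearMap.add_comp, TensorProduct.map_add_left, LinearMap.add_apply, map_add])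
        (fun c β z => by
          rw [map_smul, LinearMap.smul_comp, TensorProduct.map_smul_left, LinearMap.smul_apply,
            map_smul])
        (fun β z z' => by simp only [map_add])
        (fun c β z => by simp only [map_smul])) ∘ₗ comulOne R F

/-- `α ↦ [(⋀Y)(α(η))](η)`. -/
def mapA (Y : F →ₗ[R] Module.Dual R F) (η : E) : E' →ₗ[R] E :=
  act.toLinearMap.flip η ∘ₗ (ExteriorAlgebra.map Y).toLinearMap ∘ₗ act.toLinearMap.flip η

/-- `α ⊗ β ↦ ∑ [β₁ ∧ (⋀Y)(α(η))](η) ⊗ β'`, where `Δ(β) = ∑ β₁ ⊗ β'`. -/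
def mapB (Y : F →ₗ[R] Module.Dual R F) (η : E) : E' ⊗[R] E' →ₗ[R] E ⊗[R] E' :=
  TensorProduct.lift
    (LinearMap.mk₂ R
      (fun (α β : E') =>
        LinearMap.rTensor E'
          (act.toLinearMap.flip η ∘ₗ
            LinearMap.mulRight R (ExteriorAlgebra.map Y (act α η)) ∘ₗ ExteriorAlgebra.ι R)
          (comulOne R (Module.Dual R F) β))
      (fun α α' β => by
        have h : LinearMap.mulRight R (ExteriorAlgebra.map Y (act (α + α') η)) =
            LinearMap.mulRight R (ExteriorAlgebra.map Y (act α η)) +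
            LinearMap.mulRight R (ExteriorAlgebra.map Y (act α' η)) := by
          ext x; simp [mul_add]
        rw [h, LinearMap.add_comp, LinearMap.comp_add, LinearMap.rTensor_add, LinearMap.add_apply])
      (fun c α β => by
        have h : LinearMap.mulRight R (ExteriorAlgebra.map Y (act (c • α) η)) =
            c • LinearMap.mulRight R (ExteriorAlgebra.map Y (act α η)) := by
          ext x; simp
        rw [h, LinearMap.smul_comp, LinearMap.comp_smul, LinearMap.rTensor_smul,
          LinearMap.smul_apply])
      (fun α β β' => by simp only [map_add])
      (fun c α β => by simp only [map_smul]))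

namespace BasicData

variable (D : BasicData R F n)

/-- The dual map `X^* : F → F^*`, `X^*(a)(b) = X(b)(a)`. -/
def Xs : F →ₗ[R] Module.Dual R F := LinearMap.flip D.X

/-- The component of `f_r` on `𝔽_r(1)`:
`α ⊗ β ↦ α ⊗ v(β) + (-1)^r u(α) ⊗ β + ∑ [β₁ ∧ (⋀X^*)(α(η))](η) ⊗ β' + ∑ [α₁ ∧ (⋀X)(β(η))](η) ⊗ α'`. -/
def f1 (r : ℤ) : E' ⊗[R] E' →ₗ[R] Total R F :=
  in1 ∘ₗ (LinearMap.lTensor E' (coact (ExteriorAlgebra.ι R D.v)) +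
      r.negOnePow • LinearMap.rTensor E' (coact (ExteriorAlgebra.ι R D.u))) +
  in2 ∘ₗ mapB D.Xs D.eta +
  in3 ∘ₗ mapB D.X D.eta ∘ₗ (TensorProduct.comm R E' E').toLinearMap

/-- The component of `f_r` on `𝔽_r(2)`:
`a ⊗ β ↦ (-1)^r (⋀X)(a) ⊗ β + a ⊗ v(β) + (-1)^(r+1) [X^*(u)](a) ⊗ β + ∑ (⋀X)(a') ⊗ a₁(β)`. -/
def f2 (r : ℤ) : E ⊗[R] E' →ₗ[R] Total R F :=
  in1 ∘ₗ (r.negOnePow • LinearMap.rTensor E' (ExteriorAlgebra.map D.X).toLinearMap) +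
  in2 ∘ₗ (LinearMap.lTensor E (coact (ExteriorAlgebra.ι R D.v)) +
      (r + 1).negOnePow • LinearMap.rTensor E' (act (ExteriorAlgebra.ι R (D.Xs D.u)))) +
  in4 ∘ₗ mapC D.X

/-- The component of `f_r` on `𝔽_r(3)`:
`a ⊗ β ↦ (-1)^(r+1) β ⊗ (⋀X^*)(a) + (-1)^(r+1) a ⊗ u(β) + [X(v)](a) ⊗ β - ∑ a₁(β) ⊗ (⋀X^*)(a')`. -/
def f3 (r : ℤ) : E ⊗[R] E' →ₗ[R] Total R F :=
  in1 ∘ₗ ((r + 1).negOnePow • ((TensorProduct.comm R E' E').toLinearMap ∘ₗ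
      LinearMap.rTensor E' (ExteriorAlgebra.map D.Xs).toLinearMap)) +
  in3 ∘ₗ ((r + 1).negOnePow • LinearMap.lTensor E (coact (ExteriorAlgebra.ι R D.u)) +
      LinearMap.rTensor E' (act (ExteriorAlgebra.ι R (D.X D.v)))) -
  in4 ∘ₗ (TensorProduct.comm R E' E').toLinearMap ∘ₗ mapC D.Xs

/-- The component of `f_r` on `𝔽_r(4)`:
`α ⊗ β ↦ (-1)^r [(⋀X^*)(α(η))](η) ⊗ β + (-1)^r [(⋀X)(β(η))](η) ⊗ α + α ⊗ v(β) + (-1)^r u(α) ⊗ β`. -/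
def f4 (r : ℤ) : E' ⊗[R] E' →ₗ[R] Total R F :=
  in2 ∘ₗ (r.negOnePow • LinearMap.rTensor E' (mapA D.Xs D.eta)) +
  in3 ∘ₗ (r.negOnePow • (LinearMap.rTensor E' (mapA D.X D.eta) ∘ₗ
      (TensorProduct.comm R E' E').toLinearMap)) +
  in4 ∘ₗ (LinearMap.lTensor E' (coact (ExteriorAlgebra.ι R D.v)) +
      r.negOnePow • LinearMap.rTensor E' (coact (ExteriorAlgebra.ι R D.u)))

/-- The map `f_r`; it is applied to `𝔽_r` only. -/
def f (r : ℤ) : Total R F →ₗ[R] Total R F :=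
  D.f1 r ∘ₗ out1 + D.f2 r ∘ₗ out2 + D.f3 r ∘ₗ out3 + D.f4 r ∘ₗ out4

/-- `a ⊗ α ↦ a(α)`; on `F ⊗ ⋀^s F^*` this is the map `μ_s`. -/
def mu : E ⊗[R] E' →ₗ[R] E' := TensorProduct.lift (coact : E →ₐ[R] Module.End R E').toLinearMap

/-- `α ↦ ∑ α₁(η) ⊗ α'`; on `⋀^s F^*` this is the map `σ_s`. -/
def sigma : E' →ₗ[R] E ⊗[R] E' :=
  LinearMap.rTensor E' (act.toLinearMap.flip D.eta ∘ₗ ExteriorAlgebra.ι R) ∘ₗ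
    comulOne R (Module.Dual R F)

/-- Fixed splittings `ℓ_s : ⋀^s F^* → F ⊗ ⋀^(s+1) F^*` of `μ_(s+1)` for `s ≠ n`, with `ℓ_n = 0`, and
`λ_s : ⋀^(n-1) F ⊗ ⋀^s F^* → ⋀^(s+1) F^*` of `σ_(s+1)` for `s ≠ -1`. The maps `ℓ_s` and `λ_s` are the
restrictions of `ell` and `lam`. -/
structure Splittings where
  ell : E' →ₗ[R] E ⊗[R] E'
  lam : E ⊗[R] E' →ₗ[R] E'
  ell_mem : ∀ s : ℤ, ∀ α ∈ extPow R (Module.Dual R F) s, ell α ∈ bidegFD 1 (s + 1)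
  mu_ell : ∀ s : ℤ, s ≠ n → ∀ α ∈ extPow R (Module.Dual R F) s, mu (ell α) = α
  ell_top : ∀ α ∈ extPow R (Module.Dual R F) n, ell α = 0
  lam_mem : ∀ s : ℤ, ∀ z ∈ bidegFD (n - 1) s, lam z ∈ extPow R (Module.Dual R F) (s + 1)
  lam_sigma : ∀ s : ℤ, s ≠ -1 → ∀ α ∈ extPow R (Module.Dual R F) (s + 1), lam (D.sigma α) = α

end BasicData

namespace BasicData.Splittings

variable {D : BasicData R F n} (S : D.Splittings)

/-! ### The modules `[𝔽_r(i)^(n-1)]'`, `[𝔽_r(i)^(n-1)]''`, `[𝔽_r(i)^(1)]'`, `[𝔽_r(i)^(1)]''`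
as submodules of `⋀F ⊗ ⋀F^*`; they are the same for `i = 2` and `i = 3`. -/

/-- The kernel of `λ_(r+1-n)`. -/
def coP (r : ℤ) : Submodule R (E ⊗[R] E') := bidegFD (n - 1) (r + 1 - n) ⊓ LinearMap.ker S.lam

/-- The image of `σ_(r+2-n)`. -/
def coPP (_S : D.Splittings) (r : ℤ) : Submodule R (E ⊗[R] E') :=
  (extPow R (Module.Dual R F) (r + 2 - n)).map D.sigma

/-- The kernel of `μ_(r-1)`. -/
def oneP (_S : D.Splittings) (r : ℤ) : Submodule R (E ⊗[R] E') :=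
  bidegFD 1 (r - 1) ⊓ LinearMap.ker (mu : E ⊗[R] E' →ₗ[R] E')

/-- The image of `ℓ_(r-2)`. -/
def onePP (r : ℤ) : Submodule R (E ⊗[R] E') := (extPow R (Module.Dual R F) (r - 2)).map S.ell

/-! ### The modules `𝕄_r` and `ℕ_r` -/

/-- The part of `𝕄_r` which has a uniform description in `r`. -/
def hatM (r : ℤ) : Submodule R (Total R F) :=
  (⨆ t ∈ {t : ℤ | t ≠ 0 ∧ t ≠ n ∧ t ≠ r + 1 ∧ t ≠ r + 1 - n}, F1 R F r t) ⊔
  (S.coP r).map in2 ⊔ (⨆ t ∈ Set.Icc (2 : ℤ) (n - 2), F2 R F r t) ⊔ (S.oneP r).map in2 ⊔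
  (S.coP r).map in3 ⊔ (⨆ t ∈ Set.Icc (2 : ℤ) (n - 2), F3 R F r t) ⊔ (S.oneP r).map in3 ⊔
  (⨆ t ∈ {t : ℤ | t ≠ 0 ∧ t ≠ n ∧ t ≠ r - 1 ∧ t ≠ r - 1 - n}, F4 R F r t)

/-- The module `𝕄_r`. -/
def MM (r : ℤ) : Submodule R (Total R F) :=
  S.hatM r ⊔
  (if r = 0 then F3 R F 0 0
    else if r = 2 then (S.onePP 2).map in3
    else if r = 2 * n - 2 then (S.coPP (2 * n - 2)).map in3
    else if r = 2 * n then F3 R F (2 * n) n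
    else ⊥)

/-- `N` if the statement `p` is true, and zero otherwise. -/
def chi (p : Prop) [Decidable p] (N : Submodule R (Total R F)) : Submodule R (Total R F) :=
  if p then N else ⊥

/-- The module `N̂_r` which generates the split exact subcomplex. -/
def hatN (r : ℤ) : Submodule R (Total R F) :=
  chi (n ≤ r ∧ r ≤ 2 * n - 1) (F1 R F r n) ⊔
  chi (n ≤ r ∧ r ≤ 2 * n - 2) (F1 R F r (r + 1 - n)) ⊔
  chi (0 ≤ r ∧ r ≤ n) (F2 R F r 0) ⊔
  chi (2 ≤ r ∧ r ≤ n + 1) ((S.onePP r).map in2) ⊔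
  chi (1 ≤ r ∧ r ≤ n) (F3 R F r 0) ⊔
  chi (3 ≤ r ∧ r ≤ n + 1) ((S.onePP r).map in3) ⊔
  chi (n + 1 ≤ r ∧ r ≤ 2 * n + 1) (F4 R F r n) ⊔
  chi (n + 1 ≤ r ∧ r ≤ 2 * n) (F4 R F r (r - 1 - n))

/-- The modules of the split exact subcomplex `ℕ` of `𝔽`; its maps are the restrictions of `f_r`. -/
def NN (r : ℤ) : Submodule R (Total R F) := S.hatN r ⊔ (S.hatN (r + 1)).map (D.f (r + 1))

/-! ### The projection `π_r : 𝔽_r → 𝕄_r` -/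

/-- The projection of `𝔽_r(i)^(n-1)` onto `[𝔽_r(i)^(n-1)]''`, with kernel `[𝔽_r(i)^(n-1)]'`. -/
def projCoPP (r : ℤ) : E ⊗[R] E' →ₗ[R] E ⊗[R] E' :=
  D.sigma ∘ₗ S.lam ∘ₗ projFD (n - 1) (r + 1 - n)

/-- The projection of `𝔽_r(i)^(n-1)` onto `[𝔽_r(i)^(n-1)]'`, with kernel `[𝔽_r(i)^(n-1)]''`. -/
def projCoP (r : ℤ) : E ⊗[R] E' →ₗ[R] E ⊗[R] E' :=
  projFD (n - 1) (r + 1 - n) - S.projCoPP r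

/-- The projection of `𝔽_r(i)^(1)` onto `[𝔽_r(i)^(1)]''`, with kernel `[𝔽_r(i)^(1)]'`. -/
def projOnePP (r : ℤ) : E ⊗[R] E' →ₗ[R] E ⊗[R] E' :=
  S.ell ∘ₗ mu ∘ₗ projFD 1 (r - 1)

/-- The projection of `𝔽_r(i)^(1)` onto `[𝔽_r(i)^(1)]'`, with kernel `[𝔽_r(i)^(1)]''`. -/
def projOneP (r : ℤ) : E ⊗[R] E' →ₗ[R] E ⊗[R] E' :=
  projFD 1 (r - 1) - S.projOnePP r

/-- The part common to `i = 2` and `i = 3` of the projection onto `𝕄_r`. -/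
def projMid (r : ℤ) : E ⊗[R] E' →ₗ[R] E ⊗[R] E' :=
  S.projCoP r + (∑ t ∈ Finset.Icc (2 : ℤ) (n - 2), projFD t (r - t)) + S.projOneP r

/-- The projection `π_r` of `𝔽_r = 𝕃_r ⊕ 𝕄_r ⊕ N̂_r` onto `𝕄_r`, where `𝕃_r` is the sum of the
summands of `𝔽_r` which occur neither in `𝕄_r` nor in `N̂_r`. -/
def projM (r : ℤ) : Total R F →ₗ[R] Total R F :=
  in1 ∘ₗ (∑ t ∈ (Finset.Icc (0 : ℤ) n).filter
      (fun t : ℤ => t ≠ 0 ∧ t ≠ n ∧ t ≠ r + 1 ∧ t ≠ r + 1 - n), projDD t (r + 1 - t)) ∘ₗ out1 +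
  in2 ∘ₗ S.projMid r ∘ₗ out2 +
  in3 ∘ₗ (S.projMid r +
    (if r = 0 then projFD 0 0
      else if r = 2 then S.projOnePP 2
      else if r = 2 * n - 2 then S.projCoPP (2 * n - 2)
      else if r = 2 * n then projFD n n
      else 0)) ∘ₗ out3 +
  in4 ∘ₗ (∑ t ∈ (Finset.Icc (0 : ℤ) n).filter
      (fun t : ℤ => t ≠ 0 ∧ t ≠ n ∧ t ≠ r - 1 ∧ t ≠ r - 1 - n), projDD t (r - 1 - t)) ∘ₗ out4

/-! ### The maps `τ_r` -/

/-- The map `1 ⊗ β ↦ β` on `⋀^0 F^* ⊗ ⋀F^*`. -/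
def dropL : E' ⊗[R] E' →ₗ[R] E' :=
  TensorProduct.lid R E' ∘ₗ LinearMap.rTensor E' (scalarPart R (Module.Dual R F))

/-- The map `α ⊗ 1 ↦ α` on `⋀F^* ⊗ ⋀^0 F^*`. -/
def dropR : E' ⊗[R] E' →ₗ[R] E' :=
  TensorProduct.rid R E' ∘ₗ LinearMap.lTensor E' (scalarPart R (Module.Dual R F))

/-- The map `η ⊗ β ↦ β` on `⋀^n F ⊗ ⋀F^*`. -/
def dropEta (D : BasicData R F n) : E ⊗[R] E' →ₗ[R] E' :=
  TensorProduct.lid R E' ∘ₗ LinearMap.rTensor E' (scalarPart R F ∘ₗ act D.eps)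

/-- The map `β ↦ x ⊗ β`. -/
def tensorL {A : Type*} [AddCommGroup A] [Module R A] (x : A) : E' →ₗ[R] A ⊗[R] E' :=
  TensorProduct.mk R A E' x

/-- The map `β ↦ β ⊗ x`. -/
def tensorR (x : E') : E' →ₗ[R] E' ⊗[R] E' := (TensorProduct.mk R E' E').flip x

/-- `g` if the statement `p` is true, and zero otherwise. -/
def chiMap {A B : Type*} [AddCommGroup A] [Module R A] [AddCommGroup B] [Module R B]
    (p : Prop) [Decidable p] (g : A →ₗ[R] B) : A →ₗ[R] B :=
  if p then g else 0

/-- The summands `τ_r(i)` of `τ_r`, for `i = 1, 2, 3, 4`; in the cases `i = 2, 3` the elements of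
`[𝔽_r(i)^(n-1)]''` are written as `σ(β)`, so that `β` is recovered by `λ`. -/
def tau1 (_S : D.Splittings) (r : ℤ) : E' ⊗[R] E' →ₗ[R] Total R F :=
  chiMap (-1 ≤ r ∧ r ≤ n - 1)
    ((r + 1).negOnePow • (in2 ∘ₗ tensorL (1 : E)) ∘ₗ dropL ∘ₗ projDD 0 (r + 1)) +
  chiMap (0 ≤ r ∧ r ≤ n - 1)
    (r.negOnePow • (in3 ∘ₗ tensorL (1 : E)) ∘ₗ dropR ∘ₗ projDD (r + 1) 0)

def tau2 (r : ℤ) : E ⊗[R] E' →ₗ[R] Total R F :=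
  chiMap (n - 1 ≤ r ∧ r ≤ 2 * n - 2)
    ((in1 ∘ₗ tensorL D.eps +
      chiMap (r = n - 1) ((n : ℤ).negOnePow •
        ((scalarPart R (Module.Dual R F) ∘ₗ coact (ExteriorAlgebra.ι R D.v)).smulRight
          (in3 ((1 : E) ⊗ₜ D.eps))))) ∘ₗ S.lam ∘ₗ projFD (n - 1) (r + 1 - n)) +
  chiMap (n ≤ r ∧ r ≤ 2 * n)
    (((r + 1).negOnePow • (in4 ∘ₗ tensorL D.eps) +
      chiMap (r = n) ((scalarPart R (Module.Dual R F)).smulRight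
        (in3 (S.ell (coact (ExteriorAlgebra.ι R D.u) D.eps))))) ∘ₗ dropEta D ∘ₗ projFD n (r - n))

def tau3 (r : ℤ) : E ⊗[R] E' →ₗ[R] Total R F :=
  chiMap (n - 1 ≤ r ∧ r ≤ 2 * n - 3)
    ((in1 ∘ₗ tensorR D.eps -
      chiMap (r = n - 1)
        ((scalarPart R (Module.Dual R F) ∘ₗ coact (ExteriorAlgebra.ι R D.u)).smulRight
          (in2 ((1 : E) ⊗ₜ D.eps)))) ∘ₗ S.lam ∘ₗ projFD (n - 1) (r + 1 - n)) +
  chiMap (n ≤ r ∧ r ≤ 2 * n - 1)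
    (((r + 1).negOnePow • (in4 ∘ₗ tensorR D.eps) +
      chiMap (r = n) ((n : ℤ).negOnePow • (scalarPart R (Module.Dual R F)).smulRight
        (in2 (S.ell (coact (ExteriorAlgebra.ι R D.v) D.eps))))) ∘ₗ dropEta D ∘ₗ projFD n (r - n))

def tau4 (r : ℤ) : E' ⊗[R] E' →ₗ[R] Total R F :=
  chiMap (1 ≤ r ∧ r ≤ n) (in2 ∘ₗ S.ell ∘ₗ dropL ∘ₗ projDD 0 (r - 1)) -
  chiMap (2 ≤ r ∧ r ≤ n) (in3 ∘ₗ S.ell ∘ₗ dropR ∘ₗ projDD (r - 1) 0)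

/-- The map `τ_r : 𝕃_r → N̂_(r+1)`, extended to `𝔽_r` by zero on `𝕄_r ⊕ N̂_r`. -/
def tau (r : ℤ) : Total R F →ₗ[R] Total R F :=
  S.tau1 r ∘ₗ out1 + S.tau2 r ∘ₗ out2 + S.tau3 r ∘ₗ out3 + S.tau4 r ∘ₗ out4

/-! ### The maps `ψ_r` and `m_r` -/

/-- The map `ψ_r : 𝔽_r → 𝕄_r`: the identity on `𝕄_r`, zero on `N̂_r`, and `-π_r ∘ f_(r+1) ∘ τ_r`
on `𝕃_r`. -/
def psi (r : ℤ) : Total R F →ₗ[R] Total R F :=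
  S.projM r - S.projM r ∘ₗ D.f (r + 1) ∘ₗ S.tau r

/-- The map `m_r = ψ_(r-1) ∘ f_r`; it is applied to `𝕄_r` only. -/
def m (r : ℤ) : Total R F →ₗ[R] Total R F := S.psi (r - 1) ∘ₗ D.f r

end BasicData.Splittings

end Complexes

/-! ## Complexes of submodules of a fixed module -/

section SubComplex

variable {R : Type uR} [CommRing R] {T : Type uT} [AddCommGroup T] [Module R T]

/-- The maps `d_r` restrict to `C_r → C_(r-1)` and form a complex there. -/
structure IsComplex (C : ℤ → Submodule R T) (d : ℤ → T →ₗ[R] T) : Prop where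
  mapsTo : ∀ r, ∀ x ∈ C r, d r x ∈ C (r - 1)
  sq_zero : ∀ r, ∀ x ∈ C r, d (r - 1) (d r x) = 0

namespace IsComplex

variable {C : ℤ → Submodule R T} {d : ℤ → T →ₗ[R] T}

theorem mapsTo' (h : IsComplex C d) {i j : ℤ} (hij : j + 1 = i) : ∀ x ∈ C i, d i x ∈ C j := by
  obtain rfl : j = i - 1 := by omega
  exact h.mapsTo i

/-- The restricted map `d_r : C_r → C_(r-1)`. -/
def diff (h : IsComplex C d) (r : ℤ) : C r →ₗ[R] C (r - 1) := (d r).restrict (h.mapsTo r)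

/-- The complex `⋯ → C_r → C_(r-1) → ⋯` of `R`-modules. -/
def toChainComplex (h : IsComplex C d) : ChainComplex (ModuleCat.{uT} R) ℤ where
  X r := ModuleCat.of R (C r)
  d i j := if hij : j + 1 = i then
    ModuleCat.ofHom ((d i).restrict (h.mapsTo' hij)) else 0
  shape i j hij := dif_neg hij
  d_comp_d' i j k hij hjk := by
    have hij' : j + 1 = i := hij
    have hjk' : k + 1 = j := hjk
    rw [dif_pos hij', dif_pos hjk']
    obtain rfl : j = i - 1 := by omega
    ext x
    exact h.sq_zero i x.1 x.2

end IsComplex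

/-- The maps `g_r` restrict to a map of complexes `C_r → C'_r`. -/
structure IsChainMap (C : ℤ → Submodule R T) (d : ℤ → T →ₗ[R] T)
    (C' : ℤ → Submodule R T) (d' : ℤ → T →ₗ[R] T) (g : ℤ → T →ₗ[R] T) : Prop where
  mapsTo : ∀ r, ∀ x ∈ C r, g r x ∈ C' r
  comm : ∀ r, ∀ x ∈ C r, d' r (g r x) = g (r - 1) (d r x)

/-- The map of complexes of `R`-modules which is given by the restrictions of `g_r`. -/
def IsChainMap.toHom {C : ℤ → Submodule R T} {d : ℤ → T →ₗ[R] T}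
    {C' : ℤ → Submodule R T} {d' : ℤ → T →ₗ[R] T} {g : ℤ → T →ₗ[R] T}
    (hg : IsChainMap C d C' d' g) (h : IsComplex C d) (h' : IsComplex C' d') :
    Quiver.Hom h.toChainComplex h'.toChainComplex where
  f r := ModuleCat.ofHom ((g r).restrict (hg.mapsTo r))
  comm' i j hij := by
    have hij' : j + 1 = i := hij
    obtain rfl : j = i - 1 := by omega
    dsimp only [IsComplex.toChainComplex]
    rw [dif_pos hij', dif_pos hij']
    ext x
    exact hg.comm i x.1 x.2

/-- The ideal `I_1(g)` of a linear map `g : A → B`, that is, the image of `A ⊗ B^* → R`. -/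
def I1 {A B : Type*} [AddCommGroup A] [Module R A] [AddCommGroup B] [Module R B]
    (g : A →ₗ[R] B) : Ideal R :=
  Ideal.span {c | ∃ (x : A) (φ : Module.Dual R B), φ (g x) = c}

end SubComplex

/-! ## Matrices -/

section Matrices

variable {R : Type uR} [CommRing R] {F : Type uF} [AddCommGroup F] [Module R F] {n : ℕ}

/-- The ideal `I_1(uX) + I_1(Xv) + I_1(vu - Adj X)` of a row `u`, a square matrix `X`, a column `v`. -/
def idealH (u : Fin n → R) (X : Matrix (Fin n) (Fin n) R) (v : Fin n → R) : Ideal R :=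
  Ideal.span {c | ∃ j, c = Matrix.vecMul u X j} ⊔
  Ideal.span {c | ∃ i, c = X.mulVec v i} ⊔
  Ideal.span {c | ∃ i j, c = (Matrix.vecMulVec v u - X.adjugate) i j}

/-- A basis `e_1, …, e_n` of `F` with dual basis `ε_1, …, ε_n` such that `e_1 ∧ ⋯ ∧ e_n = η` and
`ε_n ∧ ⋯ ∧ ε_1` is the orientation element of `⋀^n F^*`. -/
structure IsAdapted (D : BasicData R F n) (b : Module.Basis (Fin n) R F) : Prop where
  wedge_eq : ExteriorAlgebra.ιMulti R n b = D.eta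
  dual_wedge_eq : ExteriorAlgebra.ιMulti R n (fun i => b.coord i.rev) = D.eps

/-- The matrix of `X` with respect to a basis of `F` and its dual basis:
`X(e_j) = ∑ i, x_ij ε_i`. -/
def matrixOf (D : BasicData R F n) (b : Module.Basis (Fin n) R F) : Matrix (Fin n) (Fin n) R :=
  Matrix.of fun i j => D.X (b j) (b i)

end Matrices

end TwoSequences

end

open scoped TensorProduct

noncomputable section

namespace TwoSequences

universe uR uF uT

/-! ### Grade involution, scalar part and the first component of the comultiplication. -/

section ExteriorBasics

variable {R : Type uR} [CommRing R] {V : Type uF} [AddCommGroup V] [Module R V]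

local notation "ex" => ExteriorAlgebra R V

/-! The complex. After a choice of basis all components of `f` are built from a few operators:
contractions by `u`, `v`, `X^*(u)`, `X(v)`; the map `⋀X`; the cofactor map `A_Y(α) =
[(⋀Y)(α(η))](η)` (`mapA`); and the canonical element of `F^* ⊗ F` acting on `⋀F ⊗ ⋀F^*` (`cas`). The
relevant part of the comultiplication is `∑ e_i ⊗ ε_i(x)` (`comulOne_eq_sum`), so the terms of `f`
that involve `Δ` are `cas ∘ (A_Y ⊗ 1)` and `(⋀Y ⊗ 1) ∘ cas` (`mapB_eq`, `mapC_eq`). Evaluation at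
`η` is linear over `⋀F` and inverse to evaluation at `ε`. Hence `A_Y`, for `Y` adjoint to `X`, is an
adjugate of `⋀X`: both composites are multiplication by the determinant (`mapA_map`, `map_mapA`),
and `A_X`, `A_Y` are transposes of each other in degrees 1 and 2 (`sum_mapA_one`, `sum_mapA_two`).
With these rules `f ∘ f = 0` is a cancellation of signed terms (`f_f`).

The elimination. Each summand of `𝕃` is joined to a summand of `N̂`, one degree higher, by a
component of `f` that is an isomorphism; `τ` inverts these components. Three facts suffice: `τ f =
1` on `N̂` (`tau_f`), `τ` vanishes on `𝕄` and `N̂` (`tau_MM`, `tau_hatN`), and `1 - f τ` maps `𝔽`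
into `𝕄 + N̂` (`sub_f_tau_mem`). Formally (`Elimination`), `ψ = π (1 - f τ)` then kills `N̂` and
`f(N̂)` and commutes with the differentials, `τ` contracts `ℕ`, and `1 - τ f` is a homotopy inverse
of `ψ`. The Kronecker delta terms of `τ` make the identities hold where two such pairs interfere.
The elements `1 ⊗ 1` and `ε ⊗ ε` of the first and fourth summands have a possible partner both in
the second and in the third summand; the partner in the second is used, and the four unused ones are
the exceptional summands of `𝕄` in degrees `0`, `2`, `2n - 2`, `2n`.

Entries. The operators above have entries in the ideal of `u`, `v`, `X` except `⋀X` in degree 0,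
`A_X` in degree `n`, and the contraction `μ` which comes from `cas` on `F ⊗ ⋀F^*`. The bidegrees and
kernels that define `𝕄` avoid all three, with two exceptions: the lowest summand of `𝕄_0`, whose
target is zero, and the exceptional summand of `𝕄_2`, where `ψ` rewrites the unit term
(`m_in3_ell_mem`). As `𝕄_r` is a retract of a finite free module, it is finitely generated and
projective, and the entries may be measured in the ambient module.

Homology. `𝕄_0` is `R` times `[1 ⊗ 1]_3`. Modulo `ℕ_0` the element `[α ⊗ 1]_1` is `-α(u) [1 ⊗ 1]_3`,
and `[1 ⊗ β]_1` is zero. So the three types of generators of `𝕄_1` go to the entries of `uX`, to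
those of `Xv`, and to a signed cofactor minus `v_j u_i`; the cofactor comes from Cramer's rule
(`scalarPart_act_mapA`) and its sign from the reversed wedge in `ε` (`ιMulti_rev`). -/

theorem ext_left_induction {P : ExteriorAlgebra R V → Prop}
    (scalar : ∀ r : R, P (algebraMap R _ r)) (add : ∀ x y, P x → P y → P (x + y))
    (ι_mul : ∀ a x, P x → P (ExteriorAlgebra.ι R a * x)) (x : ExteriorAlgebra R V) : P x :=
  CliffordAlgebra.left_induction (0 : QuadraticForm R V) scalar add (fun x a => ι_mul a x) x

variable (R V) in
/-- The grade involution of the exterior algebra. -/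
def inv : ExteriorAlgebra R V →ₐ[R] ExteriorAlgebra R V :=
  CliffordAlgebra.involute (Q := (0 : QuadraticForm R V))

@[simp] theorem inv_ι (a : V) : inv R V (ExteriorAlgebra.ι R a) = -ExteriorAlgebra.ι R a :=
  CliffordAlgebra.involute_ι a

@[simp] theorem inv_inv (x : ExteriorAlgebra R V) : inv R V (inv R V x) = x :=
  CliffordAlgebra.involute_involute x

theorem inv_of_mem {i : ℕ} {x : ExteriorAlgebra R V} (hx : x ∈ ⋀[R]^i V) :
    inv R V x = (-1 : ℤˣ) ^ i • x := by
  induction hx using Submodule.pow_induction_on_left' with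
  | algebraMap r => simp
  | add x y i hx hy ihx ihy => rw [map_add, ihx, ihy, smul_add]
  | mem_mul m hm i x hx ih =>
    obtain ⟨a, rfl⟩ := hm
    rw [map_mul, ih, inv_ι, pow_succ]
    rcases Int.units_eq_one_or ((-1 : ℤˣ) ^ i) with h | h <;> rw [h] <;> simp

@[simp] theorem scalarPart_algebraMap (c : R) :
    scalarPart R V (algebraMap R _ c) = c := ExteriorAlgebra.algebraMap_leftInverse V c

@[simp] theorem scalarPart_one : scalarPart R V 1 = 1 := by
  simpa using scalarPart_algebraMap (V := V) (1 : R)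

@[simp] theorem scalarPart_ι_mul (a : V) (x : ExteriorAlgebra R V) :
    scalarPart R V (ExteriorAlgebra.ι R a * x) = 0 := by
  simp [scalarPart, ExteriorAlgebra.algebraMapInv]

theorem scalarPart_inv (x : ExteriorAlgebra R V) :
    scalarPart R V (inv R V x) = scalarPart R V x := by
  induction x using ext_left_induction with
  | scalar r => rw [AlgHom.commutes]
  | add x y hx hy => simp [hx, hy]
  | ι_mul a x hx => simp

@[simp] theorem ιInv_algebraMap (c : R) :
    ExteriorAlgebra.ιInv (algebraMap R (ExteriorAlgebra R V) c) = 0 := by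
  simp only [ExteriorAlgebra.ιInv, LinearMap.comp_apply, AlgHom.toLinearMap_apply,
    AlgHom.commutes]
  exact TrivSqZeroExt.snd_inl V c

/-- In the trivial square-zero extension the degree 1 part of a product pairs degree 0 with degree
1, and `ι a` has no degree 0 part. -/
theorem ιInv_ι_mul (a : V) (x : ExteriorAlgebra R V) :
    ExteriorAlgebra.ιInv (ExteriorAlgebra.ι R a * x) = scalarPart R V x • a := by
  -- The right action must be the one inside the definition of `ExteriorAlgebra.ιInv`, so that both
  -- sides refer to the same square-zero extension.
  let _ : Module Rᵐᵒᵖ V := Module.compHom _ ((RingHom.id R).fromOpposite mul_comm)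
  have _ : IsCentralScalar R V := ⟨fun r m => rfl⟩
  have h : ∀ y : ExteriorAlgebra R V,
      (ExteriorAlgebra.toTrivSqZeroExt y).fst = scalarPart R V y := by
    intro y
    induction y using ext_left_induction with
    | scalar r =>
      rw [AlgHom.commutes, scalarPart_algebraMap]
      exact TrivSqZeroExt.fst_inl V r
    | add x y hx hy => simp [hx, hy]
    | ι_mul a x hx => simp
  have h2 : ∀ y : ExteriorAlgebra R V,
      ExteriorAlgebra.ιInv y = (ExteriorAlgebra.toTrivSqZeroExt y).snd := fun y => rfl
  rw [h2, map_mul, TrivSqZeroExt.snd_mul]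
  simp [h]

theorem ιInv_inv (x : ExteriorAlgebra R V) :
    ExteriorAlgebra.ιInv (inv R V x) = -ExteriorAlgebra.ιInv x := by
  induction x using ext_left_induction with
  | scalar r => rw [AlgHom.commutes]; simp
  | add x y hx hy => simp [hx, hy]; abel
  | ι_mul a x hx => rw [map_mul, inv_ι, neg_mul, map_neg, ιInv_ι_mul, ιInv_ι_mul, scalarPart_inv]

/-! ### The first component of the comultiplication -/

local notation "gr" => (fun i : ℕ => ⋀[R]^i V)

theorem tmul_ι_one_mul (a : V) (y z : ex) :
    (GradedTensorProduct.tmul R (ExteriorAlgebra.ι R a) 1 * GradedTensorProduct.tmul R y z :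
      ExtSq R V) = GradedTensorProduct.tmul R (ExteriorAlgebra.ι R a * y) z := by
  induction y using DirectSum.Decomposition.inductionOn (ℳ := gr) with
  | zero => simp [GradedTensorProduct.tmul]
  | homogeneous y => exact GradedTensorProduct.tmul_one_mul_coe_tmul gr gr _ y z
  | add y y' hy hy' =>
    simp only [GradedTensorProduct.tmul, TensorProduct.add_tmul, map_add, mul_add] at hy hy' ⊢
    rw [hy, hy']

/-- The odd element `ι a` has to pass `y` on its way to the second factor; the Koszul sign is
recorded by the involution. -/
theorem tmul_one_ι_mul (a : V) (y z : ex) :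
    (GradedTensorProduct.tmul R 1 (ExteriorAlgebra.ι R a) * GradedTensorProduct.tmul R y z :
      ExtSq R V) = GradedTensorProduct.tmul R (inv R V y) (ExteriorAlgebra.ι R a * z) := by
  induction y using DirectSum.Decomposition.inductionOn (ℳ := gr) with
  | zero => simp [GradedTensorProduct.tmul]
  | @homogeneous i y =>
    have h := GradedTensorProduct.tmul_coe_mul_coe_tmul (R := R) gr gr (j₁ := 1) (i₂ := i) 1
      ⟨_, ι_mem_one R V a⟩ y z
    refine h.trans ?_
    rw [inv_of_mem y.2, one_mul, one_mul]
    rcases Int.units_eq_one_or ((-1 : ℤˣ) ^ i) with h | h <;>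
      rw [h] <;> simp [GradedTensorProduct.tmul, TensorProduct.neg_tmul]
  | add y y' hy hy' =>
    simp only [GradedTensorProduct.tmul, TensorProduct.add_tmul, map_add, mul_add] at hy hy' ⊢
    rw [hy, hy']

theorem diagonal_mul (a : V) (y z : ex) :
    (diagonal R V a * GradedTensorProduct.tmul R y z : ExtSq R V) =
      GradedTensorProduct.tmul R (ExteriorAlgebra.ι R a * y) z +
      GradedTensorProduct.tmul R (inv R V y) (ExteriorAlgebra.ι R a * z) := by
  rw [← tmul_ι_one_mul, ← tmul_one_ι_mul, ← add_mul]
  rfl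

theorem comul_ι_mul (a : V) (x : ex) :
    comul R V (ExteriorAlgebra.ι R a * x) = diagonal R V a * comul R V x := by
  rw [map_mul]
  congr 1
  simp [comul]

variable (R V) in
/-- The comultiplication with values in the ordinary tensor product. -/
def comulT : ex →ₗ[R] ex ⊗[R] ex :=
  (GradedTensorProduct.of R gr gr).symm.toLinearMap ∘ₗ (comul R V).toLinearMap

variable (R V) in
/-- The multiplication by the diagonal of `a`, on the ordinary tensor product. -/
def diagMul (a : V) : ex ⊗[R] ex →ₗ[R] ex ⊗[R] ex :=
  LinearMap.rTensor _ (LinearMap.mulLeft R (ExteriorAlgebra.ι R a)) +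
    TensorProduct.map (inv R V).toLinearMap (LinearMap.mulLeft R (ExteriorAlgebra.ι R a))

theorem comulT_one : comulT R V 1 = 1 ⊗ₜ 1 := by
  simp [comulT]; rfl

theorem comulT_ι_mul (a : V) (x : ex) :
    comulT R V (ExteriorAlgebra.ι R a * x) = diagMul R V a (comulT R V x) := by
  have h : ∀ w : ex ⊗[R] ex, (GradedTensorProduct.of R gr gr).symm
      (diagonal R V a * GradedTensorProduct.of R gr gr w) = diagMul R V a w := by
    intro w
    induction w using TensorProduct.induction_on with
    | zero => simp
    | tmul y z => exact congrArg _ (diagonal_mul a y z)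
    | add w w' hw hw' => simp only [map_add, mul_add, hw, hw']
  rw [comulT, LinearMap.comp_apply, AlgHom.toLinearMap_apply, comul_ι_mul]
  exact h _

/-- The counit axiom; it supplies the leading term `a ⊗ x` in the recursion for `comulOne`. -/
theorem counit_comulT (x : ex) :
    LinearMap.rTensor ex (scalarPart R V) (comulT R V x) = 1 ⊗ₜ x := by
  induction x using ext_left_induction with
  | scalar r =>
    rw [Algebra.algebraMap_eq_smul_one, map_smul, map_smul, comulT_one]
    simp
  | add x y hx hy => rw [map_add, map_add, hx, hy, TensorProduct.tmul_add]
  | ι_mul a x hx =>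
    have h : ∀ w, LinearMap.rTensor ex (scalarPart R V) (diagMul R V a w) =
        LinearMap.lTensor R (LinearMap.mulLeft R (ExteriorAlgebra.ι R a))
          (LinearMap.rTensor ex (scalarPart R V) w) := by
      intro w
      induction w using TensorProduct.induction_on with
      | zero => simp
      | tmul y z => simp [diagMul, scalarPart_inv]
      | add w w' hw hw' => simp only [map_add, hw, hw']
    rw [comulT_ι_mul, h, hx]
    simp

theorem comulOne_one : comulOne R V 1 = 0 := by
  change LinearMap.rTensor ex ExteriorAlgebra.ιInv (comulT R V 1) = 0
  rw [comulT_one, LinearMap.rTensor_tmul, ← map_one (algebraMap R _), ιInv_algebraMap,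
    TensorProduct.zero_tmul]

/-- Multiplication by the diagonal puts `a` in the first slot, where only the degree 0 part of the
left factor survives projection to degree 1, or in the second slot, where a left factor of degree 1
contributes the sign. The outcome is the Leibniz recursion of a contraction. -/
theorem comulOne_ι_mul (a : V) (x : ex) :
    comulOne R V (ExteriorAlgebra.ι R a * x) =
      a ⊗ₜ x - LinearMap.lTensor V (LinearMap.mulLeft R (ExteriorAlgebra.ι R a))
        (comulOne R V x) := by
  change LinearMap.rTensor ex ExteriorAlgebra.ιInv (comulT R V _) = _ -
    LinearMap.lTensor V _ (LinearMap.rTensor ex ExteriorAlgebra.ιInv (comulT R V x))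
  have h : ∀ w, LinearMap.rTensor ex ExteriorAlgebra.ιInv (diagMul R V a w) =
      LinearMap.rTensor ex (LinearMap.toSpanSingleton R V a)
          (LinearMap.rTensor ex (scalarPart R V) w) -
        LinearMap.lTensor V (LinearMap.mulLeft R (ExteriorAlgebra.ι R a))
          (LinearMap.rTensor ex ExteriorAlgebra.ιInv w) := by
    intro w
    induction w using TensorProduct.induction_on with
    | zero => simp
    | tmul y z =>
      simp [diagMul, ιInv_inv, ιInv_ι_mul, TensorProduct.neg_tmul, sub_eq_add_neg]
    | add w w' hw hw' => simp only [map_add, hw, hw']; abel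
  rw [comulT_ι_mul, h, counit_comulT]
  simp

/-- Both sides vanish on scalars and obey the same recursion under left multiplication by a vector.
Through this formula the graded tensor product disappears from the rest of the argument. -/
theorem comulOne_eq_sum {ι : Type*} [Fintype ι] (b : Module.Basis ι R V) (x : ex) :
    comulOne R V x = ∑ i, b i ⊗ₜ[R] (CliffordAlgebra.contractLeft (b.coord i) x : ex) := by
  induction x using ext_left_induction with
  | scalar r =>
    rw [Algebra.algebraMap_eq_smul_one, map_smul, comulOne_one, ← Algebra.algebraMap_eq_smul_one]
    simp [CliffordAlgebra.contractLeft_algebraMap]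
  | add x y hx hy => simp only [map_add, hx, hy, TensorProduct.tmul_add, Finset.sum_add_distrib]
  | ι_mul a x hx =>
    rw [comulOne_ι_mul, hx, map_sum]
    have h : a ⊗ₜ[R] x = ∑ i, b i ⊗ₜ[R] (b.coord i a • x) := by
      conv_lhs => rw [← b.sum_repr a, TensorProduct.sum_tmul]
      simp [TensorProduct.smul_tmul]
    rw [h, ← Finset.sum_sub_distrib]
    refine Finset.sum_congr rfl fun i _ => ?_
    rw [LinearMap.lTensor_tmul, ← TensorProduct.tmul_sub]
    congr 1
    exact (CliffordAlgebra.contractLeft_ι_mul (d := b.coord i) a x).symm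

end ExteriorBasics

/-! ### Homogeneous pieces in integer degrees. -/

section Degrees

variable {R : Type uR} [CommRing R] {V : Type uF} [AddCommGroup V] [Module R V]
variable {W : Type*} [AddCommGroup W] [Module R W]

theorem extPow_natCast (t : ℕ) : extPow R V t = ⋀[R]^t V := by simp [extPow]

theorem extPow_of_neg {t : ℤ} (ht : t < 0) : extPow R V t = ⊥ := if_neg (by omega)

theorem eq_zero_of_mem_neg {t : ℤ} (ht : t < 0) {x : ExteriorAlgebra R V}
    (hx : x ∈ extPow R V t) : x = 0 := by
  rw [extPow_of_neg ht] at hx; exact hx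

theorem extPow_cast {s t : ℤ} {x : ExteriorAlgebra R V} (hx : x ∈ extPow R V s) (h : s = t) :
    x ∈ extPow R V t := h ▸ hx

theorem ι_mul_mem_extPow (a : V) {t : ℤ} {x : ExteriorAlgebra R V} (hx : x ∈ extPow R V t) :
    ExteriorAlgebra.ι R a * x ∈ extPow R V (t + 1) := by
  rcases lt_or_ge t 0 with h | h
  · rw [eq_zero_of_mem_neg h hx, mul_zero]; exact zero_mem _
  · lift t to ℕ using h
    rw [extPow_natCast] at hx
    have : ((t : ℤ) + 1) = ((t + 1 : ℕ) : ℤ) := by push_cast; ring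
    rw [this, extPow_natCast, add_comm t 1]
    change _ ∈ LinearMap.range (ExteriorAlgebra.ι R) ^ (1 + t)
    rw [pow_add, pow_one]
    exact Submodule.mul_mem_mul (LinearMap.mem_range_self _ _) hx

theorem algebraMap_mem_extPow (c : R) : algebraMap R _ c ∈ extPow R V 0 := by
  rw [← Nat.cast_zero, extPow_natCast]
  change _ ∈ LinearMap.range (ExteriorAlgebra.ι R) ^ 0
  rw [pow_zero]
  exact Submodule.algebraMap_mem c

theorem one_mem_extPow : (1 : ExteriorAlgebra R V) ∈ extPow R V 0 := by
  simpa using algebraMap_mem_extPow (V := V) (1 : R)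

theorem ι_mem_extPow (a : V) : ExteriorAlgebra.ι R a ∈ extPow R V 1 := by
  simpa using ι_mul_mem_extPow a one_mem_extPow

/-- Integer degrees turn the later bookkeeping into linear arithmetic; the case `zero` absorbs the
negative degrees. -/
theorem extPow_induction {P : ∀ (t : ℤ) (x : ExteriorAlgebra R V), x ∈ extPow R V t → Prop}
    (zero : ∀ t, P t 0 (zero_mem _))
    (scalar : ∀ r : R, P 0 (algebraMap R _ r) (algebraMap_mem_extPow r))
    (add : ∀ t x y hx hy, P t x hx → P t y hy → P t (x + y) (add_mem hx hy))
    (ι_mul : ∀ a t x hx, P t x hx → P (t + 1) (ExteriorAlgebra.ι R a * x) (ι_mul_mem_extPow a hx))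
    {t : ℤ} {x : ExteriorAlgebra R V} (hx : x ∈ extPow R V t) : P t x hx := by
  rcases lt_or_ge t 0 with h | h
  · obtain rfl := eq_zero_of_mem_neg h hx
    exact zero t
  · lift t to ℕ using h
    have hx' := hx
    rw [extPow_natCast] at hx'
    induction hx' using Submodule.pow_induction_on_left' with
    | algebraMap r => exact scalar r
    | add x y i hx' hy' ihx ihy =>
      have hx : x ∈ extPow R V i := by rw [extPow_natCast]; exact hx'
      have hy : y ∈ extPow R V i := by rw [extPow_natCast]; exact hy'
      exact add _ _ _ hx hy (ihx hx) (ihy hy)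
    | mem_mul m hm i x hx' ih =>
      obtain ⟨a, rfl⟩ := hm
      have hx : x ∈ extPow R V i := by rw [extPow_natCast]; exact hx'
      have h := ι_mul a i x hx (ih hx)
      have e : ((i.succ : ℕ) : ℤ) = i + 1 := by push_cast; ring
      simp only [e]
      exact h

theorem map_mem_extPow (f : V →ₗ[R] W) {t : ℤ} {x : ExteriorAlgebra R V}
    (hx : x ∈ extPow R V t) : ExteriorAlgebra.map f x ∈ extPow R W t := by
  induction hx using extPow_induction with
  | zero s => rw [map_zero]; exact zero_mem _
  | scalar r => rw [AlgHom.commutes]; exact algebraMap_mem_extPow r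
  | add s x x' _ _ hx hx' => rw [map_add]; exact add_mem hx hx'
  | ι_mul a s x _ ih =>
    rw [map_mul, ExteriorAlgebra.map_apply_ι]; exact ι_mul_mem_extPow _ ih

theorem exists_algebraMap_of_mem {x : ExteriorAlgebra R V} (hx : x ∈ extPow R V 0) :
    ∃ c : R, x = algebraMap R _ c := by
  rw [← Nat.cast_zero, extPow_natCast] at hx
  change x ∈ LinearMap.range (ExteriorAlgebra.ι R) ^ 0 at hx
  rw [pow_zero] at hx
  obtain ⟨c, hc⟩ := Submodule.mem_one.1 hx
  exact ⟨c, hc.symm⟩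

theorem eq_scalarPart_of_mem {x : ExteriorAlgebra R V} (hx : x ∈ extPow R V 0) :
    x = algebraMap R _ (scalarPart R V x) := by
  obtain ⟨c, rfl⟩ := exists_algebraMap_of_mem hx
  rw [scalarPart_algebraMap]

theorem exists_ι_of_mem {x : ExteriorAlgebra R V} (hx : x ∈ extPow R V 1) :
    ∃ a : V, x = ExteriorAlgebra.ι R a := by
  rw [← Nat.cast_one, extPow_natCast] at hx
  change x ∈ LinearMap.range (ExteriorAlgebra.ι R) ^ 1 at hx
  rw [pow_one] at hx
  obtain ⟨c, hc⟩ := hx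
  exact ⟨c, hc.symm⟩

/-- An alternating map in more than `n` arguments vanishes by the pigeonhole principle on tuples
from a basis of `n` elements. -/
theorem extPow_eq_bot_of_lt {n : ℕ} (b : Module.Basis (Fin n) R V) {t : ℤ} (ht : n < t) :
    extPow R V t = ⊥ := by
  lift t to ℕ using by omega
  rw [extPow_natCast, ← ExteriorAlgebra.ιMulti_span_fixedDegree, Submodule.span_eq_bot]
  rintro _ ⟨v, rfl⟩
  have h : ExteriorAlgebra.ιMulti R t (M := V) = 0 := by
    refine Module.Basis.ext_alternating b fun v hv => ?_
    exact absurd (Fintype.card_le_of_injective v hv) (by simp; omega)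
  rw [h]; rfl

theorem eq_zero_of_mem_gt {n : ℕ} (b : Module.Basis (Fin n) R V) {t : ℤ} (ht : n < t)
    {x : ExteriorAlgebra R V} (hx : x ∈ extPow R V t) : x = 0 := by
  rw [extPow_eq_bot_of_lt b ht] at hx; exact hx

theorem extProj_mem (t : ℤ) (x : ExteriorAlgebra R V) : extProj R V t x ∈ extPow R V t := by
  unfold extProj extPow
  split_ifs
  · rw [GradedAlgebra.proj_apply]; exact SetLike.coe_mem _
  · simp

theorem extProj_of_mem {t : ℤ} {x : ExteriorAlgebra R V} (hx : x ∈ extPow R V t) :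
    extProj R V t x = x := by
  rcases lt_or_ge t 0 with h | h
  · rw [eq_zero_of_mem_neg h hx, map_zero]
  · lift t to ℕ using h
    rw [extPow_natCast] at hx
    simp [extProj, GradedAlgebra.proj_apply, DirectSum.decompose_of_mem_same (fun i : ℕ => ⋀[R]^i V) hx]

theorem extProj_of_mem_ne {s t : ℤ} {x : ExteriorAlgebra R V} (hx : x ∈ extPow R V s)
    (h : s ≠ t) : extProj R V t x = 0 := by
  rcases lt_or_ge s 0 with hs | hs
  · rw [eq_zero_of_mem_neg hs hx, map_zero]
  rcases lt_or_ge t 0 with ht | ht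
  · rw [extProj, if_neg (by omega), LinearMap.zero_apply]
  · lift t to ℕ using ht
    lift s to ℕ using hs
    rw [extPow_natCast] at hx
    simp [extProj, GradedAlgebra.proj_apply,
      DirectSum.decompose_of_mem_ne (fun i : ℕ => ⋀[R]^i V) hx (by exact_mod_cast h)]

theorem mul_ι_eq (a : V) (x : ExteriorAlgebra R V) :
    x * ExteriorAlgebra.ι R a = ExteriorAlgebra.ι R a * inv R V x := by
  induction x using ext_left_induction with
  | scalar r => rw [AlgHom.commutes, Algebra.commutes]
  | add x y hx hy => rw [add_mul, map_add, mul_add, hx, hy]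
  | ι_mul c x hx =>
    rw [mul_assoc, hx, map_mul, inv_ι, ← mul_assoc, ← mul_assoc,
      eq_neg_of_add_eq_zero_left (ExteriorAlgebra.ι_add_mul_swap (R := R) c a)]
    simp

theorem mul_eq_of_mem_one {x y : ExteriorAlgebra R V} (hx : x ∈ extPow R V 1) :
    y * x = x * inv R V y := by
  obtain ⟨a, rfl⟩ := exists_ι_of_mem hx
  exact mul_ι_eq a y

/-- Passing two vectors applies the involution twice, so no sign remains. -/
theorem mul_comm_of_mem_two {x y : ExteriorAlgebra R V} (hx : x ∈ extPow R V 2) :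
    y * x = x * y := by
  have h : ∀ t : ℤ, x ∈ extPow R V t → t = 2 → y * x = x * y := by
    clear hx
    intro t ht
    induction ht using extPow_induction with
    | zero t => simp
    | scalar r => intro h; omega
    | add t x x' _ _ hx hx' => intro h; rw [mul_add, add_mul, hx h, hx' h]
    | ι_mul a t x hx _ =>
      intro h
      obtain rfl : t = 1 := by omega
      obtain ⟨c, rfl⟩ := exists_ι_of_mem hx
      rw [← mul_assoc, mul_ι_eq a, mul_assoc, mul_ι_eq c, inv_inv, mul_assoc]
  exact h 2 hx rfl

end Degrees

/-! ### Contraction along a pairing, treating `act` and `coact` at once. -/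

section PairingAction

variable {R : Type uR} [CommRing R]
variable {V W V' W' : Type*} [AddCommGroup V] [Module R V] [AddCommGroup W] [Module R W]
  [AddCommGroup V'] [Module R V'] [AddCommGroup W'] [Module R W']

/-- The action of `⋀V` on `⋀W` by contraction along a pairing `V → W^*`. -/
def pact (P : V →ₗ[R] Module.Dual R W) :
    ExteriorAlgebra R V →ₐ[R] Module.End R (ExteriorAlgebra R W) :=
  ExteriorAlgebra.lift R ⟨CliffordAlgebra.contractLeft ∘ₗ P, fun a => by
    refine LinearMap.ext fun x => ?_
    exact CliffordAlgebra.contractLeft_contractLeft (P a) x⟩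

theorem act_eq_pact {F : Type*} [AddCommGroup F] [Module R F] :
    (act : ExteriorAlgebra R (Module.Dual R F) →ₐ[R] _) =
      pact (LinearMap.id : Module.Dual R F →ₗ[R] Module.Dual R F) := rfl

theorem coact_eq_pact {F : Type*} [AddCommGroup F] [Module R F] :
    (coact : ExteriorAlgebra R F →ₐ[R] _) = pact (Module.Dual.eval R F) := rfl

variable (P : V →ₗ[R] Module.Dual R W)

theorem pact_ι (v : V) (x : ExteriorAlgebra R W) :
    pact P (ExteriorAlgebra.ι R v) x = CliffordAlgebra.contractLeft (P v) x := by
  rw [pact, ExteriorAlgebra.lift_ι_apply]; rfl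

theorem pact_ι_ι_mul (v : V) (w : W) (x : ExteriorAlgebra R W) :
    pact P (ExteriorAlgebra.ι R v) (ExteriorAlgebra.ι R w * x) =
      P v w • x - ExteriorAlgebra.ι R w * pact P (ExteriorAlgebra.ι R v) x := by
  rw [pact_ι, pact_ι]; exact CliffordAlgebra.contractLeft_ι_mul (d := P v) w x

theorem pact_ι_algebraMap (v : V) (r : R) :
    pact P (ExteriorAlgebra.ι R v) (algebraMap R _ r) = 0 := by
  rw [pact_ι]; exact CliffordAlgebra.contractLeft_algebraMap (d := P v) _ r

theorem pact_ι_ι (v : V) (w : W) :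
    pact P (ExteriorAlgebra.ι R v) (ExteriorAlgebra.ι R w) = algebraMap R _ (P v w) := by
  rw [pact_ι]; exact CliffordAlgebra.contractLeft_ι (d := P v) _ w

theorem pact_mul (x y : ExteriorAlgebra R V) (z : ExteriorAlgebra R W) :
    pact P (x * y) z = pact P x (pact P y z) := by rw [map_mul]; rfl

@[simp] theorem pact_one (z : ExteriorAlgebra R W) : pact P 1 z = z := by rw [map_one]; rfl

theorem pact_ι_ι_self (v : V) (x : ExteriorAlgebra R W) :
    pact P (ExteriorAlgebra.ι R v) (pact P (ExteriorAlgebra.ι R v) x) = 0 := by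
  rw [← pact_mul, ExteriorAlgebra.ι_sq_zero, map_zero]; rfl

theorem pact_ι_comm (v v' : V) (x : ExteriorAlgebra R W) :
    pact P (ExteriorAlgebra.ι R v) (pact P (ExteriorAlgebra.ι R v') x) =
      -pact P (ExteriorAlgebra.ι R v') (pact P (ExteriorAlgebra.ι R v) x) := by
  rw [← pact_mul, ← pact_mul,
    eq_neg_of_add_eq_zero_left (ExteriorAlgebra.ι_add_mul_swap (R := R) v v'), map_neg]
  rfl

theorem pact_ι_mem {t : ℤ} (v : V) {x : ExteriorAlgebra R W} (hx : x ∈ extPow R W t) :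
    pact P (ExteriorAlgebra.ι R v) x ∈ extPow R W (t - 1) := by
  induction hx using extPow_induction with
  | zero t => rw [map_zero]; exact zero_mem _
  | scalar r => rw [pact_ι_algebraMap]; exact zero_mem _
  | add t x y _ _ hx hy => rw [map_add]; exact add_mem hx hy
  | ι_mul a t x hx ih =>
    rw [pact_ι_ι_mul]
    exact sub_mem (Submodule.smul_mem _ _ (extPow_cast hx (by ring)))
      (extPow_cast (ι_mul_mem_extPow a ih) (by ring))

theorem pact_mem {s t : ℤ} {x : ExteriorAlgebra R V} (hx : x ∈ extPow R V s)
    {y : ExteriorAlgebra R W} (hy : y ∈ extPow R W t) : pact P x y ∈ extPow R W (t - s) := by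
  induction hx using extPow_induction with
  | zero s => rw [map_zero]; exact zero_mem _
  | scalar r =>
    rw [Algebra.algebraMap_eq_smul_one, map_smul, LinearMap.smul_apply, pact_one, sub_zero]
    exact Submodule.smul_mem _ _ hy
  | add s x x' _ _ hx hx' => rw [map_add]; exact add_mem hx hx'
  | ι_mul a s x hx ih =>
    rw [pact_mul]; exact extPow_cast (pact_ι_mem P a ih) (by ring)

/-- Contraction is natural with respect to adjoint maps. -/
theorem pact_map (P' : V' →ₗ[R] Module.Dual R W') (f : W →ₗ[R] W') (g : V' →ₗ[R] V)
    (h : ∀ v w, P' v (f w) = P (g v) w) (y : ExteriorAlgebra R V') (z : ExteriorAlgebra R W) :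
    pact P' y (ExteriorAlgebra.map f z) =
      ExteriorAlgebra.map f (pact P (ExteriorAlgebra.map g y) z) := by
  induction y using ext_left_induction generalizing z with
  | scalar r => simp [Algebra.algebraMap_eq_smul_one]
  | add x y hx hy => simp only [map_add, LinearMap.add_apply, hx, hy]
  | ι_mul a x hx =>
    rw [pact_mul, hx, map_mul, pact_mul, ExteriorAlgebra.map_apply_ι]
    generalize pact P (ExteriorAlgebra.map g x) z = z
    induction z using ext_left_induction with
    | scalar r => rw [AlgHom.commutes, pact_ι_algebraMap, pact_ι_algebraMap, map_zero]
    | add x y hx hy => simp only [map_add, hx, hy]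
    | ι_mul w z hz =>
      rw [map_mul, ExteriorAlgebra.map_apply_ι, pact_ι_ι_mul, pact_ι_ι_mul, hz, map_sub, map_mul,
        ExteriorAlgebra.map_apply_ι, map_smul, h]

variable (Q : W →ₗ[R] Module.Dual R V)

/-- The commutator of multiplication by `w` with contraction by `x`. Contraction by a vector `a` is
a derivation, so each exchange of `a` with `w` costs the scalar `P a w`, which is also what
contracting `x` by `w` produces. -/
theorem pact_pact_ι (hPQ : ∀ v w, P v w = Q w v) (w : W) (x : ExteriorAlgebra R V)
    (z : ExteriorAlgebra R W) :
    pact P (pact Q (ExteriorAlgebra.ι R w) x) z =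
      ExteriorAlgebra.ι R w * pact P x z - pact P (inv R V x) (ExteriorAlgebra.ι R w * z) := by
  induction x using ext_left_induction with
  | scalar r =>
    rw [pact_ι_algebraMap, AlgHom.commutes]
    simp [Algebra.algebraMap_eq_smul_one]
  | add x y hx hy =>
    simp only [map_add, LinearMap.add_apply, hx, hy, mul_add]
    abel
  | ι_mul a x hx =>
    rw [pact_ι_ι_mul, map_sub, map_smul, LinearMap.sub_apply, LinearMap.smul_apply, pact_mul, hx,
      map_sub, pact_ι_ι_mul, pact_mul, map_mul (inv R V), inv_ι, neg_mul, map_neg,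
      LinearMap.neg_apply, pact_mul, hPQ]
    abel

/-- For `z` in top degree, `x ↦ x(z)` is linear over the exterior algebra. -/
theorem pact_pact_of_top (hPQ : ∀ v w, P v w = Q w v) {z : ExteriorAlgebra R W}
    (hz : ∀ w, ExteriorAlgebra.ι R w * z = 0) (a : ExteriorAlgebra R W) (x : ExteriorAlgebra R V) :
    pact P (pact Q a x) z = a * pact P x z := by
  induction a using ext_left_induction with
  | scalar r => simp [Algebra.algebraMap_eq_smul_one]
  | add a b ha hb => simp only [map_add, LinearMap.add_apply, add_mul, ha, hb]
  | ι_mul w a ha =>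
    rw [pact_mul, pact_pact_ι P Q hPQ, ha, hz, map_zero, sub_zero, mul_assoc]

end PairingAction

/-! ### The two actions and the canonical element of `F^* ⊗ F`. -/

section ActCoact

variable {R : Type uR} [CommRing R] {F : Type uF} [AddCommGroup F] [Module R F]

local notation "E" => ExteriorAlgebra R F
local notation "E'" => ExteriorAlgebra R (Module.Dual R F)
local notation "ι" => ExteriorAlgebra.ι R

theorem act_mul (x y : E') (z : E) : act (x * y) z = act x (act y z) := by
  simp only [act_eq_pact]; exact pact_mul _ x y z
theorem coact_mul (x y : E) (z : E') : coact (x * y) z = coact x (coact y z) := by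
  simp only [coact_eq_pact]; exact pact_mul _ x y z
@[simp] theorem act_one (z : E) : act (1 : E') z = z := by
  simp only [act_eq_pact]; exact pact_one _ z

@[simp] theorem act_algebraMap (c : R) (z : E) : act (algebraMap R E' c) z = c • z := by
  simp [Algebra.algebraMap_eq_smul_one]
@[simp] theorem coact_algebraMap (c : R) (z : E') : coact (algebraMap R E c) z = c • z := by
  simp [Algebra.algebraMap_eq_smul_one]

theorem act_ι_ι_mul (α : Module.Dual R F) (a : F) (z : E) :
    act (ι α) (ι a * z) = α a • z - ι a * act (ι α) z := by
  simp only [act_eq_pact]; exact pact_ι_ι_mul _ α a z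
theorem coact_ι_ι_mul (a : F) (α : Module.Dual R F) (z : E') :
    coact (ι a) (ι α * z) = α a • z - ι α * coact (ι a) z := by
  simp only [coact_eq_pact]; exact pact_ι_ι_mul _ a α z

theorem act_ι_ι (α : Module.Dual R F) (a : F) : act (ι α) (ι a) = algebraMap R E (α a) := by
  rw [act_eq_pact]; exact pact_ι_ι _ α a
theorem coact_ι_ι (a : F) (α : Module.Dual R F) : coact (ι a) (ι α) = algebraMap R E' (α a) := by
  rw [coact_eq_pact]; exact pact_ι_ι _ a α

theorem coact_ι_algebraMap (a : F) (c : R) : coact (ι a) (algebraMap R E' c) = 0 := by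
  rw [coact_eq_pact]; exact pact_ι_algebraMap _ a c

theorem act_ι_algebraMap (a : Module.Dual R F) (c : R) : act (ι a) (algebraMap R E c) = 0 := by
  rw [act_eq_pact]; exact pact_ι_algebraMap _ a c

theorem act_mem {s t : ℤ} {x : E'} (hx : x ∈ extPow R _ s) {y : E} (hy : y ∈ extPow R F t) :
    act x y ∈ extPow R F (t - s) := by
  simp only [act_eq_pact]; exact pact_mem _ hx hy
theorem coact_mem {s t : ℤ} {x : E} (hx : x ∈ extPow R _ s) {y : E'} (hy : y ∈ extPow R _ t) :
    coact x y ∈ extPow R (Module.Dual R F) (t - s) := by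
  simp only [coact_eq_pact]; exact pact_mem _ hx hy

theorem act_ι_self (α : Module.Dual R F) (z : E) : act (ι α) (act (ι α) z) = 0 := by
  rw [act_eq_pact]; exact pact_ι_ι_self _ α z
theorem coact_ι_self (a : F) (z : E') : coact (ι a) (coact (ι a) z) = 0 := by
  rw [coact_eq_pact]; exact pact_ι_ι_self _ a z
theorem act_ι_comm (α β : Module.Dual R F) (z : E) :
    act (ι α) (act (ι β) z) = -act (ι β) (act (ι α) z) := by
  simp only [act_eq_pact]; exact pact_ι_comm _ α β z
theorem coact_ι_comm (a b : F) (z : E') :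
    coact (ι a) (coact (ι b) z) = -coact (ι b) (coact (ι a) z) := by
  simp only [coact_eq_pact]; exact pact_ι_comm _ a b z

/-- Contraction is natural for adjoint maps. This is the only place where adjointness of `X` and `Y`
enters directly; the later identities use it through this one. -/
theorem coact_map {X Y : F →ₗ[R] Module.Dual R F} (h : ∀ a b, Y a b = X b a) (y z : E) :
    coact y (ExteriorAlgebra.map X z) =
      ExteriorAlgebra.map X (act (ExteriorAlgebra.map Y y) z) := by
 
  rw [act_eq_pact, coact_eq_pact]
  exact pact_map (LinearMap.id : Module.Dual R F →ₗ[R] Module.Dual R F) (Module.Dual.eval R F) X Y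
    (fun v w => (h v w).symm) y z

theorem comulOne_eq_sum_act {ι' : Type*} [Fintype ι'] (b : Module.Basis ι' R F) (x : E) :
    comulOne R F x = ∑ i, b i ⊗ₜ[R] act (ι (b.coord i)) x :=
  (comulOne_eq_sum b x).trans
    (Finset.sum_congr rfl fun i _ => by rw [act_eq_pact, pact_ι]; rfl)

theorem comulOne_eq_sum_coact {ι' : Type*} [Fintype ι'] (b : Module.Basis ι' R F) (x : E') :
    comulOne R (Module.Dual R F) x = ∑ i, b.coord i ⊗ₜ[R] coact (ι (b i)) x := by
  classical
  rw [comulOne_eq_sum b.dualBasis x]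
  refine Finset.sum_congr rfl fun i _ => ?_
  have h : b.dualBasis.coord i = Module.Dual.eval R F (b i) := by
    refine LinearMap.ext fun f => ?_
    simp
  rw [h, coact_eq_pact, pact_ι, Module.Basis.coe_dualBasis]

theorem mapA_apply (Y : F →ₗ[R] Module.Dual R F) (η : E) (α : E') :
    mapA Y η α = act (ExteriorAlgebra.map Y (act α η)) η := rfl

variable {ι' : Type*} [Fintype ι'] (b : Module.Basis ι' R F)

/-- The action of the canonical element of `F^* ⊗ F` on `⋀F ⊗ ⋀F^*`. -/
def cas : E ⊗[R] E' →ₗ[R] E ⊗[R] E' :=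
  ∑ i, TensorProduct.map (act (ι (b.coord i))) (coact (ι (b i)))

theorem cas_tmul (x : E) (y : E') :
    cas b (x ⊗ₜ y) = ∑ i, act (ι (b.coord i)) x ⊗ₜ[R] coact (ι (b i)) y := by
  simp [cas, LinearMap.sum_apply]

/-- The wedge acts by composition: `[β₁ ∧ (⋀Y)(α(η))](η)` is `β₁` contracted into `A_Y(α)`, and
summation over `Δ(β)` is the action of `cas`. -/
theorem mapB_eq (Y : F →ₗ[R] Module.Dual R F) (η : E) :
    mapB Y η = cas b ∘ₗ LinearMap.rTensor E' (mapA Y η) := by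
  refine TensorProduct.ext' fun α β => ?_
  simp only [mapB, TensorProduct.lift.tmul, LinearMap.mk₂_apply, LinearMap.comp_apply,
    LinearMap.rTensor_tmul, cas_tmul, comulOne_eq_sum_coact b, map_sum, mapA_apply]
  refine Finset.sum_congr rfl fun i _ => ?_
  congr 1
  exact act_mul _ _ _

theorem mapC_eq (Y : F →ₗ[R] Module.Dual R F) :
    mapC Y = LinearMap.rTensor E' (ExteriorAlgebra.map Y).toLinearMap ∘ₗ cas b := by
  refine TensorProduct.ext' fun a β => ?_
  simp only [mapC, TensorProduct.lift.tmul, LinearMap.comp_apply,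
    cas_tmul, comulOne_eq_sum_act b, map_sum, LinearMap.sum_apply, LinearMap.rTensor_tmul]
  rfl

end ActCoact

/-! ### Elements of degree two over an arbitrary ring. -/

section TwoForms

variable {R : Type uR} [CommRing R] {F : Type uF} [AddCommGroup F] [Module R F]
variable {M : Type*} [AddCommGroup M]

/-- For summands that are symmetric in `i`, `j` and zero on the diagonal this exhibits the double
sum as twice the sum over `i < j`. The factor 2 is carried along, since it need not be invertible.
-/
theorem sum_sum_split {n : ℕ} (H : Fin n → Fin n → M) :
    ∑ i, ∑ j, H i j =
      (∑ i, ∑ j, if i < j then H i j + H j i else 0) + ∑ i, H i i := by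
  have h1 : ∀ i j, H i j = (if i < j then H i j else 0) + (if j < i then H i j else 0) +
      (if i = j then H i j else 0) := by
    intro i j
    rcases lt_trichotomy i j with h | h | h
    · simp [h, h.not_gt, h.ne]
    · simp [h]
    · simp [h, h.not_gt, h.ne']
  have h2 : ∑ i, ∑ j, (if j < i then H i j else 0) = ∑ i, ∑ j, if i < j then H j i else 0 :=
    Finset.sum_comm
  calc ∑ i, ∑ j, H i j = ∑ i, ∑ j, ((if i < j then H i j else 0) + (if j < i then H i j else 0) +
      (if i = j then H i j else 0)) := by
        exact Finset.sum_congr rfl fun i _ => Finset.sum_congr rfl fun j _ => h1 i j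
    _ = _ := by
      simp only [Finset.sum_add_distrib, h2]
      congr 1
      · simp only [← Finset.sum_add_distrib]
        refine Finset.sum_congr rfl fun i _ => Finset.sum_congr rfl fun j _ => ?_
        split_ifs <;> simp
      · simp

local notation "E" => ExteriorAlgebra R F
local notation "E'" => ExteriorAlgebra R (Module.Dual R F)
local notation "ι" => ExteriorAlgebra.ι R

theorem extPow_two_induction {V : Type*} [AddCommGroup V] [Module R V]
    {P : ∀ x : ExteriorAlgebra R V, x ∈ extPow R V 2 → Prop} (zero : P 0 (zero_mem _))
    (add : ∀ x y hx hy, P x hx → P y hy → P (x + y) (add_mem hx hy))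
    (ι_mul_ι : ∀ a b, P (ι a * ι b) (ι_mul_mem_extPow a (ι_mem_extPow b)))
    {x : ExteriorAlgebra R V} (hx : x ∈ extPow R V 2) : P x hx := by
  have h : ∀ (t : ℤ) (_ : x ∈ extPow R V t), t = 2 → ∀ hx, P x hx := by
    clear hx
    intro t ht
    induction ht using extPow_induction with
    | zero t => exact fun _ _ => zero
    | scalar r => intro h; omega
    | add t x x' h1 h2 hx hx' =>
      rintro rfl hx0
      exact add _ _ h1 h2 (hx rfl h1) (hx' rfl h2)
    | ι_mul a t x hx _ =>
      intro h
      obtain rfl : t = 1 := by omega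
      obtain ⟨c, rfl⟩ := exists_ι_of_mem hx
      exact fun _ => ι_mul_ι a c
  exact h 2 hx rfl hx

theorem act_ι_ι_ι_ι (α β : Module.Dual R F) (a c : F) :
    act (ι α * ι β) (ι a * ι c) = algebraMap R E (β a * α c - β c * α a) := by
  rw [act_mul, act_ι_ι_mul, act_ι_ι, map_sub, map_smul, act_ι_ι, ← Algebra.commutes,
    ← Algebra.smul_def, map_smul, act_ι_ι]
  simp [Algebra.algebraMap_eq_smul_one, sub_smul, mul_smul]

theorem coact_ι_ι_ι_ι (α β : Module.Dual R F) (a c : F) :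
    coact (ι a * ι c) (ι α * ι β) = algebraMap R E' (α c * β a - β c * α a) := by
  rw [coact_mul, coact_ι_ι_mul, coact_ι_ι, map_sub, map_smul, coact_ι_ι, ← Algebra.commutes,
    ← Algebra.smul_def, map_smul, coact_ι_ι]
  simp [Algebra.algebraMap_eq_smul_one, sub_smul, mul_smul]

/-- On decomposable elements both sides are the same 2 × 2 determinant. -/
theorem scalarPart_coact_two {y : E} (hy : y ∈ extPow R F 2) (α β : Module.Dual R F) :
    scalarPart R _ (coact y (ι α * ι β)) = scalarPart R _ (act (ι α * ι β) y) := by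
  induction hy using extPow_two_induction with
  | zero => simp
  | add x y _ _ hx hy => simp only [map_add, LinearMap.add_apply, hx, hy]
  | ι_mul_ι a c =>
    rw [coact_ι_ι_ι_ι, act_ι_ι_ι_ι, scalarPart_algebraMap, scalarPart_algebraMap]
    ring

theorem ι_mul_ι_swap {V : Type*} [AddCommGroup V] [Module R V] (a c : V) :
    ι a * ι c = -(ι c * ι a) :=
  eq_neg_of_add_eq_zero_left (ExteriorAlgebra.ι_add_mul_swap (R := R) a c)

/-- The dual vectors appear in the order `l`, `k` because `ε_l ∧ ε_k` contracts by `ε_k` first, and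
so takes `e_k ∧ e_l` to `+1`. -/
theorem eq_sum_of_mem_two {n : ℕ} (b : Module.Basis (Fin n) R F) {x : E}
    (hx : x ∈ extPow R F 2) :
    x = ∑ k, ∑ l, if k < l then
      scalarPart R F (act (ι (b.coord l) * ι (b.coord k)) x) • (ι (b k) * ι (b l)) else 0 := by
  induction hx using extPow_two_induction with
  | zero => simp
  | add x y _ _ hx hy =>
    conv_lhs => rw [hx, hy]
    simp only [← Finset.sum_add_distrib]
    refine Finset.sum_congr rfl fun i _ => Finset.sum_congr rfl fun j _ => ?_
    split_ifs <;> simp [add_smul]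
  | ι_mul_ι a c =>
    have h : ι a * ι c = ∑ k, ∑ l, (b.coord k a * b.coord l c) • (ι (b k) * ι (b l)) := by
      conv_lhs => rw [← b.sum_repr a, ← b.sum_repr c]
      simp only [map_sum, map_smul, Finset.sum_mul, Finset.mul_sum, smul_mul_smul_comm]
      exact Finset.sum_comm
    conv_lhs => rw [h, sum_sum_split]
    simp only [ExteriorAlgebra.ι_sq_zero, smul_zero, Finset.sum_const_zero, add_zero]
    refine Finset.sum_congr rfl fun i _ => Finset.sum_congr rfl fun j _ => ?_
    split_ifs
    · rw [act_ι_ι_ι_ι, scalarPart_algebraMap, ι_mul_ι_swap (b j) (b i), sub_smul, smul_neg,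
        ← sub_eq_add_neg, mul_comm (b.coord j a)]
    · rfl

end TwoForms

/-! ### Duality between `η` and `ε`, and the cofactor map. -/

section Hodge

variable {R : Type uR} [CommRing R] {F : Type uF} [AddCommGroup F] [Module R F] {n : ℕ}

local notation "E" => ExteriorAlgebra R F
local notation "E'" => ExteriorAlgebra R (Module.Dual R F)
local notation "ι" => ExteriorAlgebra.ι R

namespace BasicData

variable (D : BasicData R F n) (b : Module.Basis (Fin n) R F)

include b in
theorem ι_mul_eta (a : F) : ι a * D.eta = 0 :=
  eq_zero_of_mem_gt b (by omega) (ι_mul_mem_extPow a D.eta_mem)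

include b in
theorem ι_mul_eps (α : Module.Dual R F) : ι α * D.eps = 0 :=
  eq_zero_of_mem_gt b.dualBasis (by omega) (ι_mul_mem_extPow α D.eps_mem)

include b in
/-- The map `ω ↦ ω(η)` is linear over `⋀F`. -/
theorem act_coact_eta (a : E) (ω : E') : act (coact a ω) D.eta = a * act ω D.eta := by
  rw [act_eq_pact, coact_eq_pact]
  exact pact_pact_of_top (LinearMap.id : Module.Dual R F →ₗ[R] Module.Dual R F)
    (Module.Dual.eval R F) (fun _ _ => rfl) (D.ι_mul_eta b) a ω

include b in
/-- The map `a ↦ a(ε)` is linear over `⋀F^*`. -/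
theorem coact_act_eps (α : E') (a : E) : coact (act α a) D.eps = α * coact a D.eps := by
  rw [act_eq_pact, coact_eq_pact]
  exact pact_pact_of_top (Module.Dual.eval R F)
    (LinearMap.id : Module.Dual R F →ₗ[R] Module.Dual R F) (fun _ _ => rfl) (D.ι_mul_eps b) α a

include b in
-- Together with `act_coact_eps` this makes `α ↦ α(η)` and `a ↦ a(ε)` mutually inverse.
theorem coact_act_eta (α : E') : coact (act α D.eta) D.eps = α := by
  rw [D.coact_act_eps b, D.compatible, mul_one]

include b in
-- Write `ε(η) = c`. Linearity over `⋀F` with `a = η`, `ω = ε` gives `η = c η`, and evaluating at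
-- `ε` gives `c = 1`.
theorem act_eps_eta : act D.eps D.eta = 1 := by
  obtain ⟨c, hc⟩ := exists_algebraMap_of_mem
    (extPow_cast (act_mem D.eps_mem D.eta_mem) (sub_self _))
  have h1 := D.act_coact_eta b D.eta D.eps
  rw [D.compatible, act_one, hc, ← Algebra.commutes, ← Algebra.smul_def] at h1
  have h2 := congrArg (fun x => scalarPart R _ (coact x D.eps)) h1
  simp only [map_smul, LinearMap.smul_apply, D.compatible, scalarPart_one, smul_eq_mul,
    mul_one] at h2
  rw [hc, ← h2, map_one]

include b in
theorem act_coact_eps (a : E) : act (coact a D.eps) D.eta = a := by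
  rw [D.act_coact_eta b, D.act_eps_eta b, mul_one]

theorem mapA_mem (Y : F →ₗ[R] Module.Dual R F) {t : ℤ} {α : E'}
    (hα : α ∈ extPow R (Module.Dual R F) t) : mapA Y D.eta α ∈ extPow R F t :=
  extPow_cast (act_mem (map_mem_extPow Y (act_mem hα D.eta_mem)) D.eta_mem) (by ring)

theorem map_inv {V W : Type*} [AddCommGroup V] [Module R V] [AddCommGroup W] [Module R W]
    (f : V →ₗ[R] W) (x : ExteriorAlgebra R V) :
    ExteriorAlgebra.map f (inv R V x) = inv R W (ExteriorAlgebra.map f x) := by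
  induction x using ext_left_induction with
  | scalar r => simp
  | add x y hx hy => simp only [map_add, hx, hy]
  | ι_mul a x hx => simp only [map_mul, inv_ι, ExteriorAlgebra.map_apply_ι, hx, map_neg]

section Adjoint

variable {X Y : F →ₗ[R] Module.Dual R F} (h : ∀ a c, Y a c = X c a)

include b h in
-- The form `γ` is moved behind `(⋀Y)(α(η))`, so that `coact_map` carries `⋀X` onto `γ(η)`; duality
-- writes `(⋀X)(γ(η))` as `(A_X γ)(ε)`. Moving `A_X γ`, again of degree 1, to the front undoes the
-- involution.
theorem map_act_mapA_one (γ : Module.Dual R F) (α : E') :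
    ExteriorAlgebra.map X (act (ι γ) (mapA Y D.eta α)) =
      coact (mapA X D.eta (ι γ)) α := by
  have hx := D.mapA_mem X (ι_mem_extPow (R := R) γ)
  rw [mapA_apply Y, ← act_mul,
    ← inv_inv (ExteriorAlgebra.map Y (act α D.eta)), ← mul_ι_eq, act_mul, ← map_inv,
    ← coact_map h, ← D.coact_act_eta b (ExteriorAlgebra.map X _), ← coact_mul]
  change coact (_ * mapA X D.eta (ι γ)) _ = _
  rw [mul_eq_of_mem_one hx, inv_inv, coact_mul, D.coact_act_eta b]

include b h in
-- The same computation as in degree 1, without signs since elements of degree 2 are central.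
theorem map_act_mapA_two {γ : E'} (hγ : γ ∈ extPow R (Module.Dual R F) 2) (α : E') :
    ExteriorAlgebra.map X (act γ (mapA Y D.eta α)) = coact (mapA X D.eta γ) α := by
  have hx := D.mapA_mem X hγ
  rw [mapA_apply Y, ← act_mul, ← mul_comm_of_mem_two hγ, act_mul,
    ← coact_map h, ← D.coact_act_eta b (ExteriorAlgebra.map X _), ← coact_mul]
  change coact (_ * mapA X D.eta γ) _ = _
  rw [mul_comm_of_mem_two hx, coact_mul, D.coact_act_eta b]

/-- The determinant of `Y`, computed with `η` and `ε`. -/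
def detc (Y : F →ₗ[R] Module.Dual R F) : R := scalarPart R F (mapA Y D.eta 1)

theorem act_map_eta : act (ExteriorAlgebra.map Y D.eta) D.eta = algebraMap R _ (D.detc Y) := by
  have := eq_scalarPart_of_mem (D.mapA_mem Y (one_mem_extPow (R := R)))
  rw [detc, mapA_apply, act_one]
  rwa [mapA_apply, act_one] at this

include b in
theorem map_eta : ExteriorAlgebra.map X D.eta = D.detc X • D.eps := by
  rw [← D.coact_act_eta b (ExteriorAlgebra.map X D.eta), act_map_eta, coact_algebraMap]

include b h in
-- `A_Y` is an adjugate of `⋀X`: duality pulls `a` out of the evaluation at `η`, and what is left is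
-- the determinant.
theorem mapA_map (a : E) : mapA Y D.eta (ExteriorAlgebra.map X a) = D.detc Y • a := by
  rw [mapA_apply, ← coact_map (fun a c => (h c a).symm), D.act_coact_eta b, act_map_eta,
    ← Algebra.commutes, ← Algebra.smul_def]

include b h in
theorem map_mapA (α : E') : ExteriorAlgebra.map X (mapA Y D.eta α) = D.detc X • α := by
  rw [mapA_apply, ← coact_map h, D.map_eta b, map_smul, D.coact_act_eta b]

include b h in
-- Adjointness of `X` and `Y`, applied to the pair `η`, `η`, compares the two determinants.
theorem detc_adjoint : D.detc Y = D.detc X := by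
  have h1 := coact_map h D.eta D.eta
  rw [D.map_eta b, map_smul, D.compatible, act_map_eta, AlgHom.commutes] at h1
  have := congrArg (scalarPart R _) h1
  simpa using this.symm

include b in
theorem mapA_coact_ι (u : F) (α : E') :
    mapA Y D.eta (coact (ι u) α) = act (ι (Y u)) (mapA Y D.eta α) := by
  rw [mapA_apply, D.act_coact_eta b, map_mul, ExteriorAlgebra.map_apply_ι, act_mul, mapA_apply]

include b h in
-- The matrices of `A_X` and `A_Y` in degree 1 are transposes: this is `map_act_mapA_one` for `α` of
-- degree 1, where both sides are scalars.
theorem sum_mapA_one :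
    ∑ i, mapA X D.eta (ι (b.coord i)) ⊗ₜ[R] ι (b i) =
      ∑ i, ι (b i) ⊗ₜ[R] mapA Y D.eta (ι (b.coord i)) := by
  choose x hx using fun i => exists_ι_of_mem (D.mapA_mem X (ι_mem_extPow (R := R) (b.coord i)))
  choose y hy using fun i => exists_ι_of_mem (D.mapA_mem Y (ι_mem_extPow (R := R) (b.coord i)))
  have hxy : ∀ i j, b.coord j (x i) = b.coord i (y j) := by
    intro i j
    have h1 := D.map_act_mapA_one b (fun a c => (h c a).symm) (b.coord j) (ι (b.coord i))
    rw [hx, hy, act_ι_ι, coact_ι_ι, AlgHom.commutes] at h1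
    exact ExteriorAlgebra.algebraMap_leftInverse (R := R) (Module.Dual R F) |>.injective h1
  have e : ∀ z : F, ι z = ∑ j, b.coord j z • ι (b j) := fun z => by
    conv_lhs => rw [← b.sum_repr z]
    simp only [map_sum, map_smul, Module.Basis.coord_apply]
  have e1 : ∀ i, mapA X D.eta (ι (b.coord i)) ⊗ₜ[R] ι (b i) =
      ∑ j, b.coord j (x i) • (ι (b j) ⊗ₜ[R] ι (b i)) := fun i => by
    rw [hx, e (x i), TensorProduct.sum_tmul]
    exact Finset.sum_congr rfl fun j _ => by rw [TensorProduct.smul_tmul']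
  have e2 : ∀ j, ι (b j) ⊗ₜ[R] mapA Y D.eta (ι (b.coord j)) =
      ∑ i, b.coord i (y j) • (ι (b j) ⊗ₜ[R] ι (b i)) := fun j => by
    rw [hy, e (y j), TensorProduct.tmul_sum]
    exact Finset.sum_congr rfl fun i _ => by rw [TensorProduct.tmul_smul]
  simp only [e1, e2]
  rw [Finset.sum_comm]
  simp only [hxy]

include b h in
-- The analogue in degree 2, again a statement about transposed matrices. Each side counts every
-- pair `i < j` twice, so both are brought to the form `2 • (sum over i < j and k < l)`.
theorem sum_mapA_two :
    ∑ i, ∑ j, mapA X D.eta (ι (b.coord i) * ι (b.coord j)) ⊗ₜ[R] (ι (b i) * ι (b j)) =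
      ∑ i, ∑ j, (ι (b i) * ι (b j)) ⊗ₜ[R] mapA Y D.eta (ι (b.coord i) * ι (b.coord j)) := by
  have hm : ∀ i j, ι (b.coord i) * ι (b.coord j) ∈ extPow R (Module.Dual R F) 2 :=
    fun i j => ι_mul_mem_extPow _ (ι_mem_extPow _)
  let e : Fin n → Fin n → E := fun i j => ι (b i) * ι (b j)
  let ε : Fin n → Fin n → E' := fun i j => ι (b.coord i) * ι (b.coord j)
  have he : ∀ i j, e j i = -e i j := fun i j => ι_mul_ι_swap _ _
  have hε : ∀ i j, ε j i = -ε i j := fun i j => ι_mul_ι_swap _ _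
  -- The matrix of `A_X` on two-forms; `hc` identifies its transpose with the matrix of `A_Y`.
  let c : Fin n → Fin n → Fin n → Fin n → R := fun i j k l =>
    scalarPart R F (act (ε l k) (mapA X D.eta (ε i j)))
  have hc : ∀ i j k l, scalarPart R F (act (ε j i) (mapA Y D.eta (ε k l))) = c i j k l := by
    intro i j k l
    have h1 := congrArg (scalarPart R _)
      (D.map_act_mapA_two b h (hm j i) (ε k l))
    have h2 : ∀ z : E, scalarPart R _ (ExteriorAlgebra.map X z) = scalarPart R F z := by
      intro z
      induction z using ext_left_induction with
      | scalar r => rw [AlgHom.commutes, scalarPart_algebraMap, scalarPart_algebraMap]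
      | add x y hx hy => simp only [map_add, hx, hy]
      | ι_mul a x hx => simp
    rw [h2, scalarPart_coact_two (D.mapA_mem X (hm j i))] at h1
    refine h1.trans ?_
    change scalarPart R F (act (ε k l) (mapA X D.eta (ε j i))) = _
    -- Both pairs of indices are reversed, so the two signs cancel.
    rw [hε i j, hε l k, map_neg, map_neg, map_neg]
    simp [c]
  have l1 : ∀ i j, mapA X D.eta (ε i j) ⊗ₜ[R] e i j + mapA X D.eta (ε j i) ⊗ₜ[R] e j i =
      (2 : R) • ∑ k, ∑ l, if k < l then c i j k l • (e k l ⊗ₜ[R] e i j) else 0 := by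
    intro i j
    rw [hε i j, he i j, map_neg, TensorProduct.neg_tmul, TensorProduct.tmul_neg, neg_neg,
      ← two_smul R]
    congr 1
    conv_lhs => rw [eq_sum_of_mem_two b (D.mapA_mem X (hm i j) : mapA X D.eta (ε i j) ∈ _)]
    simp only [TensorProduct.sum_tmul]
    refine Finset.sum_congr rfl fun k _ => Finset.sum_congr rfl fun l _ => ?_
    split_ifs
    · rw [TensorProduct.smul_tmul']
    · rw [TensorProduct.zero_tmul]
  have l2 : ∀ k l, e k l ⊗ₜ[R] mapA Y D.eta (ε k l) + e l k ⊗ₜ[R] mapA Y D.eta (ε l k) =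
      (2 : R) • ∑ i, ∑ j, if i < j then c i j k l • (e k l ⊗ₜ[R] e i j) else 0 := by
    intro k l
    rw [hε k l, he k l, map_neg, TensorProduct.neg_tmul, TensorProduct.tmul_neg, neg_neg,
      ← two_smul R]
    congr 1
    conv_lhs => rw [eq_sum_of_mem_two b (D.mapA_mem Y (hm k l) : mapA Y D.eta (ε k l) ∈ _)]
    simp only [TensorProduct.tmul_sum]
    refine Finset.sum_congr rfl fun i _ => Finset.sum_congr rfl fun j _ => ?_
    split_ifs
    · rw [← hc, TensorProduct.tmul_smul]
    · rw [TensorProduct.tmul_zero]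
  change ∑ i, ∑ j, mapA X D.eta (ε i j) ⊗ₜ[R] e i j = ∑ i, ∑ j, e i j ⊗ₜ[R] mapA Y D.eta (ε i j)
  have e0 : ∀ i, e i i = 0 := fun i => ExteriorAlgebra.ι_sq_zero _
  rw [sum_sum_split fun i j => mapA X D.eta (ε i j) ⊗ₜ[R] e i j,
    sum_sum_split fun i j => e i j ⊗ₜ[R] mapA Y D.eta (ε i j)]
  simp only [e0, TensorProduct.tmul_zero, TensorProduct.zero_tmul, Finset.sum_const_zero,
    add_zero, l1, l2]
  have l3 : ∀ (i j : Fin n) (p : Fin n → Fin n → E ⊗[R] E),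
      (if i < j then (2 : R) • ∑ k, ∑ l, (if k < l then p k l else 0) else 0) =
        ∑ k, ∑ l, if i < j ∧ k < l then (2 : R) • p k l else 0 := by
    intro i j p
    by_cases hij : i < j
    · simp [hij, Finset.smul_sum]
    · simp [hij]
  simp only [l3]
  have l4 : ∀ p : Fin n → Fin n → Fin n → Fin n → E ⊗[R] E,
      ∑ i, ∑ j, ∑ k, ∑ l, p i j k l = ∑ k, ∑ l, ∑ i, ∑ j, p i j k l := by
    intro p
    calc ∑ i, ∑ j, ∑ k, ∑ l, p i j k l = ∑ i, ∑ k, ∑ j, ∑ l, p i j k l :=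
          Finset.sum_congr rfl fun i _ => Finset.sum_comm
      _ = ∑ k, ∑ i, ∑ j, ∑ l, p i j k l := Finset.sum_comm
      _ = ∑ k, ∑ i, ∑ l, ∑ j, p i j k l :=
          Finset.sum_congr rfl fun k _ => Finset.sum_congr rfl fun i _ => Finset.sum_comm
      _ = _ := Finset.sum_congr rfl fun k _ => Finset.sum_comm
  rw [l4]
  refine Finset.sum_congr rfl fun k _ => Finset.sum_congr rfl fun l _ =>
    Finset.sum_congr rfl fun i _ => Finset.sum_congr rfl fun j _ => ?_
  simp only [and_comm]

end Adjoint
end BasicData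
end Hodge

/-! ### The operators in `f`, their commutation rules, and `f ∘ f = 0`. -/

section SquareZero

set_option linter.unusedSimpArgs false

variable {R : Type uR} [CommRing R] {F : Type uF} [AddCommGroup F] [Module R F] {n : ℕ}

local notation "E" => ExteriorAlgebra R F
local notation "E'" => ExteriorAlgebra R (Module.Dual R F)
local notation "ι" => ExteriorAlgebra.ι R

theorem tensor_induction {A B : Type*} [AddCommGroup A] [Module R A] [AddCommGroup B] [Module R B]
    {M : Type*} [AddCommGroup M] [Module R M] (f g : A ⊗[R] B →ₗ[R] M)
    (h : ∀ a c, f (a ⊗ₜ c) = g (a ⊗ₜ c)) (z : A ⊗[R] B) : f z = g z :=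
  congrArg (fun k : A ⊗[R] B →ₗ[R] M => k z) (TensorProduct.ext' h)

/-- `⋀X ⊗ 1`. -/
abbrev mapX (X : F →ₗ[R] Module.Dual R F) : E ⊗[R] E' →ₗ[R] E' ⊗[R] E' :=
  LinearMap.rTensor E' (ExteriorAlgebra.map X).toLinearMap

/-- The contraction of the second factor. -/
abbrev conR {A : Type*} [AddCommGroup A] [Module R A] (v : F) : A ⊗[R] E' →ₗ[R] A ⊗[R] E' :=
  LinearMap.lTensor A (coact (ι v))

/-- The contraction of the first factor. -/
abbrev conL (u : F) : E' ⊗[R] E' →ₗ[R] E' ⊗[R] E' := LinearMap.rTensor E' (coact (ι u))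

/-- The contraction of the first factor by a linear form. -/
abbrev conF (w : Module.Dual R F) : E ⊗[R] E' →ₗ[R] E ⊗[R] E' := LinearMap.rTensor E' (act (ι w))

variable (R F) in
/-- The interchange of the two factors. -/
abbrev swap : E' ⊗[R] E' →ₗ[R] E' ⊗[R] E' := (TensorProduct.comm R E' E').toLinearMap

theorem swap_swap (z : E' ⊗[R] E') : swap R F (swap R F z) = z :=
  tensor_induction (swap R F ∘ₗ swap R F) LinearMap.id (fun a c => by simp) z

theorem swap_conR (v : F) (z : E' ⊗[R] E') : swap R F (conR v z) = conL v (swap R F z) :=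
  tensor_induction (swap R F ∘ₗ conR v) (conL v ∘ₗ swap R F) (fun a c => by simp) z

theorem swap_conL (v : F) (z : E' ⊗[R] E') : swap R F (conL v z) = conR v (swap R F z) :=
  tensor_induction (swap R F ∘ₗ conL v) (conR v ∘ₗ swap R F) (fun a c => by simp) z

theorem conR_conR {A : Type*} [AddCommGroup A] [Module R A] (v : F) (z : A ⊗[R] E') :
    conR v (conR v z) = 0 :=
  tensor_induction (conR v ∘ₗ conR v) 0 (fun a c => by simp [coact_ι_self]) z

theorem conL_conL (v : F) (z : E' ⊗[R] E') : conL v (conL v z) = 0 :=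
  tensor_induction (conL v ∘ₗ conL v) 0 (fun a c => by simp [coact_ι_self]) z

theorem conF_conF (w : Module.Dual R F) (z : E ⊗[R] E') : conF w (conF w z) = 0 :=
  tensor_induction (conF w ∘ₗ conF w) 0 (fun a c => by simp [act_ι_self]) z

theorem conL_conR (u v : F) (z : E' ⊗[R] E') : conL u (conR v z) = conR v (conL u z) :=
  tensor_induction (conL u ∘ₗ conR v) (conR v ∘ₗ conL u) (fun a c => by simp) z

theorem conF_conR (w : Module.Dual R F) (v : F) (z : E ⊗[R] E') :
    conF w (conR v z) = conR v (conF w z) :=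
  tensor_induction (conF w ∘ₗ conR v) (conR v ∘ₗ conF w) (fun a c => by simp) z

theorem mapX_conR (X : F →ₗ[R] Module.Dual R F) (v : F) (z : E ⊗[R] E') :
    mapX X (conR v z) = conR v (mapX X z) :=
  tensor_induction (mapX X ∘ₗ conR v) (conR v ∘ₗ mapX X) (fun a c => by simp) z

theorem rTensor_conR {A B : Type*} [AddCommGroup A] [Module R A] [AddCommGroup B] [Module R B]
    (g : A →ₗ[R] B) (v : F) (z : A ⊗[R] E') :
    LinearMap.rTensor E' g (conR v z) = conR v (LinearMap.rTensor E' g z) :=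
  tensor_induction (LinearMap.rTensor E' g ∘ₗ conR v) (conR v ∘ₗ LinearMap.rTensor E' g)
    (fun a c => by simp) z

section Casimir

variable {κ : Type*} [Fintype κ] (b : Module.Basis κ R F)

/-- Each term of `cas` contracts the same factor once more, and two contractions of one factor
anticommute. Contractions of different factors commute without a sign, since plain tensor products
of maps are used. -/
theorem cas_conR (v : F) (z : E ⊗[R] E') : cas b (conR v z) = -conR v (cas b z) :=
  tensor_induction (cas b ∘ₗ conR v) (-(conR v ∘ₗ cas b)) (fun a c => by
    simp only [LinearMap.comp_apply, LinearMap.neg_apply, LinearMap.lTensor_tmul, cas_tmul,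
      map_sum, ← Finset.sum_neg_distrib, ← TensorProduct.tmul_neg]
    exact Finset.sum_congr rfl fun i _ => by rw [coact_ι_comm]) z

theorem cas_conF (w : Module.Dual R F) (z : E ⊗[R] E') : cas b (conF w z) = -conF w (cas b z) :=
  tensor_induction (cas b ∘ₗ conF w) (-(conF w ∘ₗ cas b)) (fun a c => by
    simp only [LinearMap.comp_apply, LinearMap.neg_apply, LinearMap.rTensor_tmul, cas_tmul,
      map_sum, ← Finset.sum_neg_distrib, ← TensorProduct.neg_tmul]
    exact Finset.sum_congr rfl fun i _ => by rw [act_ι_comm]) z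

end Casimir

namespace BasicData

variable (D : BasicData R F n) (b : Module.Basis (Fin n) R F)

/-- `A_Y ⊗ 1`. -/
abbrev mapAT (Y : F →ₗ[R] Module.Dual R F) : E' ⊗[R] E' →ₗ[R] E ⊗[R] E' :=
  LinearMap.rTensor E' (mapA Y D.eta)

variable {X Y : F →ₗ[R] Module.Dual R F} (h : ∀ a c, Y a c = X c a)

include b in
theorem mapAT_conL (u : F) (z : E' ⊗[R] E') :
    D.mapAT Y (conL u z) = conF (Y u) (D.mapAT Y z) :=
  tensor_induction (D.mapAT Y ∘ₗ conL u) (conF (Y u) ∘ₗ D.mapAT Y) (fun a c => by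
    simp [D.mapA_coact_ι b]) z

include h in
omit D b in
theorem conL_mapX (u : F) (z : E ⊗[R] E') :
    conL u (mapX X z) = mapX X (conF (Y u) z) :=
  tensor_induction (conL u ∘ₗ mapX X) (mapX X ∘ₗ conF (Y u)) (fun a c => by
    simp [coact_map h]) z

include h in
omit D b in
theorem conR_swap_mapX (u : F) (z : E ⊗[R] E') :
    conR u (swap R F (mapX X z)) = swap R F (mapX X (conF (Y u) z)) := by
  rw [← swap_conL, conL_mapX h]

include b h in
theorem mapAT_mapX (z : E ⊗[R] E') : D.mapAT Y (mapX X z) = D.detc Y • z :=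
  tensor_induction (D.mapAT Y ∘ₗ mapX X) (D.detc Y • LinearMap.id) (fun a c => by
    simp [D.mapA_map b h, TensorProduct.smul_tmul']) z

include b h in
theorem mapX_mapAT (z : E' ⊗[R] E') : mapX X (D.mapAT Y z) = D.detc X • z :=
  tensor_induction (mapX X ∘ₗ D.mapAT Y) (D.detc X • LinearMap.id) (fun a c => by
    simp [D.map_mapA b h, TensorProduct.smul_tmul']) z

/-- The bilinear map `x ⊗ y ↦ x(α) ⊗ y(β)`. -/
def contractBoth (α β : E') : E ⊗[R] E →ₗ[R] E' ⊗[R] E' :=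
  TensorProduct.map (coact.toLinearMap.flip α) (coact.toLinearMap.flip β)

omit D b in
theorem contractBoth_tmul (α β : E') (x y : E) :
    contractBoth α β (x ⊗ₜ y) = coact x α ⊗ₜ coact y β := rfl

include b h in
-- Move `⋀X` past the contractions with `map_act_mapA_one`; both sides are then the two sides of
-- `sum_mapA_one`, contracted into `α ⊗ β`.
theorem mapX_cas_mapAT (z : E' ⊗[R] E') :
    mapX X (cas b (D.mapAT Y z)) = swap R F (mapX Y (cas b (D.mapAT X (swap R F z)))) :=
  tensor_induction (mapX X ∘ₗ cas b ∘ₗ D.mapAT Y)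
    (swap R F ∘ₗ mapX Y ∘ₗ cas b ∘ₗ D.mapAT X ∘ₗ swap R F) (fun α β => by
    have := congrArg (contractBoth α β) (D.sum_mapA_one b h)
    simp only [map_sum, contractBoth_tmul] at this
    simp only [LinearMap.comp_apply, LinearMap.rTensor_tmul, cas_tmul, map_sum,
      LinearEquiv.coe_coe, TensorProduct.comm_tmul, AlgHom.toLinearMap_apply,
      D.map_act_mapA_one b h, D.map_act_mapA_one b fun a c => (h c a).symm]
    exact this) z

include b h in
theorem mapX_cas_cas_mapAT (z : E' ⊗[R] E') :
    mapX X (cas b (cas b (D.mapAT Y z))) =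
      swap R F (mapX Y (cas b (cas b (D.mapAT X (swap R F z))))) :=
  tensor_induction (mapX X ∘ₗ cas b ∘ₗ cas b ∘ₗ D.mapAT Y)
    (swap R F ∘ₗ mapX Y ∘ₗ cas b ∘ₗ cas b ∘ₗ D.mapAT X ∘ₗ swap R F) (fun α β => by
    have := congrArg (contractBoth α β) (D.sum_mapA_two b h)
    have hm : ∀ i j, ι (b.coord i) * ι (b.coord j) ∈ extPow R (Module.Dual R F) 2 :=
      fun i j => ι_mul_mem_extPow _ (ι_mem_extPow _)
    simp only [map_sum, contractBoth_tmul] at this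
    simp only [LinearMap.comp_apply, LinearMap.rTensor_tmul, cas_tmul, map_sum,
      LinearEquiv.coe_coe, TensorProduct.comm_tmul, AlgHom.toLinearMap_apply, ← act_mul,
      ← coact_mul,
      D.map_act_mapA_two b h (hm _ _), D.map_act_mapA_two b (fun a c => (h c a).symm) (hm _ _)]
    rw [Finset.sum_comm, this, Finset.sum_comm]) z

include b h in
-- Both sides expand to the double sum of `X(e_j)(e_i) ε_i(A_X β) ⊗ (⋀X)(ε_j(a))`, with the two
-- summations in different order.
theorem cas_mapAT_swap_mapX (z : E ⊗[R] E') :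
    cas b (D.mapAT X (swap R F (mapX X z))) = D.mapAT X (swap R F (mapX X (cas b z))) :=
  tensor_induction (cas b ∘ₗ D.mapAT X ∘ₗ swap R F ∘ₗ mapX X)
    (D.mapAT X ∘ₗ swap R F ∘ₗ mapX X ∘ₗ cas b) (fun a β => by
    simp only [LinearMap.comp_apply, LinearMap.rTensor_tmul, cas_tmul, map_sum,
      LinearEquiv.coe_coe, TensorProduct.comm_tmul, AlgHom.toLinearMap_apply, coact_map h,
      ExteriorAlgebra.map_apply_ι, D.mapA_coact_ι b]
    have e1 : ∀ i, ι (Y (b i)) = ∑ j, X (b j) (b i) • ι (b.coord j) := fun i => by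
      rw [← b.sum_dual_apply_smul_coord (Y (b i))]
      simp only [map_sum, map_smul, h]
    have e2 : ∀ i, ι (X (b i)) = ∑ j, X (b i) (b j) • ι (b.coord j) := fun i => by
      conv_lhs => rw [← b.sum_dual_apply_smul_coord (X (b i))]
      simp only [map_sum, map_smul]
    simp only [e1, e2, map_sum, map_smul, LinearMap.sum_apply, LinearMap.smul_apply,
      TensorProduct.tmul_sum, TensorProduct.sum_tmul, TensorProduct.tmul_smul,
      ← TensorProduct.smul_tmul']
    rw [Finset.sum_comm]) z

theorem Xs_apply (a c : F) : D.Xs a c = D.X c a := rfl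

theorem X_apply (a c : F) : D.X a c = D.Xs c a := rfl

include b in
theorem f1_apply (r : ℤ) (z : E' ⊗[R] E') :
    D.f1 r z = in1 (conR D.v z + r.negOnePow • conL D.u z) + in2 (cas b (D.mapAT D.Xs z)) +
      in3 (cas b (D.mapAT D.X (swap R F z))) := by
  simp only [f1, mapB_eq b]; rfl

include b in
theorem f2_apply (r : ℤ) (z : E ⊗[R] E') :
    D.f2 r z = in1 (r.negOnePow • mapX D.X z) +
      in2 (conR D.v z + (r + 1).negOnePow • conF (D.Xs D.u) z) + in4 (mapX D.X (cas b z)) := by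
  simp only [f2, mapC_eq b]; rfl

include b in
theorem f3_apply (r : ℤ) (z : E ⊗[R] E') :
    D.f3 r z = in1 ((r + 1).negOnePow • swap R F (mapX D.Xs z)) +
      in3 ((r + 1).negOnePow • conR D.u z + conF (D.X D.v) z) -
      in4 (swap R F (mapX D.Xs (cas b z))) := by
  simp only [f3, mapC_eq b]; rfl

theorem f4_apply (r : ℤ) (z : E' ⊗[R] E') :
    D.f4 r z = in2 (r.negOnePow • D.mapAT D.Xs z) + in3 (r.negOnePow • D.mapAT D.X (swap R F z)) +
      in4 (conR D.v z + r.negOnePow • conL D.u z) := rfl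

theorem f_in1 (r : ℤ) (z : E' ⊗[R] E') : D.f r (in1 z) = D.f1 r z := by
  simp [f, in1, out1, out2, out3, out4]
theorem f_in2 (r : ℤ) (z : E ⊗[R] E') : D.f r (in2 z) = D.f2 r z := by
  simp [f, in2, out1, out2, out3, out4]
theorem f_in3 (r : ℤ) (z : E ⊗[R] E') : D.f r (in3 z) = D.f3 r z := by
  simp [f, in3, out1, out2, out3, out4]
theorem f_in4 (r : ℤ) (z : E' ⊗[R] E') : D.f r (in4 z) = D.f4 r z := by
  simp [f, in4, out1, out2, out3, out4]

omit D b in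
theorem total_eq (x : Total R F) : x = in1 (out1 x) + in2 (out2 x) + in3 (out3 x) + in4 (out4 x) := by
  simp [in1, in2, in3, in4, out1, out2, out3, out4]

include b in
-- The operator identities bring every composite to a normal form, in which the terms cancel. No
-- degrees are involved, so the identity holds on the whole ambient module.
theorem f_f_in1 (r : ℤ) (z : E' ⊗[R] E') : D.f (r - 1) (D.f r (in1 z)) = 0 := by
  have hX := D.Xs_apply
  have hXs := D.X_apply
  have s1 : (r - 1).negOnePow = -r.negOnePow := by rw [Int.negOnePow_sub]; simp
  have s2 : (r + 1).negOnePow = -r.negOnePow := Int.negOnePow_succ r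
  have s3 : (r - 1 + 1).negOnePow = r.negOnePow := by rw [sub_add_cancel]
  rw [f_in1, D.f1_apply b]
  simp only [map_add, map_sub, f_in1, f_in2, f_in3, f_in4, D.f1_apply b, D.f2_apply b,
    D.f3_apply b, D.f4_apply, s1, s2, s3]
  -- With the value of `(-1)^r` fixed, all signs become integers that `abel` can cancel.
  rcases Int.units_eq_one_or r.negOnePow with hs | hs <;>
  · simp only [hs, one_smul, Units.neg_smul, neg_neg, map_neg, map_add, map_zero, conR_conR,
      conL_conL, conF_conF, conL_conR, swap_swap, swap_conR, swap_conL, conF_conR, mapX_conR,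
      rTensor_conR, cas_conR, cas_conF, D.mapAT_conL b, conL_mapX hX, conL_mapX hXs,
      conR_swap_mapX hXs, D.mapAT_mapX b hX, D.mapAT_mapX b hXs, D.mapX_mapAT b hX, D.mapX_mapAT b hXs,
      D.mapX_cas_mapAT b hX, D.mapX_cas_cas_mapAT b hX, D.cas_mapAT_swap_mapX b hX,
      D.cas_mapAT_swap_mapX b hXs, D.detc_adjoint b hX, map_smul]
    abel

include b in
theorem f_f_in2 (r : ℤ) (z : E ⊗[R] E') : D.f (r - 1) (D.f r (in2 z)) = 0 := by
  have hX := D.Xs_apply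
  have hXs := D.X_apply
  have s1 : (r - 1).negOnePow = -r.negOnePow := by rw [Int.negOnePow_sub]; simp
  have s2 : (r + 1).negOnePow = -r.negOnePow := Int.negOnePow_succ r
  have s3 : (r - 1 + 1).negOnePow = r.negOnePow := by rw [sub_add_cancel]
  rw [f_in2, D.f2_apply b]
  simp only [map_add, map_sub, f_in1, f_in2, f_in3, f_in4, D.f1_apply b, D.f2_apply b,
    D.f3_apply b, D.f4_apply, s1, s2, s3]
  rcases Int.units_eq_one_or r.negOnePow with hs | hs <;>
  · simp only [hs, one_smul, Units.neg_smul, neg_neg, map_neg, map_add, map_zero, conR_conR,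
      conL_conL, conF_conF, conL_conR, swap_swap, swap_conR, swap_conL, conF_conR, mapX_conR,
      rTensor_conR, cas_conR, cas_conF, D.mapAT_conL b, conL_mapX hX, conL_mapX hXs,
      conR_swap_mapX hXs, D.mapAT_mapX b hX, D.mapAT_mapX b hXs, D.mapX_mapAT b hX, D.mapX_mapAT b hXs,
      D.mapX_cas_mapAT b hX, D.mapX_cas_cas_mapAT b hX, D.cas_mapAT_swap_mapX b hX,
      D.cas_mapAT_swap_mapX b hXs, D.detc_adjoint b hX, map_smul]
    abel

include b in
theorem f_f_in3 (r : ℤ) (z : E ⊗[R] E') : D.f (r - 1) (D.f r (in3 z)) = 0 := by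
  have hX := D.Xs_apply
  have hXs := D.X_apply
  have s1 : (r - 1).negOnePow = -r.negOnePow := by rw [Int.negOnePow_sub]; simp
  have s2 : (r + 1).negOnePow = -r.negOnePow := Int.negOnePow_succ r
  have s3 : (r - 1 + 1).negOnePow = r.negOnePow := by rw [sub_add_cancel]
  rw [f_in3, D.f3_apply b]
  simp only [map_add, map_sub, f_in1, f_in2, f_in3, f_in4, D.f1_apply b, D.f2_apply b,
    D.f3_apply b, D.f4_apply, s1, s2, s3]
  rcases Int.units_eq_one_or r.negOnePow with hs | hs <;>
  · simp only [hs, one_smul, Units.neg_smul, neg_neg, map_neg, map_add, map_zero, conR_conR,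
      conL_conL, conF_conF, conL_conR, swap_swap, swap_conR, swap_conL, conF_conR, mapX_conR,
      rTensor_conR, cas_conR, cas_conF, D.mapAT_conL b, conL_mapX hX, conL_mapX hXs,
      conR_swap_mapX hXs, D.mapAT_mapX b hX, D.mapAT_mapX b hXs, D.mapX_mapAT b hX, D.mapX_mapAT b hXs,
      D.mapX_cas_mapAT b hX, D.mapX_cas_cas_mapAT b hX, D.cas_mapAT_swap_mapX b hX,
      D.cas_mapAT_swap_mapX b hXs, D.detc_adjoint b hX, map_smul]
    abel

include b in
theorem f_f_in4 (r : ℤ) (z : E' ⊗[R] E') : D.f (r - 1) (D.f r (in4 z)) = 0 := by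
  have hX := D.Xs_apply
  have hXs := D.X_apply
  have s1 : (r - 1).negOnePow = -r.negOnePow := by rw [Int.negOnePow_sub]; simp
  have s2 : (r + 1).negOnePow = -r.negOnePow := Int.negOnePow_succ r
  have s3 : (r - 1 + 1).negOnePow = r.negOnePow := by rw [sub_add_cancel]
  rw [f_in4, D.f4_apply]
  simp only [map_add, map_sub, f_in1, f_in2, f_in3, f_in4, D.f1_apply b, D.f2_apply b,
    D.f3_apply b, D.f4_apply, s1, s2, s3]
  rcases Int.units_eq_one_or r.negOnePow with hs | hs <;>
  · simp only [hs, one_smul, Units.neg_smul, neg_neg, map_neg, map_add, map_zero, conR_conR,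
      conL_conL, conF_conF, conL_conR, swap_swap, swap_conR, swap_conL, conF_conR, mapX_conR,
      rTensor_conR, cas_conR, cas_conF, D.mapAT_conL b, conL_mapX hX, conL_mapX hXs,
      conR_swap_mapX hXs, D.mapAT_mapX b hX, D.mapAT_mapX b hXs, D.mapX_mapAT b hX, D.mapX_mapAT b hXs,
      D.mapX_cas_mapAT b hX, D.mapX_cas_cas_mapAT b hX, D.cas_mapAT_swap_mapX b hX,
      D.cas_mapAT_swap_mapX b hXs, D.detc_adjoint b hX, map_smul]
    abel

include b in
theorem f_f (r : ℤ) (x : Total R F) : D.f (r - 1) (D.f r x) = 0 := by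
  rw [total_eq x]
  simp only [map_add, D.f_f_in1 b, D.f_f_in2 b, D.f_f_in3 b, D.f_f_in4 b, add_zero]

end BasicData
end SquareZero

/-! ### Elimination of a contractible subcomplex, formally. -/

section Elimination

open CategoryTheory

variable {R : Type uR} [CommRing R] {T : Type uT} [AddCommGroup T] [Module R T]

theorem IsComplex.toChainComplex_d {C : ℤ → Submodule R T} {d : ℤ → T →ₗ[R] T}
    (hC : IsComplex C d) {i j : ℤ} (hij : j + 1 = i) :
    hC.toChainComplex.d i j = ModuleCat.ofHom ((d i).restrict (hC.mapsTo' hij)) := dif_pos hij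

/-- The maps of degree one between complexes of submodules, given by endomorphisms of the ambient
module. -/
def degreeOneMaps {C C' : ℤ → Submodule R T} {d d' : ℤ → T →ₗ[R] T} (hC : IsComplex C d)
    (hC' : IsComplex C' d') (τ : ℤ → T →ₗ[R] T) (hτ : ∀ r, ∀ x ∈ C r, τ r x ∈ C' (r + 1))
    (i j : ℤ) : hC.toChainComplex.X i ⟶ hC'.toChainComplex.X j :=
  if hij : i + 1 = j then
    ModuleCat.ofHom ((τ i).restrict (p := C i) (q := C' j) fun x hx => hij ▸ hτ i x hx) else 0

theorem degreeOneMaps_eq {C C' : ℤ → Submodule R T} {d d' : ℤ → T →ₗ[R] T} (hC : IsComplex C d)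
    (hC' : IsComplex C' d') (τ : ℤ → T →ₗ[R] T) (hτ : ∀ r, ∀ x ∈ C r, τ r x ∈ C' (r + 1))
    {i j : ℤ} (hij : i + 1 = j) : degreeOneMaps hC hC' τ hτ i j =
      ModuleCat.ofHom ((τ i).restrict (p := C i) (q := C' j) fun x hx => hij ▸ hτ i x hx) :=
  dif_pos hij

/-- A homotopy between maps of complexes of submodules, given by endomorphisms of the ambient
module. -/
def homotopyOfMaps {C C' : ℤ → Submodule R T} {d d' : ℤ → T →ₗ[R] T} (hC : IsComplex C d)
    (hC' : IsComplex C' d') (φ χ : hC.toChainComplex ⟶ hC'.toChainComplex)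
    (g k τ : ℤ → T →ₗ[R] T) (hg : ∀ r, ∀ x ∈ C r, g r x ∈ C' r)
    (hk : ∀ r, ∀ x ∈ C r, k r x ∈ C' r) (hτ : ∀ r, ∀ x ∈ C r, τ r x ∈ C' (r + 1))
    (hφ : ∀ r, φ.f r = ModuleCat.ofHom ((g r).restrict (hg r)))
    (hχ : ∀ r, χ.f r = ModuleCat.ofHom ((k r).restrict (hk r)))
    (h : ∀ r, ∀ x ∈ C r, g r x = τ (r - 1) (d r x) + d' (r + 1) (τ r x) + k r x) :
    Homotopy φ χ where
  hom := degreeOneMaps hC hC' τ hτ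
  zero i j hij := dif_neg hij
  comm r := by
    have w1 : r - 1 + 1 = r := sub_add_cancel r 1
    rw [dNext_eq _ (show (ComplexShape.down ℤ).Rel r (r - 1) from w1),
      prevD_eq _ (show (ComplexShape.down ℤ).Rel (r + 1) r from rfl), hC.toChainComplex_d w1,
      hC'.toChainComplex_d rfl, degreeOneMaps_eq hC hC' τ hτ w1, degreeOneMaps_eq hC hC' τ hτ rfl,
      hφ, hχ]
    ext x
    exact h r x.1 x.2

/-- Data for the elimination of a split exact subcomplex: `N` is generated by `N'`, on which
`τ` inverts the differential. -/
structure Elimination (C M N' N : ℤ → Submodule R T) (d τ π ψ m : ℤ → T →ₗ[R] T) : Prop where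
  d_d : ∀ r x, d (r - 1) (d r x) = 0
  d_mem : ∀ r, ∀ x ∈ C r, d r x ∈ C (r - 1)
  M_le : ∀ r, M r ≤ C r
  N'_le : ∀ r, N' r ≤ C r
  N_eq : ∀ r, N r = N' r ⊔ (N' (r + 1)).map (d (r + 1))
  psi_eq : ∀ r x, ψ r x = π r x - π r (d (r + 1) (τ r x))
  m_eq : ∀ r x, m r x = ψ (r - 1) (d r x)
  tau_mem : ∀ r, ∀ x ∈ C r, τ r x ∈ N' (r + 1)
  tau_M : ∀ r, ∀ x ∈ M r, τ r x = 0
  tau_N' : ∀ r, ∀ x ∈ N' r, τ r x = 0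
  tau_d : ∀ r, ∀ x ∈ N' (r + 1), τ r (d (r + 1) x) = x
  res : ∀ r, ∀ x ∈ C r, x - d (r + 1) (τ r x) ∈ M r ⊔ N' r
  pi_M : ∀ r, ∀ x ∈ M r, π r x = x
  pi_N' : ∀ r, ∀ x ∈ N' r, π r x = 0

namespace Elimination

variable {C M N' N : ℤ → Submodule R T} {d τ π ψ m : ℤ → T →ₗ[R] T}
  (h : Elimination C M N' N d τ π ψ m)

include h

theorem d_mem' (r : ℤ) {x : T} (hx : x ∈ C (r + 1)) : d (r + 1) x ∈ C r := by
  have := h.d_mem (r + 1) x hx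
  rwa [add_sub_cancel_right] at this

theorem d_d' (r : ℤ) (x : T) : d r (d (r + 1) x) = 0 := by
  have := h.d_d (r + 1) x
  rwa [add_sub_cancel_right] at this

theorem tau_d' (r : ℤ) {x : T} (hx : x ∈ N' r) : τ (r - 1) (d r x) = x := by
  have := h.tau_d (r - 1) x (by rwa [sub_add_cancel])
  rwa [sub_add_cancel] at this

theorem N_le (r : ℤ) : N r ≤ C r := by
  rw [h.N_eq]
  refine sup_le (h.N'_le r) ?_
  rintro _ ⟨x, hx, rfl⟩
  exact h.d_mem' r (h.N'_le _ hx)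

theorem N'_le_N (r : ℤ) : N' r ≤ N r := by rw [h.N_eq]; exact le_sup_left

theorem d_N' (r : ℤ) {x : T} (hx : x ∈ N' r) : d r x ∈ N (r - 1) := by
  rw [h.N_eq, sub_add_cancel]
  exact Submodule.mem_sup_right ⟨x, hx, rfl⟩

/-- The structure of `ψ`. -/
theorem exists_psi (r : ℤ) {x : T} (hx : x ∈ C r) :
    ∃ y ∈ N' r, ψ r x = x - d (r + 1) (τ r x) - y ∧ ψ r x ∈ M r := by
  obtain ⟨a, ha, y, hy, hay⟩ := Submodule.mem_sup.1 (h.res r x hx)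
  have : ψ r x = a := by
    rw [h.psi_eq, ← map_sub, ← hay, map_add, h.pi_M r a ha, h.pi_N' r y hy, add_zero]
  refine ⟨y, hy, ?_, this ▸ ha⟩
  rw [this, ← hay, add_sub_cancel_right]

theorem psi_M (r : ℤ) {x : T} (hx : x ∈ M r) : ψ r x = x := by
  rw [h.psi_eq, h.tau_M r x hx, map_zero, map_zero, sub_zero, h.pi_M r x hx]

theorem psi_N' (r : ℤ) {x : T} (hx : x ∈ N' r) : ψ r x = 0 := by
  rw [h.psi_eq, h.tau_N' r x hx, map_zero, map_zero, sub_zero, h.pi_N' r x hx]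

/-- Since `τ d = 1` on `N'`, the two terms of `ψ (d x)` coincide. -/
theorem psi_d_N' (r : ℤ) {x : T} (hx : x ∈ N' r) : ψ (r - 1) (d r x) = 0 := by
  rw [h.psi_eq, h.tau_d' r hx, sub_add_cancel, sub_self]

theorem psi_N (r : ℤ) {x : T} (hx : x ∈ N r) : ψ r x = 0 := by
  rw [h.N_eq] at hx
  obtain ⟨y, hy, _, ⟨z, hz, rfl⟩, rfl⟩ := Submodule.mem_sup.1 hx
  have := h.psi_d_N' (r + 1) hz
  rw [add_sub_cancel_right] at this
  rw [map_add, h.psi_N' r hy, this, add_zero]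

/-- If `ψ x = 0`, then `exists_psi` presents `x` as `d (τ x) + y` with both `τ x` and `y` in `N'`.
-/
theorem psi_eq_zero_iff (r : ℤ) {x : T} (hx : x ∈ C r) : ψ r x = 0 ↔ x ∈ N r := by
  refine ⟨fun h0 => ?_, h.psi_N r⟩
  obtain ⟨y, hy, e, -⟩ := h.exists_psi r hx
  rw [h0, eq_comm, sub_eq_zero, sub_eq_iff_eq_add'] at e
  rw [e, h.N_eq]
  exact add_mem (Submodule.mem_sup_right ⟨_, h.tau_mem r x hx, rfl⟩) (Submodule.mem_sup_left hy)

theorem psi_mem (r : ℤ) {x : T} (hx : x ∈ C r) : ψ r x ∈ M r :=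
  let ⟨_, _, _, hm⟩ := h.exists_psi r hx
  hm

/-- `ψ x` differs from `x` by a boundary and an element `y` of `N'`; the boundary dies under `d`,
and `d y` dies under `ψ`. In particular `m m = ψ d d = 0` on `M`. -/
theorem m_psi (r : ℤ) {x : T} (hx : x ∈ C r) : m r (ψ r x) = ψ (r - 1) (d r x) := by
  obtain ⟨y, hy, e, -⟩ := h.exists_psi r hx
  rw [h.m_eq, e, map_sub (d r), map_sub (d r), h.d_d', sub_zero, map_sub, h.psi_d_N' r hy,
    sub_zero]

theorem isComplex_C : IsComplex C d := ⟨h.d_mem, fun r _ _ => h.d_d r _⟩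

theorem isComplex_N : IsComplex N d where
  mapsTo r x hx := by
    rw [h.N_eq] at hx
    obtain ⟨y, hy, _, ⟨z, hz, rfl⟩, rfl⟩ := Submodule.mem_sup.1 hx
    rw [map_add, h.d_d', add_zero]
    exact h.d_N' r hy
  sq_zero r _ _ := h.d_d r _

theorem isComplex_M : IsComplex M m where
  mapsTo r x hx := by
    rw [h.m_eq]; exact h.psi_mem _ (h.d_mem _ _ (h.M_le _ hx))
  sq_zero r x hx := by
    rw [h.m_eq r, h.m_psi _ (h.d_mem _ _ (h.M_le _ hx)), h.d_d, map_zero]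

theorem isChainMap_psi : IsChainMap C d M m ψ where
  mapsTo r _ hx := h.psi_mem r hx
  comm r _ hx := h.m_psi r hx

/-- The subcomplex `N` is contractible. -/
theorem nonempty_homotopy_N (cN : IsComplex N d) :
    Nonempty (Homotopy (𝟙 cN.toChainComplex) 0) := by
  refine ⟨homotopyOfMaps cN cN _ _ (fun _ => LinearMap.id) 0 τ (fun _ _ hx => hx)
    (fun r x hx => zero_mem _) (fun r x hx => ?_) (fun r => rfl) (fun r => rfl) fun r x hx => ?_⟩
  · exact h.N'_le_N _ (h.tau_mem r x (h.N_le r hx))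
  -- For `x = y + d z` with `y`, `z` in `N'`, the term `τ d` recovers `y` and the term `d τ`
  -- recovers `d z`.
  · change x = τ (r - 1) (d r x) + d (r + 1) (τ r x) + 0
    rw [h.N_eq] at hx
    obtain ⟨y, hy, _, ⟨z, hz, rfl⟩, rfl⟩ := Submodule.mem_sup.1 hx
    rw [map_add (d r), h.d_d', add_zero (d r y), h.tau_d' r hy, map_add (τ r), h.tau_N' r y hy,
      h.tau_d r z hz, zero_add, add_zero]

theorem tau_d_mem (r : ℤ) {x : T} (hx : x ∈ C r) : τ (r - 1) (d r x) ∈ N' r := by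
  have := h.tau_mem _ _ (h.d_mem r x hx)
  rwa [sub_add_cancel] at this

/-- The inclusion of `M` into `C` up to homotopy. -/
theorem isChainMap_section :
    IsChainMap M m C d (fun r => LinearMap.id - τ (r - 1) ∘ₗ d r) where
  mapsTo r x hx := sub_mem (h.M_le r hx) (h.N'_le r (h.tau_d_mem r (h.M_le r hx)))
  comm r x hx := by
    obtain ⟨y, hy, e, -⟩ := h.exists_psi (r - 1) (h.d_mem r x (h.M_le r hx))
    simp only [LinearMap.sub_apply, LinearMap.id_apply, LinearMap.comp_apply, h.m_eq]
    -- Applying `1 - τ d` to `ψ (d x) = d x - d τ (d x) - y` restores the `y` which `ψ` has removed.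
    have h1 : τ (r - 1 - 1) (d (r - 1) y) = y := h.tau_d' _ hy
    rw [e, sub_add_cancel]
    have h2 : ∀ z, d (r - 1) (d r z) = 0 := h.d_d r
    simp only [map_sub, h2, map_zero, h1]
    abel

/-- `ψ` and `1 - τ d` are inverse up to homotopy: on `M` their composite is exactly the identity,
and on `C` it is the identity up to the homotopy `-τ`. -/
theorem isIso_homologyMap (cC : IsComplex C d) (cM : IsComplex M m) (cψ : IsChainMap C d M m ψ)
    (r : ℤ) : IsIso (HomologicalComplex.homologyMap (cψ.toHom cC cM) r) := by
  let φ := cψ.toHom cC cM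
  let χ := h.isChainMap_section.toHom cM cC
  have h1 : Homotopy (φ ≫ χ) (𝟙 cC.toChainComplex) := by
    refine homotopyOfMaps cC cC _ _ (fun r => (LinearMap.id - τ (r - 1) ∘ₗ d r) ∘ₗ ψ r)
      (fun _ => LinearMap.id) (fun r => -τ r)
      (fun r x hx => h.isChainMap_section.mapsTo r _ (h.psi_mem r hx)) (fun _ _ hx => hx)
      (fun r x hx => ?_) (fun r => rfl) (fun r => rfl) fun r x hx => ?_
    · exact neg_mem (h.N'_le _ (h.tau_mem r x hx))
    · change ψ r x - τ (r - 1) (d r (ψ r x)) =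
        -τ (r - 1) (d r x) + d (r + 1) (-τ r x) + x
      obtain ⟨y, hy, e, -⟩ := h.exists_psi r hx
      rw [e, map_sub (d r), map_sub (d r), h.d_d', sub_zero, map_sub, h.tau_d' r hy, map_neg]
      abel
  have h2 : Homotopy (χ ≫ φ) (𝟙 cM.toChainComplex) := by
    refine homotopyOfMaps cM cM _ _ (fun r => ψ r ∘ₗ (LinearMap.id - τ (r - 1) ∘ₗ d r))
      (fun _ => LinearMap.id) 0
      (fun r x hx => h.psi_mem r (h.isChainMap_section.mapsTo r x hx)) (fun _ _ hx => hx)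
      (fun r x hx => zero_mem _) (fun r => rfl) (fun r => rfl) fun r x hx => ?_
    change ψ r (x - τ (r - 1) (d r x)) = 0 + m (r + 1) 0 + x
    rw [map_sub, h.psi_N' r (h.tau_d_mem r (h.M_le r hx)), h.psi_M r hx, map_zero]
    simp
  exact (HomotopyEquiv.toHomologyIso ⟨φ, χ, h1, h2⟩ r).isIso_hom

end Elimination
end Elimination

/-! ### Bihomogeneous pieces of a tensor product of exterior algebras. -/

section Bidegrees

variable {R : Type uR} [CommRing R] {V W V' W' : Type*} [AddCommGroup V] [Module R V]
  [AddCommGroup W] [Module R W] [AddCommGroup V'] [Module R V'] [AddCommGroup W'] [Module R W']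

variable (R V W) in
/-- `⋀^a V ⊗ ⋀^b W` inside `⋀V ⊗ ⋀W`. -/
def bideg (a b : ℤ) : Submodule R (ExteriorAlgebra R V ⊗[R] ExteriorAlgebra R W) :=
  LinearMap.range (TensorProduct.mapIncl (extPow R V a) (extPow R W b))

theorem tmul_mem_bideg {a b : ℤ} {x : ExteriorAlgebra R V} {y : ExteriorAlgebra R W}
    (hx : x ∈ extPow R V a) (hy : y ∈ extPow R W b) : x ⊗ₜ[R] y ∈ bideg R V W a b :=
  ⟨⟨x, hx⟩ ⊗ₜ ⟨y, hy⟩, rfl⟩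

theorem bideg_le {a b : ℤ} {P : Submodule R (ExteriorAlgebra R V ⊗[R] ExteriorAlgebra R W)}
    (h : ∀ x ∈ extPow R V a, ∀ y ∈ extPow R W b, x ⊗ₜ[R] y ∈ P) : bideg R V W a b ≤ P := by
  rintro _ ⟨z, rfl⟩
  induction z using TensorProduct.induction_on with
  | zero => rw [map_zero]; exact zero_mem _
  | tmul x y => exact h x x.2 y y.2
  | add z z' hz hz' => rw [map_add]; exact add_mem hz hz'

theorem bideg_eq_bot_left {a b : ℤ} (h : extPow R V a = ⊥) : bideg R V W a b = ⊥ :=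
  le_bot_iff.1 <| bideg_le fun x hx y _ => by
    rw [h, Submodule.mem_bot] at hx; rw [hx, TensorProduct.zero_tmul]; exact zero_mem _

theorem bideg_eq_bot_right {a b : ℤ} (h : extPow R W b = ⊥) : bideg R V W a b = ⊥ :=
  le_bot_iff.1 <| bideg_le fun x _ y hy => by
    rw [h, Submodule.mem_bot] at hy; rw [hy, TensorProduct.tmul_zero]; exact zero_mem _

theorem map_mem_bideg {a b a' b' : ℤ} {g : ExteriorAlgebra R V →ₗ[R] ExteriorAlgebra R V'}
    {k : ExteriorAlgebra R W →ₗ[R] ExteriorAlgebra R W'}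
    (hg : ∀ x ∈ extPow R V a, g x ∈ extPow R V' a') (hk : ∀ y ∈ extPow R W b, k y ∈ extPow R W' b')
    {z : ExteriorAlgebra R V ⊗[R] ExteriorAlgebra R W} (hz : z ∈ bideg R V W a b) :
    TensorProduct.map g k z ∈ bideg R V' W' a' b' := by
  have : bideg R V W a b ≤ (bideg R V' W' a' b').comap (TensorProduct.map g k) :=
    bideg_le fun x hx y hy => tmul_mem_bideg (hg x hx) (hk y hy)
  exact this hz

theorem eqOn_bideg {M : Type*} [AddCommGroup M] [Module R M] {a b : ℤ}
    (g k : ExteriorAlgebra R V ⊗[R] ExteriorAlgebra R W →ₗ[R] M)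
    (h : ∀ x ∈ extPow R V a, ∀ y ∈ extPow R W b, g (x ⊗ₜ y) = k (x ⊗ₜ y))
    {z : ExteriorAlgebra R V ⊗[R] ExteriorAlgebra R W} (hz : z ∈ bideg R V W a b) :
    g z = k z := by
  have : bideg R V W a b ≤ LinearMap.eqLocus g k := bideg_le h
  exact this hz

variable (R V W) in
/-- The projection onto `⋀^a V ⊗ ⋀^b W`. -/
def bproj (a b : ℤ) : ExteriorAlgebra R V ⊗[R] ExteriorAlgebra R W →ₗ[R]
    ExteriorAlgebra R V ⊗[R] ExteriorAlgebra R W :=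
  TensorProduct.map (extProj R V a) (extProj R W b)

theorem bproj_mem (a b : ℤ) (z : ExteriorAlgebra R V ⊗[R] ExteriorAlgebra R W) :
    bproj R V W a b z ∈ bideg R V W a b := by
  induction z using TensorProduct.induction_on with
  | zero => rw [map_zero]; exact zero_mem _
  | tmul x y => exact tmul_mem_bideg (extProj_mem a x) (extProj_mem b y)
  | add z z' hz hz' => rw [map_add]; exact add_mem hz hz'

theorem bproj_of_mem {a b : ℤ} {z : ExteriorAlgebra R V ⊗[R] ExteriorAlgebra R W}
    (hz : z ∈ bideg R V W a b) : bproj R V W a b z = z :=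
  eqOn_bideg (bproj R V W a b) LinearMap.id (fun x hx y hy => by
    simp [bproj, extProj_of_mem hx, extProj_of_mem hy]) hz

theorem bproj_of_mem_ne {a b a' b' : ℤ} {z : ExteriorAlgebra R V ⊗[R] ExteriorAlgebra R W}
    (hz : z ∈ bideg R V W a b) (h : a ≠ a' ∨ b ≠ b') : bproj R V W a' b' z = 0 :=
  eqOn_bideg (bproj R V W a' b') 0 (fun x hx y hy => by
    rcases h with h | h
    · simp [bproj, extProj_of_mem_ne hx h]
    · simp [bproj, extProj_of_mem_ne hy h]) hz

/-- If one factor is generated by a single element, every tensor of that bidegree is pure. It is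
used with the generators `1`, `η`, and (on the left or right) `ε`. -/
theorem exists_left_of_span {a b : ℤ} {x₀ : ExteriorAlgebra R V}
    (h : ∀ x ∈ extPow R V a, ∃ c : R, x = c • x₀)
    {z : ExteriorAlgebra R V ⊗[R] ExteriorAlgebra R W} (hz : z ∈ bideg R V W a b) :
    ∃ y ∈ extPow R W b, z = x₀ ⊗ₜ y := by
  have : bideg R V W a b ≤ (extPow R W b).map (TensorProduct.mk R _ _ x₀) :=
    bideg_le fun x hx y hy => by
      obtain ⟨c, rfl⟩ := h x hx
      exact ⟨c • y, Submodule.smul_mem _ _ hy, by simp [TensorProduct.smul_tmul']⟩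
  obtain ⟨y, hy, rfl⟩ := this hz
  exact ⟨y, hy, rfl⟩

theorem exists_right_of_span {a b : ℤ} {y₀ : ExteriorAlgebra R W}
    (h : ∀ y ∈ extPow R W b, ∃ c : R, y = c • y₀)
    {z : ExteriorAlgebra R V ⊗[R] ExteriorAlgebra R W} (hz : z ∈ bideg R V W a b) :
    ∃ x ∈ extPow R V a, z = x ⊗ₜ y₀ := by
  have : bideg R V W a b ≤ (extPow R V a).map ((TensorProduct.mk R _ _).flip y₀) :=
    bideg_le fun x hx y hy => by
      obtain ⟨c, rfl⟩ := h y hy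
      exact ⟨c • x, Submodule.smul_mem _ _ hx, by simp [TensorProduct.smul_tmul']⟩
  obtain ⟨x, hx, rfl⟩ := this hz
  exact ⟨x, hx, rfl⟩

theorem exists_smul_one {x : ExteriorAlgebra R V} (hx : x ∈ extPow R V 0) :
    ∃ c : R, x = c • 1 := by
  obtain ⟨c, rfl⟩ := exists_algebraMap_of_mem hx
  exact ⟨c, Algebra.algebraMap_eq_smul_one c⟩

theorem exists_one_tmul {b : ℤ} {z : ExteriorAlgebra R V ⊗[R] ExteriorAlgebra R W}
    (hz : z ∈ bideg R V W 0 b) : ∃ y ∈ extPow R W b, z = 1 ⊗ₜ y :=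
  exists_left_of_span (fun _ => exists_smul_one) hz

theorem exists_tmul_one {a : ℤ} {z : ExteriorAlgebra R V ⊗[R] ExteriorAlgebra R W}
    (hz : z ∈ bideg R V W a 0) : ∃ x ∈ extPow R V a, z = x ⊗ₜ 1 :=
  exists_right_of_span (fun _ => exists_smul_one) hz

end Bidegrees

/-! ### Bidegrees of the operators. -/

section Operators

variable {R : Type uR} [CommRing R] {F : Type uF} [AddCommGroup F] [Module R F] {n : ℕ}

local notation "E" => ExteriorAlgebra R F
local notation "E'" => ExteriorAlgebra R (Module.Dual R F)
local notation "ι" => ExteriorAlgebra.ι R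

theorem bidegDD_eq (a c : ℤ) :
    (bidegDD a c : Submodule R (E' ⊗[R] E')) = bideg R (Module.Dual R F) (Module.Dual R F) a c :=
  rfl
theorem bidegFD_eq (a c : ℤ) :
    (bidegFD a c : Submodule R (E ⊗[R] E')) = bideg R F (Module.Dual R F) a c := rfl
theorem projDD_eq (a c : ℤ) :
    (projDD a c : E' ⊗[R] E' →ₗ[R] _) = bproj R (Module.Dual R F) (Module.Dual R F) a c := rfl
theorem projFD_eq (a c : ℤ) :
    (projFD a c : E ⊗[R] E' →ₗ[R] _) = bproj R F (Module.Dual R F) a c := rfl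

theorem bidegDD_eq_bot (b : Module.Basis (Fin n) R F) {a c : ℤ}
    (h : a < 0 ∨ n < a ∨ c < 0 ∨ n < c) : (bidegDD a c : Submodule R (E' ⊗[R] E')) = ⊥ := by
  rw [bidegDD_eq]
  rcases h with h | h | h | h
  · exact bideg_eq_bot_left (extPow_of_neg h)
  · exact bideg_eq_bot_left (extPow_eq_bot_of_lt b.dualBasis h)
  · exact bideg_eq_bot_right (extPow_of_neg h)
  · exact bideg_eq_bot_right (extPow_eq_bot_of_lt b.dualBasis h)

theorem bidegFD_eq_bot (b : Module.Basis (Fin n) R F) {a c : ℤ}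
    (h : a < 0 ∨ n < a ∨ c < 0 ∨ n < c) : (bidegFD a c : Submodule R (E ⊗[R] E')) = ⊥ := by
  rw [bidegFD_eq]
  rcases h with h | h | h | h
  · exact bideg_eq_bot_left (extPow_of_neg h)
  · exact bideg_eq_bot_left (extPow_eq_bot_of_lt b h)
  · exact bideg_eq_bot_right (extPow_of_neg h)
  · exact bideg_eq_bot_right (extPow_eq_bot_of_lt b.dualBasis h)

theorem bidegDD_cast {a c a' c' : ℤ} {z : E' ⊗[R] E'} (hz : z ∈ bidegDD a c)
    (ha : a = a') (hc : c = c') : z ∈ bidegDD a' c' := ha ▸ hc ▸ hz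

theorem bidegFD_cast {a c a' c' : ℤ} {z : E ⊗[R] E'} (hz : z ∈ bidegFD a c)
    (ha : a = a') (hc : c = c') : z ∈ bidegFD a' c' := ha ▸ hc ▸ hz

theorem coact_ι_mem {t : ℤ} (v : F) {β : E'} (hβ : β ∈ extPow R (Module.Dual R F) t) :
    coact (ι v) β ∈ extPow R (Module.Dual R F) (t - 1) := coact_mem (ι_mem_extPow v) hβ

theorem act_ι_mem {t : ℤ} (w : Module.Dual R F) {a : E} (ha : a ∈ extPow R F t) :
    act (ι w) a ∈ extPow R F (t - 1) := act_mem (ι_mem_extPow w) ha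

theorem conR_memDD (v : F) {a c : ℤ} {z : E' ⊗[R] E'} (hz : z ∈ bidegDD a c) :
    conR v z ∈ bidegDD a (c - 1) :=
  map_mem_bideg (g := LinearMap.id) (fun _ hx => hx) (fun _ hy => coact_ι_mem v hy) hz

theorem conR_memFD (v : F) {a c : ℤ} {z : E ⊗[R] E'} (hz : z ∈ bidegFD a c) :
    conR v z ∈ bidegFD a (c - 1) :=
  map_mem_bideg (g := LinearMap.id) (fun _ hx => hx) (fun _ hy => coact_ι_mem v hy) hz

theorem conL_mem (v : F) {a c : ℤ} {z : E' ⊗[R] E'} (hz : z ∈ bidegDD a c) :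
    conL v z ∈ bidegDD (a - 1) c :=
  map_mem_bideg (k := LinearMap.id) (fun _ hy => coact_ι_mem v hy) (fun _ hx => hx) hz

theorem conF_mem (w : Module.Dual R F) {a c : ℤ} {z : E ⊗[R] E'} (hz : z ∈ bidegFD a c) :
    conF w z ∈ bidegFD (a - 1) c :=
  map_mem_bideg (k := LinearMap.id) (fun _ hy => act_ι_mem w hy) (fun _ hx => hx) hz

theorem mapX_mem (X : F →ₗ[R] Module.Dual R F) {a c : ℤ} {z : E ⊗[R] E'} (hz : z ∈ bidegFD a c) :
    mapX X z ∈ bidegDD a c :=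
  map_mem_bideg (k := LinearMap.id) (fun _ hy => map_mem_extPow X hy) (fun _ hx => hx) hz

theorem swap_mem {a c : ℤ} {z : E' ⊗[R] E'} (hz : z ∈ bidegDD a c) :
    swap R F z ∈ bidegDD c a := by
  have : (bidegDD a c : Submodule R (E' ⊗[R] E')) ≤ (bidegDD c a).comap (swap R F) :=
    bideg_le fun x hx y hy => tmul_mem_bideg hy hx
  exact this hz

theorem cas_mem {κ : Type*} [Fintype κ] (b : Module.Basis κ R F) {a c : ℤ} {z : E ⊗[R] E'}
    (hz : z ∈ bidegFD a c) : cas b z ∈ bidegFD (a - 1) (c - 1) := by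
  rw [cas, LinearMap.sum_apply]
  exact sum_mem fun i _ =>
    map_mem_bideg (fun _ hy => act_ι_mem _ hy) (fun _ hx => coact_ι_mem _ hx) hz

theorem cas_one_tmul {κ : Type*} [Fintype κ] (b : Module.Basis κ R F) (β : E') :
    cas b ((1 : E) ⊗ₜ β) = 0 := by
  have : ∀ w : Module.Dual R F, act (ι w) (1 : E) = 0 := fun w => by
    simpa using act_ι_algebraMap w (1 : R)
  simp [cas_tmul, this]

theorem mu_mem {a c : ℤ} {z : E ⊗[R] E'} (hz : z ∈ bidegFD a c) :
    (BasicData.mu z : E') ∈ extPow R (Module.Dual R F) (c - a) := by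
  have : (bidegFD a c : Submodule R (E ⊗[R] E')) ≤
      (extPow R (Module.Dual R F) (c - a)).comap BasicData.mu :=
    bideg_le fun x hx y hy => coact_mem hx hy
  exact this hz

/-- On `F ⊗ ⋀F^*` the map `a ⊗ β ↦ ∑ (⋀X)(a') ⊗ a₁(β)` is contraction. -/
theorem mapX_cas_of_mem_one {κ : Type*} [Fintype κ] (b : Module.Basis κ R F)
    (X : F →ₗ[R] Module.Dual R F) {c : ℤ} {z : E ⊗[R] E'} (hz : z ∈ bidegFD 1 c) :
    mapX X (cas b z) = (1 : E') ⊗ₜ BasicData.mu z :=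
  eqOn_bideg (mapX X ∘ₗ cas b) (TensorProduct.mk R E' E' 1 ∘ₗ BasicData.mu) (fun x hx y _ => by
    obtain ⟨a, rfl⟩ := exists_ι_of_mem hx
    simp only [LinearMap.comp_apply, cas_tmul, map_sum, LinearMap.rTensor_tmul, act_ι_ι,
      AlgHom.toLinearMap_apply, AlgHom.commutes, TensorProduct.mk_apply, BasicData.mu,
      TensorProduct.lift.tmul]
    conv_rhs => rw [← b.sum_repr a]
    simp only [map_sum, map_smul, LinearMap.sum_apply, LinearMap.smul_apply,
      TensorProduct.tmul_sum, TensorProduct.tmul_smul, Algebra.algebraMap_eq_smul_one,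
      ← TensorProduct.smul_tmul', Module.Basis.coord_apply]) hz

namespace BasicData

variable (D : BasicData R F n) (b : Module.Basis (Fin n) R F)

theorem mapAT_mem (Y : F →ₗ[R] Module.Dual R F) {a c : ℤ} {z : E' ⊗[R] E'}
    (hz : z ∈ bidegDD a c) : D.mapAT Y z ∈ bidegFD a c :=
  map_mem_bideg (k := LinearMap.id) (fun _ hy => D.mapA_mem Y hy) (fun _ hx => hx) hz

include b in
-- With `A_Y(ε) = η` (`mapA_eps`) this makes `σ(β)` the second component of `f(ε ⊗ β)`.
theorem sigma_eq_cas (β : E') : D.sigma β = cas b (D.eta ⊗ₜ β) := by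
  rw [sigma, LinearMap.comp_apply, comulOne_eq_sum_coact b, map_sum, cas_tmul]
  rfl

include b in
theorem sigma_mem {s : ℤ} {β : E'} (hβ : β ∈ extPow R (Module.Dual R F) s) :
    D.sigma β ∈ bidegFD (n - 1) (s - 1) := by
  rw [D.sigma_eq_cas b]; exact cas_mem b (tmul_mem_bideg D.eta_mem hβ)

include b in
theorem mapA_eps (Y : F →ₗ[R] Module.Dual R F) : mapA Y D.eta D.eps = D.eta := by
  rw [mapA_apply, D.act_eps_eta b, map_one, act_one]

include b in
theorem exists_smul_eta {a : E} (ha : a ∈ extPow R F n) : ∃ c : R, a = c • D.eta := by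
  obtain ⟨c, hc⟩ := exists_algebraMap_of_mem
    (extPow_cast (coact_mem ha D.eps_mem) (sub_self _))
  exact ⟨c, by rw [← D.act_coact_eps b a, hc, act_algebraMap]⟩

include b in
theorem exists_smul_eps {α : E'} (hα : α ∈ extPow R (Module.Dual R F) n) :
    ∃ c : R, α = c • D.eps := by
  obtain ⟨c, hc⟩ := exists_algebraMap_of_mem
    (extPow_cast (act_mem hα D.eta_mem) (sub_self _))
  exact ⟨c, by rw [← D.coact_act_eta b α, hc, coact_algebraMap]⟩

include b in
theorem exists_eta_tmul {c : ℤ} {z : E ⊗[R] E'} (hz : z ∈ bidegFD n c) :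
    ∃ β ∈ extPow R (Module.Dual R F) c, z = D.eta ⊗ₜ β :=
  exists_left_of_span (fun _ => D.exists_smul_eta b) hz

include b in
theorem exists_eps_tmul {c : ℤ} {z : E' ⊗[R] E'} (hz : z ∈ bidegDD n c) :
    ∃ β ∈ extPow R (Module.Dual R F) c, z = D.eps ⊗ₜ β :=
  exists_left_of_span (fun _ => D.exists_smul_eps b) hz

include b in
theorem exists_tmul_eps {c : ℤ} {z : E' ⊗[R] E'} (hz : z ∈ bidegDD c n) :
    ∃ β ∈ extPow R (Module.Dual R F) c, z = β ⊗ₜ D.eps :=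
  exists_right_of_span (fun _ => D.exists_smul_eps b) hz

end BasicData
end Operators

/-! ### Values of `f` and `τ` on the distinguished elements. -/

section Evaluation

variable {R : Type uR} [CommRing R] {F : Type uF} [AddCommGroup F] [Module R F] {n : ℕ}

local notation "E" => ExteriorAlgebra R F
local notation "E'" => ExteriorAlgebra R (Module.Dual R F)
local notation "ι" => ExteriorAlgebra.ι R
local notation "sp" => scalarPart R (Module.Dual R F)
local notation "Λ" => extPow R (Module.Dual R F)

theorem scalarPart_of_mem_ne {V : Type*} [AddCommGroup V] [Module R V] {t : ℤ} (ht : t ≠ 0)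
    {x : ExteriorAlgebra R V} (hx : x ∈ extPow R V t) : scalarPart R V x = 0 := by
  have h := extProj_of_mem_ne hx ht
  have key : scalarPart R V ∘ₗ extProj R V 0 = scalarPart R V := by
    refine LinearMap.ext fun y => ?_
    refine ext_left_induction (P := fun y => (scalarPart R V ∘ₗ extProj R V 0) y = scalarPart R V y)
      ?_ ?_ ?_ y
    · intro c
      rw [LinearMap.comp_apply, extProj_of_mem (algebraMap_mem_extPow c)]
    · intro y z hy hz; simp only [map_add, hy, hz]
    · intro a y _
      rw [scalarPart_ι_mul]
      suffices h : ∀ y : ExteriorAlgebra R V, extProj R V 0 (ExteriorAlgebra.ι R a * y) = 0 by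
        rw [LinearMap.comp_apply, h, map_zero]
      intro y
      induction y using DirectSum.Decomposition.inductionOn (fun i : ℕ => ⋀[R]^i V) with
      | zero => simp
      | homogeneous x =>
        rename_i i
        exact extProj_of_mem_ne (ι_mul_mem_extPow a (by rw [extPow_natCast]; exact x.2))
          (by omega)
      | add y z hy hz => rw [mul_add, map_add, hy, hz, add_zero]
  rw [← key, LinearMap.comp_apply, h, map_zero]

theorem eq_smul_one_of_mem {x : E'} (hx : x ∈ Λ 0) : x = sp x • 1 := by
  conv_lhs => rw [eq_scalarPart_of_mem hx]
  rw [Algebra.algebraMap_eq_smul_one]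

theorem map_units_smul {A B : Type*} [AddCommGroup A] [Module R A] [AddCommGroup B] [Module R B]
    (g : A →ₗ[R] B) (s : ℤˣ) (x : A) : g (s • x) = s • g x := by
  rcases Int.units_eq_one_or s with rfl | rfl <;> simp

namespace BasicData

variable (D : BasicData R F n) (b : Module.Basis (Fin n) R F)

include b in
-- Contractions kill `1`, so only two terms are left; the first is one of the unit components of `f`
-- that `τ` inverts. The formulas after it isolate the other unit components in the same way.
theorem f_one_in2 (r : ℤ) (β : E') : D.f r (in2 (1 ⊗ₜ β)) =
    r.negOnePow • in1 (1 ⊗ₜ β) + in2 (1 ⊗ₜ coact (ι D.v) β) := by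
  have : ∀ w : Module.Dual R F, act (ι w) (1 : E) = 0 := fun w => by
    simpa using act_ι_algebraMap w (1 : R)
  rw [f_in2, D.f2_apply b, cas_one_tmul]
  simp [this]

include b in
theorem f_one_in3 (r : ℤ) (β : E') : D.f r (in3 (1 ⊗ₜ β)) =
    (r + 1).negOnePow • in1 (β ⊗ₜ 1) + (r + 1).negOnePow • in3 (1 ⊗ₜ coact (ι D.u) β) := by
  have : ∀ w : Module.Dual R F, act (ι w) (1 : E) = 0 := fun w => by
    simpa using act_ι_algebraMap w (1 : R)
  rw [f_in3, D.f3_apply b, cas_one_tmul]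
  simp [this]

include b in
theorem f_in2_of_mem_one (r : ℤ) {c : ℤ} {z : E ⊗[R] E'} (hz : z ∈ bidegFD 1 c) :
    D.f r (in2 z) = r.negOnePow • in1 (mapX D.X z) + in2 (conR D.v z) +
      (r + 1).negOnePow • in2 (conF (D.Xs D.u) z) + in4 (1 ⊗ₜ mu z) := by
  rw [f_in2, D.f2_apply b, mapX_cas_of_mem_one b _ hz]
  simp only [map_add, map_units_smul]; abel

include b in
theorem f_in3_of_mem_one (r : ℤ) {c : ℤ} {z : E ⊗[R] E'} (hz : z ∈ bidegFD 1 c) :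
    D.f r (in3 z) = (r + 1).negOnePow • in1 (swap R F (mapX D.Xs z)) +
      (r + 1).negOnePow • in3 (conR D.u z) + in3 (conF (D.X D.v) z) - in4 (mu z ⊗ₜ 1) := by
  rw [f_in3, D.f3_apply b, mapX_cas_of_mem_one b _ hz]
  simp only [map_add, map_units_smul, LinearEquiv.coe_coe, TensorProduct.comm_tmul]
  abel

include b in
theorem f_eps_in1 (r : ℤ) (β : E') : D.f r (in1 (D.eps ⊗ₜ β)) =
    in1 (D.eps ⊗ₜ coact (ι D.v) β) + r.negOnePow • in1 (coact (ι D.u) D.eps ⊗ₜ β) +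
      in2 (D.sigma β) + in3 (cas b (D.mapAT D.X (β ⊗ₜ D.eps))) := by
  rw [f_in1, D.f1_apply b, D.sigma_eq_cas b]
  simp [D.mapA_eps b]

include b in
theorem f_in1_eps (r : ℤ) (β : E') : D.f r (in1 (β ⊗ₜ D.eps)) =
    in1 (β ⊗ₜ coact (ι D.v) D.eps) + r.negOnePow • in1 (coact (ι D.u) β ⊗ₜ D.eps) +
      in2 (cas b (D.mapAT D.Xs (β ⊗ₜ D.eps))) + in3 (D.sigma β) := by
  rw [f_in1, D.f1_apply b, D.sigma_eq_cas b]
  simp [D.mapA_eps b]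

include b in
theorem f_eps_in4 (r : ℤ) (β : E') : D.f r (in4 (D.eps ⊗ₜ β)) =
    r.negOnePow • in2 (D.eta ⊗ₜ β) + r.negOnePow • in3 (D.mapAT D.X (β ⊗ₜ D.eps)) +
      in4 (D.eps ⊗ₜ coact (ι D.v) β) + r.negOnePow • in4 (coact (ι D.u) D.eps ⊗ₜ β) := by
  rw [f_in4, f4_apply, LinearMap.rTensor_tmul, D.mapA_eps b]
  simp [add_assoc]

include b in
theorem f_in4_eps (r : ℤ) (β : E') : D.f r (in4 (β ⊗ₜ D.eps)) =
    r.negOnePow • in2 (D.mapAT D.Xs (β ⊗ₜ D.eps)) + r.negOnePow • in3 (D.eta ⊗ₜ β) +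
      in4 (β ⊗ₜ coact (ι D.v) D.eps) + r.negOnePow • in4 (coact (ι D.u) β ⊗ₜ D.eps) := by
  rw [f_in4, f4_apply]
  simp [add_assoc, D.mapA_eps b]

end BasicData

namespace BasicData.Splittings

variable {D : BasicData R F n} (S : D.Splittings) (b : Module.Basis (Fin n) R F)

theorem tau_in1 (r : ℤ) (z : E' ⊗[R] E') : S.tau r (in1 z) = S.tau1 r z := by
  simp [tau, in1, out1, out2, out3, out4]
theorem tau_in2 (r : ℤ) (z : E ⊗[R] E') : S.tau r (in2 z) = S.tau2 r z := by
  simp [tau, in2, out1, out2, out3, out4]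
theorem tau_in3 (r : ℤ) (z : E ⊗[R] E') : S.tau r (in3 z) = S.tau3 r z := by
  simp [tau, in3, out1, out2, out3, out4]
theorem tau_in4 (r : ℤ) (z : E' ⊗[R] E') : S.tau r (in4 z) = S.tau4 r z := by
  simp [tau, in4, out1, out2, out3, out4]

/-- The ranges in the definition of `τ` matter only at a few ends; elsewhere the truncated map is
already zero for reasons of degree, and the condition may be dropped. -/
theorem chiMap_apply {A B : Type*} [AddCommGroup A] [Module R A] [AddCommGroup B] [Module R B]
    (p : Prop) [Decidable p] (g : A →ₗ[R] B) (x : A) (h : ¬ p → g x = 0) :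
    chiMap p g x = g x := by
  unfold chiMap
  split_ifs with hp
  · rfl
  · rw [h hp, LinearMap.zero_apply]

theorem chiMap_apply_zero {A B : Type*} [AddCommGroup A] [Module R A] [AddCommGroup B] [Module R B]
    (p : Prop) [Decidable p] (g : A →ₗ[R] B) (x : A) (h : p → g x = 0) :
    chiMap p g x = 0 := by
  unfold chiMap
  split_ifs with hp
  · exact h hp
  · rfl

theorem dropL_tmul (α β : E') : (dropL : E' ⊗[R] E' →ₗ[R] E') (α ⊗ₜ β) = sp α • β := by
  simp [dropL]

theorem dropR_tmul (α β : E') : (dropR : E' ⊗[R] E' →ₗ[R] E') (α ⊗ₜ β) = sp β • α := by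
  simp [dropR]

include b in
theorem dropEta_tmul (β : E') : dropEta D (D.eta ⊗ₜ β) = β := by
  simp [dropEta, D.act_eps_eta b]

theorem dropL_proj {t c : ℤ} {α β : E'} (hα : α ∈ Λ t) (hβ : β ∈ Λ c) {d : ℤ} (hd : t = 0 → d = c) :
    dropL (projDD 0 d (α ⊗ₜ[R] β)) = sp α • β := by
  by_cases ht : t = 0
  · subst ht
    rw [projDD_eq, bproj_of_mem (tmul_mem_bideg hα (hd rfl ▸ hβ)), dropL_tmul]
  · rw [projDD_eq, bproj_of_mem_ne (tmul_mem_bideg hα hβ) (Or.inl ht), map_zero,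
      scalarPart_of_mem_ne ht hα, zero_smul]

theorem dropR_proj {t c : ℤ} {α β : E'} (hα : α ∈ Λ t) (hβ : β ∈ Λ c) {d : ℤ} (hd : c = 0 → d = t) :
    dropR (projDD d 0 (α ⊗ₜ[R] β)) = sp β • α := by
  by_cases hc : c = 0
  · subst hc
    rw [projDD_eq, bproj_of_mem (tmul_mem_bideg (hd rfl ▸ hα) hβ), dropR_tmul]
  · rw [projDD_eq, bproj_of_mem_ne (tmul_mem_bideg hα hβ) (Or.inr hc), map_zero,
      scalarPart_of_mem_ne hc hβ, zero_smul]

include b in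
theorem eq_zero_or_mem_Icc {s : ℤ} {x : E'} (hx : x ∈ Λ s) : x = 0 ∨ (0 ≤ s ∧ s ≤ n) := by
  rcases lt_or_ge s 0 with h | h
  · exact Or.inl (eq_zero_of_mem_neg h hx)
  rcases lt_or_ge (n : ℤ) s with h' | h'
  · exact Or.inl (eq_zero_of_mem_gt b.dualBasis h' hx)
  · exact Or.inr ⟨h, h'⟩

include b in
theorem tau1_tmul {r t c : ℤ} (hr : t + c = r + 1) {α β : E'} (hα : α ∈ Λ t) (hβ : β ∈ Λ c) :
    S.tau1 r (α ⊗ₜ β) = (r + 1).negOnePow • in2 (1 ⊗ₜ (sp α • β)) +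
      -- In degree `-1` the element `1 ⊗ 1` fits both cases of `τ`. Only the second summand is used,
      -- since `[1 ⊗ 1]_3` belongs to `𝕄_0`.
      if r = -1 then 0 else r.negOnePow • in3 (1 ⊗ₜ (sp β • α)) := by
  have e1 : sp α • β = 0 ∨ (-1 ≤ r ∧ r ≤ n - 1) := by
    by_cases ht : t = 0
    · rcases eq_zero_or_mem_Icc b hβ with h | h
      · left; rw [h, smul_zero]
      · right; omega
    · left; rw [scalarPart_of_mem_ne ht hα, zero_smul]
  have e2 : sp β • α = 0 ∨ (-1 ≤ r ∧ r ≤ n - 1) := by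
    by_cases ht : c = 0
    · rcases eq_zero_or_mem_Icc b hα with h | h
      · left; rw [h, smul_zero]
      · right; omega
    · left; rw [scalarPart_of_mem_ne ht hβ, zero_smul]
  rw [tau1, LinearMap.add_apply, chiMap_apply]
  · congr 1
    · simp [dropL_proj hα hβ (show t = 0 → r + 1 = c by omega), tensorL]
    · split_ifs with h
      · exact chiMap_apply_zero _ _ _ fun h' => by omega
      · rw [chiMap_apply]
        · simp [dropR_proj hα hβ (show c = 0 → r + 1 = t by omega), tensorL]
        · intro h'
          rcases e2 with e2 | e2
          · simp [dropR_proj hα hβ (show c = 0 → r + 1 = t by omega), e2]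
          · omega
  · intro h'
    rcases e1 with e1 | e1
    · simp [dropL_proj hα hβ (show t = 0 → r + 1 = c by omega), e1]
    · omega

include b in
theorem tau4_tmul {r t c : ℤ} (hr : t + c = r - 1) {α β : E'} (hα : α ∈ Λ t) (hβ : β ∈ Λ c) :
    S.tau4 r (α ⊗ₜ β) = in2 (S.ell (sp α • β)) -
      -- In degree 1 the element `1 ⊗ 1` again has two partners, and the one in the third summand
      -- belongs to `𝕄_2`.
      if r = 1 then 0 else in3 (S.ell (sp β • α)) := by
  have e1 : S.ell (sp α • β) = 0 ∨ (1 ≤ r ∧ r ≤ n) := by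
    by_cases ht : t = 0
    · rcases eq_zero_or_mem_Icc b hβ with h | h
      · left; rw [h, smul_zero, map_zero]
      -- The range for `r` stops at `n`: beyond it `β` has degree `n`, where `ℓ` is zero by
      -- convention.
      · by_cases hc : c = n
        · left; rw [map_smul, S.ell_top β (hc ▸ hβ), smul_zero]
        · right; omega
    · left; rw [scalarPart_of_mem_ne ht hα, zero_smul, map_zero]
  have e2 : S.ell (sp β • α) = 0 ∨ (1 ≤ r ∧ r ≤ n) := by
    by_cases ht : c = 0
    · rcases eq_zero_or_mem_Icc b hα with h | h
      · left; rw [h, smul_zero, map_zero]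
      · by_cases hc : t = n
        · left; rw [map_smul, S.ell_top α (hc ▸ hα), smul_zero]
        · right; omega
    · left; rw [scalarPart_of_mem_ne ht hβ, zero_smul, map_zero]
  rw [tau4, LinearMap.sub_apply, chiMap_apply]
  · congr 1
    · simp only [LinearMap.comp_apply, dropL_proj hα hβ (show t = 0 → r - 1 = c by omega)]
    · split_ifs with h
      · exact chiMap_apply_zero _ _ _ fun h' => by omega
      · rw [chiMap_apply]
        · simp only [LinearMap.comp_apply, dropR_proj hα hβ (show c = 0 → r - 1 = t by omega)]
        · intro h'
          rcases e2 with e2 | e2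
          · simp only [LinearMap.comp_apply, dropR_proj hα hβ (show c = 0 → r - 1 = t by omega), e2,
              map_zero]
          · omega
  · intro h'
    rcases e1 with e1 | e1
    · simp only [LinearMap.comp_apply, dropL_proj hα hβ (show t = 0 → r - 1 = c by omega), e1,
        map_zero]
    · omega

theorem lam_sigma_of_mem {s : ℤ} (hs : s ≠ 0) {β : E'} (hβ : β ∈ Λ s) : S.lam (D.sigma β) = β :=
  S.lam_sigma (s - 1) (by omega) β (by rwa [sub_add_cancel])

include b in
-- The Kronecker delta becomes a scalar part: `v(β)` has degree 0 only for `s = 1`, that is, for `r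
-- = n - 1`.
theorem tau2_sigma {r s : ℤ} (hr : r = n - 2 + s) (hs : s ≠ 0) {β : E'} (hβ : β ∈ Λ s) :
    S.tau2 r (D.sigma β) = in1 (D.eps ⊗ₜ β) +
      (n : ℤ).negOnePow • sp (coact (ι D.v) β) • in3 (1 ⊗ₜ D.eps) := by
  have hm := D.sigma_mem b hβ
  have h1 : projFD (n - 1) (r + 1 - n) (D.sigma β) = D.sigma β :=
    bproj_of_mem (bidegFD_cast hm rfl (by omega))
  have h2 : projFD n (r - n) (D.sigma β) = 0 := bproj_of_mem_ne hm (by omega)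
  rw [tau2, LinearMap.add_apply, chiMap_apply_zero (n ≤ r ∧ r ≤ 2 * n), add_zero, chiMap_apply]
  · simp only [LinearMap.comp_apply, h1, S.lam_sigma_of_mem hs hβ, LinearMap.add_apply]
    congr 1
    rw [chiMap_apply]
    · simp [Units.smul_def]
    · intro h
      simp [scalarPart_of_mem_ne (show s - 1 ≠ 0 by omega) (coact_ι_mem D.v hβ)]
  · intro h
    rcases eq_zero_or_mem_Icc b hβ with h' | h'
    · simp [h']
    · omega
  · intro _; simp only [LinearMap.comp_apply, h2, map_zero]

include b in
-- The degree `s = n` is excluded because `[σ(ε)]_3` lies in `𝕄_(2n-2)`.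
theorem tau3_sigma {r s : ℤ} (hr : r = n - 2 + s) (hs : s ≠ 0) (hs' : s ≠ n) {β : E'} (hβ : β ∈ Λ s) :
    S.tau3 r (D.sigma β) = in1 (β ⊗ₜ D.eps) -
      sp (coact (ι D.u) β) • in2 (1 ⊗ₜ D.eps) := by
  have hm := D.sigma_mem b hβ
  have h1 : projFD (n - 1) (r + 1 - n) (D.sigma β) = D.sigma β :=
    bproj_of_mem (bidegFD_cast hm rfl (by omega))
  have h2 : projFD n (r - n) (D.sigma β) = 0 := bproj_of_mem_ne hm (by omega)
  rw [tau3, LinearMap.add_apply, chiMap_apply_zero (n ≤ r ∧ r ≤ 2 * n - 1), add_zero, chiMap_apply]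
  · simp only [LinearMap.comp_apply, h1, S.lam_sigma_of_mem hs hβ, LinearMap.sub_apply]
    congr 1
    rw [chiMap_apply]
    · simp
    · intro h
      simp [scalarPart_of_mem_ne (show s - 1 ≠ 0 by omega) (coact_ι_mem D.u hβ)]
  · intro h
    rcases eq_zero_or_mem_Icc b hβ with h' | h'
    · simp [h']
    · omega
  · intro _; simp only [LinearMap.comp_apply, h2, map_zero]

include b in
theorem tau2_eta {r s : ℤ} (hr : r = n + s) {β : E'} (hβ : β ∈ Λ s) :
    S.tau2 r (D.eta ⊗ₜ β) = (r + 1).negOnePow • in4 (D.eps ⊗ₜ β) +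
      sp β • in3 (S.ell (coact (ι D.u) D.eps)) := by
  have hm : D.eta ⊗ₜ β ∈ bidegFD (n : ℤ) s := tmul_mem_bideg D.eta_mem hβ
  have h1 : projFD n (r - n) (D.eta ⊗ₜ β) = D.eta ⊗ₜ β :=
    bproj_of_mem (bidegFD_cast hm rfl (by omega))
  have h2 : projFD (n - 1) (r + 1 - n) (D.eta ⊗ₜ β) = 0 := bproj_of_mem_ne hm (by omega)
  rw [tau2, LinearMap.add_apply, chiMap_apply_zero (n - 1 ≤ r ∧ r ≤ 2 * n - 2), zero_add,
    chiMap_apply]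
  · simp only [LinearMap.comp_apply, h1, dropEta_tmul b, LinearMap.add_apply]
    congr 1
    rw [chiMap_apply]
    · simp
    · intro h
      simp [scalarPart_of_mem_ne (show s ≠ 0 by omega) hβ]
  · intro h
    rcases eq_zero_or_mem_Icc b hβ with h' | h'
    · simp [h']
    · omega
  · intro _; simp only [LinearMap.comp_apply, h2, map_zero]

include b in
-- The degree `s = n` is excluded because `[η ⊗ ε]_3` lies in `𝕄_(2n)`.
theorem tau3_eta {r s : ℤ} (hr : r = n + s) (hs : s ≠ n) {β : E'} (hβ : β ∈ Λ s) :
    S.tau3 r (D.eta ⊗ₜ β) = (r + 1).negOnePow • in4 (β ⊗ₜ D.eps) +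
      (n : ℤ).negOnePow • sp β • in2 (S.ell (coact (ι D.v) D.eps)) := by
  have hm : D.eta ⊗ₜ β ∈ bidegFD (n : ℤ) s := tmul_mem_bideg D.eta_mem hβ
  have h1 : projFD n (r - n) (D.eta ⊗ₜ β) = D.eta ⊗ₜ β :=
    bproj_of_mem (bidegFD_cast hm rfl (by omega))
  have h2 : projFD (n - 1) (r + 1 - n) (D.eta ⊗ₜ β) = 0 := bproj_of_mem_ne hm (by omega)
  rw [tau3, LinearMap.add_apply, chiMap_apply_zero (n - 1 ≤ r ∧ r ≤ 2 * n - 3), zero_add,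
    chiMap_apply]
  · simp only [LinearMap.comp_apply, h1, dropEta_tmul b, LinearMap.add_apply]
    congr 1
    rw [chiMap_apply]
    · simp [Units.smul_def]
    · intro h
      simp [scalarPart_of_mem_ne (show s ≠ 0 by omega) hβ]
  · intro h
    rcases eq_zero_or_mem_Icc b hβ with h' | h'
    · simp [h']
    · omega
  · intro _; simp only [LinearMap.comp_apply, h2, map_zero]

/-- The map `τ_r(2)` vanishes on `⋀^t F ⊗ ⋀^c F^*` unless `t` is `n - 1` or `n`. -/
theorem tau2_eq_zero {r t c : ℤ} (ht : t = n - 1 → 2 * n - 2 < r) (ht' : t = n → 2 * n < r)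
    {z : E ⊗[R] E'} (hz : z ∈ bidegFD t c) : S.tau2 r z = 0 := by
  rw [tau2, LinearMap.add_apply, chiMap_apply_zero, chiMap_apply_zero, add_zero]
  · intro h
    simp only [LinearMap.comp_apply, projFD_eq, bproj_of_mem_ne hz (Or.inl (show t ≠ n by omega)),
      map_zero]
  · intro h
    simp only [LinearMap.comp_apply, projFD_eq,
      bproj_of_mem_ne hz (Or.inl (show t ≠ n - 1 by omega)), map_zero]

/-- The map `τ_r(3)` vanishes on `⋀^t F ⊗ ⋀^c F^*` unless `t` is `n - 1` or `n`. -/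
theorem tau3_eq_zero {r t c : ℤ} (ht : t = n - 1 → 2 * n - 3 < r) (ht' : t = n → 2 * n - 1 < r)
    {z : E ⊗[R] E'} (hz : z ∈ bidegFD t c) : S.tau3 r z = 0 := by
  rw [tau3, LinearMap.add_apply, chiMap_apply_zero, chiMap_apply_zero, add_zero]
  · intro h
    simp only [LinearMap.comp_apply, projFD_eq, bproj_of_mem_ne hz (Or.inl (show t ≠ n by omega)),
      map_zero]
  · intro h
    simp only [LinearMap.comp_apply, projFD_eq,
      bproj_of_mem_ne hz (Or.inl (show t ≠ n - 1 by omega)), map_zero]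

theorem tau2_coP {r : ℤ} {z : E ⊗[R] E'} (hz : z ∈ S.coP r) : S.tau2 r z = 0 := by
  obtain ⟨hz, hk⟩ := hz
  have hk : S.lam z = 0 := hk
  rw [tau2, LinearMap.add_apply, chiMap_apply_zero, chiMap_apply_zero, add_zero]
  · intro h
    simp only [LinearMap.comp_apply, projFD_eq,
      bproj_of_mem_ne hz (Or.inl (show (n - 1 : ℤ) ≠ n by omega)), map_zero]
  · intro h
    simp only [LinearMap.comp_apply, projFD_eq, bproj_of_mem hz, hk, map_zero]

theorem tau3_coP {r : ℤ} {z : E ⊗[R] E'} (hz : z ∈ S.coP r) : S.tau3 r z = 0 := by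
  obtain ⟨hz, hk⟩ := hz
  have hk : S.lam z = 0 := hk
  rw [tau3, LinearMap.add_apply, chiMap_apply_zero, chiMap_apply_zero, add_zero]
  · intro h
    simp only [LinearMap.comp_apply, projFD_eq,
      bproj_of_mem_ne hz (Or.inl (show (n - 1 : ℤ) ≠ n by omega)), map_zero]
  · intro h
    simp only [LinearMap.comp_apply, projFD_eq, bproj_of_mem hz, hk, map_zero]

include b in
theorem tau1_eq_zero {r t c : ℤ} (hr : t + c = r + 1) (ht : t ≠ 0) (hc : c ≠ 0)
    {z : E' ⊗[R] E'} (hz : z ∈ bidegDD t c) : S.tau1 r z = 0 :=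
  eqOn_bideg (S.tau1 r) 0 (fun x hx y hy => by
    rw [S.tau1_tmul b hr hx hy, scalarPart_of_mem_ne ht hx, scalarPart_of_mem_ne hc hy]
    simp) hz

include b in
theorem tau4_eq_zero {r t c : ℤ} (hr : t + c = r - 1) (ht : t ≠ 0 ∨ c = n) (hc : c ≠ 0 ∨ t = n)
    {z : E' ⊗[R] E'} (hz : z ∈ bidegDD t c) : S.tau4 r z = 0 :=
  eqOn_bideg (S.tau4 r) 0 (fun x hx y hy => by
    have h1 : S.ell (sp x • y) = 0 := by
      rcases ht with ht | ht
      · rw [scalarPart_of_mem_ne ht hx, zero_smul, map_zero]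
      · rw [map_smul, S.ell_top y (ht ▸ hy), smul_zero]
    have h2 : S.ell (sp y • x) = 0 := by
      rcases hc with hc | hc
      · rw [scalarPart_of_mem_ne hc hy, zero_smul, map_zero]
      · rw [map_smul, S.ell_top x (hc ▸ hx), smul_zero]
    rw [S.tau4_tmul b hr hx hy, h1, h2]
    simp) hz

end BasicData.Splittings
end Evaluation

/-! ### Generators of `𝔽`, `𝕄` and `N̂`, and the decomposition of `𝔽`. -/

section Summands

variable {R : Type uR} [CommRing R] {F : Type uF} [AddCommGroup F] [Module R F] {n : ℕ}

local notation "E" => ExteriorAlgebra R F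
local notation "E'" => ExteriorAlgebra R (Module.Dual R F)
local notation "ι" => ExteriorAlgebra.ι R
local notation "sp" => scalarPart R (Module.Dual R F)
local notation "Λ" => extPow R (Module.Dual R F)

theorem in1_mem_FF {r t c : ℤ} (h : t + c = r + 1) {z : E' ⊗[R] E'} (hz : z ∈ bidegDD t c) :
    in1 z ∈ FF R F r :=
  Submodule.mem_sup_left <| Submodule.mem_sup_left <| Submodule.mem_sup_left <|
    Submodule.mem_iSup_of_mem t ⟨z, bidegDD_cast hz rfl (by omega), rfl⟩

theorem in2_mem_FF {r t c : ℤ} (h : t + c = r) {z : E ⊗[R] E'} (hz : z ∈ bidegFD t c) :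
    in2 z ∈ FF R F r :=
  Submodule.mem_sup_left <| Submodule.mem_sup_left <| Submodule.mem_sup_right <|
    Submodule.mem_iSup_of_mem t ⟨z, bidegFD_cast hz rfl (by omega), rfl⟩

theorem in3_mem_FF {r t c : ℤ} (h : t + c = r) {z : E ⊗[R] E'} (hz : z ∈ bidegFD t c) :
    in3 z ∈ FF R F r :=
  Submodule.mem_sup_left <| Submodule.mem_sup_right <|
    Submodule.mem_iSup_of_mem t ⟨z, bidegFD_cast hz rfl (by omega), rfl⟩

theorem in4_mem_FF {r t c : ℤ} (h : t + c = r - 1) {z : E' ⊗[R] E'} (hz : z ∈ bidegDD t c) :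
    in4 z ∈ FF R F r :=
  Submodule.mem_sup_right <|
    Submodule.mem_iSup_of_mem t ⟨z, bidegDD_cast hz rfl (by omega), rfl⟩

theorem FF_le_of_bideg {r : ℤ} {P : Submodule R (Total R F)}
    (h1 : ∀ t c : ℤ, t + c = r + 1 → ∀ z ∈ bidegDD t c, in1 z ∈ P)
    (h2 : ∀ t c : ℤ, t + c = r → ∀ z ∈ bidegFD t c, in2 z ∈ P)
    (h3 : ∀ t c : ℤ, t + c = r → ∀ z ∈ bidegFD t c, in3 z ∈ P)
    (h4 : ∀ t c : ℤ, t + c = r - 1 → ∀ z ∈ bidegDD t c, in4 z ∈ P) : FF R F r ≤ P := by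
  refine sup_le (sup_le (sup_le ?_ ?_) ?_) ?_ <;> refine iSup_le fun t => ?_ <;>
    rintro _ ⟨z, hz, rfl⟩
  exacts [h1 t _ (by omega) z hz, h2 t _ (by omega) z hz, h3 t _ (by omega) z hz,
    h4 t _ (by omega) z hz]

theorem units_smul_mem {M : Type*} [AddCommGroup M] [Module R M] (P : Submodule R M) (s : ℤˣ)
    {x : M} (hx : x ∈ P) : s • x ∈ P := by
  rcases Int.units_eq_one_or s with rfl | rfl
  · rwa [one_smul]
  · rw [Units.neg_smul, one_smul]; exact neg_mem hx

theorem BasicData.f_mem (D : BasicData R F n) (b : Module.Basis (Fin n) R F) (r : ℤ)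
    (x : Total R F) (hx : x ∈ FF R F r) : D.f r x ∈ FF R F (r - 1) := by
  suffices h : FF R F r ≤ (FF R F (r - 1)).comap (D.f r) from h hx
  refine FF_le_of_bideg ?_ ?_ ?_ ?_ <;> intro t c htc z hz <;> rw [Submodule.mem_comap]
  · rw [D.f_in1, D.f1_apply b]
    refine add_mem (add_mem ?_ ?_) ?_
    · rw [map_add, map_units_smul]
      exact add_mem (in1_mem_FF (by omega) (conR_memDD _ hz))
        (units_smul_mem _ _ (in1_mem_FF (by omega) (conL_mem _ hz)))
    · exact in2_mem_FF (by omega) (cas_mem b (D.mapAT_mem _ hz))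
    · exact in3_mem_FF (by omega) (cas_mem b (D.mapAT_mem _ (swap_mem hz)))
  · rw [D.f_in2, D.f2_apply b]
    refine add_mem (add_mem ?_ ?_) ?_
    · rw [map_units_smul]
      exact units_smul_mem _ _ (in1_mem_FF (by omega) (mapX_mem _ hz))
    · rw [map_add, map_units_smul]
      exact add_mem (in2_mem_FF (by omega) (conR_memFD _ hz))
        (units_smul_mem _ _ (in2_mem_FF (by omega) (conF_mem _ hz)))
    · exact in4_mem_FF (by omega) (mapX_mem _ (cas_mem b hz))
  · rw [D.f_in3, D.f3_apply b]
    refine sub_mem (add_mem ?_ ?_) ?_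
    · rw [map_units_smul]
      exact units_smul_mem _ _ (in1_mem_FF (by omega) (swap_mem (mapX_mem _ hz)))
    · rw [map_add, map_units_smul]
      exact add_mem (units_smul_mem _ _ (in3_mem_FF (by omega) (conR_memFD _ hz)))
        (in3_mem_FF (by omega) (conF_mem _ hz))
    · exact in4_mem_FF (by omega) (swap_mem (mapX_mem _ (cas_mem b hz)))
  · rw [D.f_in4, D.f4_apply]
    refine add_mem (add_mem ?_ ?_) ?_
    · rw [map_units_smul]
      exact units_smul_mem _ _ (in2_mem_FF (by omega) (D.mapAT_mem _ hz))
    · rw [map_units_smul]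
      exact units_smul_mem _ _ (in3_mem_FF (by omega) (D.mapAT_mem _ (swap_mem hz)))
    · rw [map_add, map_units_smul]
      exact add_mem (in4_mem_FF (by omega) (conR_memDD _ hz))
        (units_smul_mem _ _ (in4_mem_FF (by omega) (conL_mem _ hz)))

namespace BasicData.Splittings

variable {D : BasicData R F n} (S : D.Splittings) (b : Module.Basis (Fin n) R F)

theorem mem_chi {p : Prop} [Decidable p] {N : Submodule R (Total R F)} {x : Total R F} (hp : p)
    (hx : x ∈ N) : x ∈ chi p N := by rwa [chi, if_pos hp]

theorem chi_le {p : Prop} [Decidable p] {N P : Submodule R (Total R F)} (h : p → N ≤ P) :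
    chi p N ≤ P := by
  unfold chi
  split_ifs with hp
  exacts [h hp, bot_le]

section HatN

variable {r s : ℤ}

theorem in1_left_mem_hatN {z : E' ⊗[R] E'} (hz : z ∈ bidegDD (n : ℤ) s) (h : 1 ≤ s) (h' : s ≤ n)
    (hr : r = n - 1 + s) : in1 z ∈ S.hatN r :=
  Submodule.mem_sup_left <| Submodule.mem_sup_left <| Submodule.mem_sup_left <|
    Submodule.mem_sup_left <| Submodule.mem_sup_left <| Submodule.mem_sup_left <|
    Submodule.mem_sup_left <| mem_chi (by omega) ⟨z, bidegDD_cast hz rfl (by omega), rfl⟩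

theorem in1_right_mem_hatN {z : E' ⊗[R] E'} (hz : z ∈ bidegDD s (n : ℤ)) (h : 1 ≤ s)
    (h' : s ≤ n - 1) (hr : r = n - 1 + s) : in1 z ∈ S.hatN r :=
  Submodule.mem_sup_left <| Submodule.mem_sup_left <| Submodule.mem_sup_left <|
    Submodule.mem_sup_left <| Submodule.mem_sup_left <| Submodule.mem_sup_left <|
    Submodule.mem_sup_right <|
    mem_chi (by omega) ⟨z, bidegDD_cast hz (by omega) (by omega), rfl⟩

theorem in2_zero_mem_hatN {z : E ⊗[R] E'} (hz : z ∈ bidegFD 0 s) (h : 0 ≤ s) (h' : s ≤ n)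
    (hr : r = s) : in2 z ∈ S.hatN r :=
  Submodule.mem_sup_left <| Submodule.mem_sup_left <| Submodule.mem_sup_left <|
    Submodule.mem_sup_left <| Submodule.mem_sup_left <|
    Submodule.mem_sup_right <| mem_chi (by omega) ⟨z, bidegFD_cast hz (by omega) (by omega), rfl⟩

theorem in2_ell_mem_hatN {β : E'} (hβ : β ∈ Λ s) (h : 0 ≤ s) (h' : s ≤ n - 1)
    (hr : r = s + 2) : in2 (S.ell β) ∈ S.hatN r :=
  Submodule.mem_sup_left <| Submodule.mem_sup_left <| Submodule.mem_sup_left <|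
    Submodule.mem_sup_left <| Submodule.mem_sup_right <|
    mem_chi (by omega) ⟨_, ⟨β, extPow_cast hβ (by omega), rfl⟩, rfl⟩

theorem in3_zero_mem_hatN {z : E ⊗[R] E'} (hz : z ∈ bidegFD 0 s) (h : 1 ≤ s) (h' : s ≤ n)
    (hr : r = s) : in3 z ∈ S.hatN r :=
  Submodule.mem_sup_left <| Submodule.mem_sup_left <| Submodule.mem_sup_left <|
    Submodule.mem_sup_right <| mem_chi (by omega) ⟨z, bidegFD_cast hz (by omega) (by omega), rfl⟩

theorem in3_ell_mem_hatN {β : E'} (hβ : β ∈ Λ s) (h : 1 ≤ s) (h' : s ≤ n - 1)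
    (hr : r = s + 2) : in3 (S.ell β) ∈ S.hatN r :=
  Submodule.mem_sup_left <| Submodule.mem_sup_left <| Submodule.mem_sup_right <|
    mem_chi (by omega) ⟨_, ⟨β, extPow_cast hβ (by omega), rfl⟩, rfl⟩

theorem in4_left_mem_hatN {z : E' ⊗[R] E'} (hz : z ∈ bidegDD (n : ℤ) s) (h : 0 ≤ s) (h' : s ≤ n)
    (hr : r = n + 1 + s) : in4 z ∈ S.hatN r :=
  Submodule.mem_sup_left <| Submodule.mem_sup_right <|
    mem_chi (by omega) ⟨z, bidegDD_cast hz rfl (by omega), rfl⟩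

theorem in4_right_mem_hatN {z : E' ⊗[R] E'} (hz : z ∈ bidegDD s (n : ℤ)) (h : 0 ≤ s)
    (h' : s ≤ n - 1) (hr : r = n + 1 + s) : in4 z ∈ S.hatN r :=
  Submodule.mem_sup_right <|
    mem_chi (by omega) ⟨z, bidegDD_cast hz (by omega) (by omega), rfl⟩

include b in
theorem hatN_le {P : Submodule R (Total R F)}
    (h1 : ∀ s : ℤ, 1 ≤ s → s ≤ n → r = n - 1 + s → ∀ β ∈ Λ s, in1 (D.eps ⊗ₜ β) ∈ P)
    (h1' : ∀ s : ℤ, 1 ≤ s → s ≤ n - 1 → r = n - 1 + s → ∀ β ∈ Λ s, in1 (β ⊗ₜ D.eps) ∈ P)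
    (h2 : 0 ≤ r → r ≤ n → ∀ β ∈ Λ r, in2 (1 ⊗ₜ β) ∈ P)
    (h2' : ∀ s : ℤ, 0 ≤ s → s ≤ n - 1 → r = s + 2 → ∀ β ∈ Λ s, in2 (S.ell β) ∈ P)
    (h3 : 1 ≤ r → r ≤ n → ∀ β ∈ Λ r, in3 (1 ⊗ₜ β) ∈ P)
    (h3' : ∀ s : ℤ, 1 ≤ s → s ≤ n - 1 → r = s + 2 → ∀ β ∈ Λ s, in3 (S.ell β) ∈ P)
    (h4 : ∀ s : ℤ, 0 ≤ s → s ≤ n → r = n + 1 + s → ∀ β ∈ Λ s, in4 (D.eps ⊗ₜ β) ∈ P)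
    (h4' : ∀ s : ℤ, 0 ≤ s → s ≤ n - 1 → r = n + 1 + s → ∀ β ∈ Λ s, in4 (β ⊗ₜ D.eps) ∈ P) :
    S.hatN r ≤ P := by
  refine sup_le (sup_le (sup_le (sup_le (sup_le (sup_le (sup_le ?_ ?_) ?_) ?_) ?_) ?_) ?_) ?_ <;>
    refine chi_le fun hr => ?_
  · rintro _ ⟨z, hz, rfl⟩
    obtain ⟨β, hβ, rfl⟩ := D.exists_eps_tmul b hz
    exact h1 _ (by omega) (by omega) (by omega) β hβ
  · rintro _ ⟨z, hz, rfl⟩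
    obtain ⟨β, hβ, rfl⟩ := D.exists_tmul_eps b (bidegDD_cast hz rfl (by omega))
    exact h1' _ (by omega) (by omega) (by omega) β hβ
  · rintro _ ⟨z, hz, rfl⟩
    obtain ⟨β, hβ, rfl⟩ := exists_one_tmul hz
    exact h2 (by omega) (by omega) β (extPow_cast hβ (by omega))
  · rintro _ ⟨_, ⟨β, hβ, rfl⟩, rfl⟩
    exact h2' _ (by omega) (by omega) (by omega) β hβ
  · rintro _ ⟨z, hz, rfl⟩
    obtain ⟨β, hβ, rfl⟩ := exists_one_tmul hz
    exact h3 (by omega) (by omega) β (extPow_cast hβ (by omega))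
  · rintro _ ⟨_, ⟨β, hβ, rfl⟩, rfl⟩
    exact h3' _ (by omega) (by omega) (by omega) β hβ
  · rintro _ ⟨z, hz, rfl⟩
    obtain ⟨β, hβ, rfl⟩ := D.exists_eps_tmul b hz
    exact h4 _ (by omega) (by omega) (by omega) β hβ
  · rintro _ ⟨z, hz, rfl⟩
    obtain ⟨β, hβ, rfl⟩ := D.exists_tmul_eps b (bidegDD_cast hz rfl (by omega))
    exact h4' _ (by omega) (by omega) (by omega) β hβ

end HatN

section MM

variable {r t c : ℤ}

theorem in1_mem_MM {z : E' ⊗[R] E'} (hz : z ∈ bidegDD t c) (hr : t + c = r + 1) (ht : t ≠ 0)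
    (ht' : t ≠ n) (hc : c ≠ 0) (hc' : c ≠ n) : in1 z ∈ S.MM r :=
  Submodule.mem_sup_left <| Submodule.mem_sup_left <| Submodule.mem_sup_left <|
    Submodule.mem_sup_left <| Submodule.mem_sup_left <| Submodule.mem_sup_left <|
    Submodule.mem_sup_left <| Submodule.mem_sup_left <|
    Submodule.mem_iSup_of_mem t <| Submodule.mem_iSup_of_mem ⟨ht, ht', by omega, by omega⟩
      ⟨z, bidegDD_cast hz rfl (by omega), rfl⟩

theorem in2_coP_mem_MM {z : E ⊗[R] E'} (hz : z ∈ S.coP r) : in2 z ∈ S.MM r :=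
  Submodule.mem_sup_left <| Submodule.mem_sup_left <| Submodule.mem_sup_left <|
    Submodule.mem_sup_left <| Submodule.mem_sup_left <| Submodule.mem_sup_left <|
    Submodule.mem_sup_left <| Submodule.mem_sup_right ⟨z, hz, rfl⟩

theorem in2_mid_mem_MM {z : E ⊗[R] E'} (hz : z ∈ bidegFD t c) (hr : t + c = r) (ht : 2 ≤ t)
    (ht' : t ≤ n - 2) : in2 z ∈ S.MM r :=
  Submodule.mem_sup_left <| Submodule.mem_sup_left <| Submodule.mem_sup_left <|
    Submodule.mem_sup_left <| Submodule.mem_sup_left <| Submodule.mem_sup_left <|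
    Submodule.mem_sup_right <|
    Submodule.mem_iSup_of_mem t <| Submodule.mem_iSup_of_mem ⟨ht, ht'⟩
      ⟨z, bidegFD_cast hz rfl (by omega), rfl⟩

theorem in2_oneP_mem_MM {z : E ⊗[R] E'} (hz : z ∈ S.oneP r) : in2 z ∈ S.MM r :=
  Submodule.mem_sup_left <| Submodule.mem_sup_left <| Submodule.mem_sup_left <|
    Submodule.mem_sup_left <| Submodule.mem_sup_left <| Submodule.mem_sup_right ⟨z, hz, rfl⟩

theorem in3_coP_mem_MM {z : E ⊗[R] E'} (hz : z ∈ S.coP r) : in3 z ∈ S.MM r :=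
  Submodule.mem_sup_left <| Submodule.mem_sup_left <| Submodule.mem_sup_left <|
    Submodule.mem_sup_left <| Submodule.mem_sup_right ⟨z, hz, rfl⟩

theorem in3_mid_mem_MM {z : E ⊗[R] E'} (hz : z ∈ bidegFD t c) (hr : t + c = r) (ht : 2 ≤ t)
    (ht' : t ≤ n - 2) : in3 z ∈ S.MM r :=
  Submodule.mem_sup_left <| Submodule.mem_sup_left <| Submodule.mem_sup_left <|
    Submodule.mem_sup_right <|
    Submodule.mem_iSup_of_mem t <| Submodule.mem_iSup_of_mem ⟨ht, ht'⟩
      ⟨z, bidegFD_cast hz rfl (by omega), rfl⟩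

theorem in3_oneP_mem_MM {z : E ⊗[R] E'} (hz : z ∈ S.oneP r) : in3 z ∈ S.MM r :=
  Submodule.mem_sup_left <| Submodule.mem_sup_left <| Submodule.mem_sup_right ⟨z, hz, rfl⟩

theorem in4_mem_MM {z : E' ⊗[R] E'} (hz : z ∈ bidegDD t c) (hr : t + c = r - 1) (ht : t ≠ 0)
    (ht' : t ≠ n) (hc : c ≠ 0) (hc' : c ≠ n) : in4 z ∈ S.MM r :=
  Submodule.mem_sup_left <| Submodule.mem_sup_right <|
    Submodule.mem_iSup_of_mem t <| Submodule.mem_iSup_of_mem ⟨ht, ht', by omega, by omega⟩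
      ⟨z, bidegDD_cast hz rfl (by omega), rfl⟩

theorem in3_zero_mem_MM {z : E ⊗[R] E'} (hz : z ∈ bidegFD 0 0) : in3 z ∈ S.MM 0 :=
  Submodule.mem_sup_right <| by rw [if_pos rfl]; exact ⟨z, hz, rfl⟩

theorem in3_ell_mem_MM {β : E'} (hβ : β ∈ Λ 0) : in3 (S.ell β) ∈ S.MM 2 :=
  Submodule.mem_sup_right <| by
    rw [if_neg (by omega), if_pos rfl]; exact ⟨_, ⟨β, hβ, rfl⟩, rfl⟩

theorem in3_sigma_mem_MM (hn : 3 ≤ n) {β : E'} (hβ : β ∈ Λ n) :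
    in3 (D.sigma β) ∈ S.MM (2 * n - 2) :=
  Submodule.mem_sup_right <| by
    rw [if_neg (by omega), if_neg (by omega), if_pos rfl]
    exact ⟨_, ⟨β, extPow_cast hβ (by omega), rfl⟩, rfl⟩

theorem in3_top_mem_MM (hn : 3 ≤ n) {z : E ⊗[R] E'} (hz : z ∈ bidegFD (n : ℤ) n) :
    in3 z ∈ S.MM (2 * n) :=
  Submodule.mem_sup_right <| by
    rw [if_neg (by omega), if_neg (by omega), if_neg (by omega), if_pos rfl]
    exact ⟨z, bidegFD_cast hz rfl (by omega), rfl⟩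

theorem MM_le {P : Submodule R (Total R F)}
    (h1 : ∀ t c : ℤ, t + c = r + 1 → t ≠ 0 → t ≠ n → c ≠ 0 → c ≠ n → ∀ z ∈ bidegDD t c, in1 z ∈ P)
    (h2 : ∀ z ∈ S.coP r, in2 z ∈ P)
    (h2' : ∀ t c : ℤ, t + c = r → 2 ≤ t → t ≤ n - 2 → ∀ z ∈ bidegFD t c, in2 z ∈ P)
    (h2'' : ∀ z ∈ S.oneP r, in2 z ∈ P)
    (h3 : ∀ z ∈ S.coP r, in3 z ∈ P)
    (h3' : ∀ t c : ℤ, t + c = r → 2 ≤ t → t ≤ n - 2 → ∀ z ∈ bidegFD t c, in3 z ∈ P)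
    (h3'' : ∀ z ∈ S.oneP r, in3 z ∈ P)
    (h4 : ∀ t c : ℤ, t + c = r - 1 → t ≠ 0 → t ≠ n → c ≠ 0 → c ≠ n → ∀ z ∈ bidegDD t c, in4 z ∈ P)
    (k0 : r = 0 → ∀ z ∈ bidegFD 0 0, in3 z ∈ P)
    (k2 : r = 2 → ∀ β ∈ Λ 0, in3 (S.ell β) ∈ P)
    (k3 : r = 2 * n - 2 → ∀ β ∈ Λ n, in3 (D.sigma β) ∈ P)
    (k4 : r = 2 * n → ∀ z ∈ bidegFD (n : ℤ) n, in3 z ∈ P) : S.MM r ≤ P := by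
  refine sup_le (sup_le (sup_le (sup_le (sup_le (sup_le (sup_le (sup_le ?_ ?_) ?_) ?_) ?_) ?_)
    ?_) ?_) ?_
  · refine iSup₂_le fun t ht => ?_
    rintro _ ⟨z, hz, rfl⟩
    obtain ⟨a1, a2, a3, a4⟩ := ht
    exact h1 t _ (by omega) a1 a2 (by omega) (by omega) z hz
  · rintro _ ⟨z, hz, rfl⟩; exact h2 z hz
  · refine iSup₂_le fun t ht => ?_
    rintro _ ⟨z, hz, rfl⟩
    exact h2' t _ (by omega) ht.1 ht.2 z hz
  · rintro _ ⟨z, hz, rfl⟩; exact h2'' z hz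
  · rintro _ ⟨z, hz, rfl⟩; exact h3 z hz
  · refine iSup₂_le fun t ht => ?_
    rintro _ ⟨z, hz, rfl⟩
    exact h3' t _ (by omega) ht.1 ht.2 z hz
  · rintro _ ⟨z, hz, rfl⟩; exact h3'' z hz
  · refine iSup₂_le fun t ht => ?_
    rintro _ ⟨z, hz, rfl⟩
    obtain ⟨a1, a2, a3, a4⟩ := ht
    exact h4 t _ (by omega) a1 a2 (by omega) (by omega) z hz
  · split_ifs with e0 e2 e3 e4
    · rintro _ ⟨z, hz, rfl⟩; exact k0 e0 z hz
    · rintro _ ⟨_, ⟨β, hβ, rfl⟩, rfl⟩; exact k2 e2 β hβ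
    · rintro _ ⟨_, ⟨β, hβ, rfl⟩, rfl⟩; exact k3 e3 β (extPow_cast hβ (by omega))
    · rintro _ ⟨z, hz, rfl⟩; exact k4 e4 z (bidegFD_cast hz rfl (by omega))
    · exact bot_le

end MM

section Decomposition

variable {r t c : ℤ}

include b in
-- `σ λ` is idempotent on this bidegree because `λ σ = 1`. The exceptional index `-1` is harmless:
-- the module is zero there.
theorem sub_sigma_lam_mem {z : E ⊗[R] E'} (hz : z ∈ bidegFD (n - 1) c) (hr : n - 1 + c = r) :
    z - D.sigma (S.lam z) ∈ S.coP r := by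
  have h1 := S.lam_mem c z hz
  refine ⟨bidegFD_cast (sub_mem hz (bidegFD_cast (D.sigma_mem b h1) rfl (by omega))) rfl
    (by omega), ?_⟩
  change S.lam _ = 0
  by_cases hc : c = -1
  · rw [bidegFD_eq_bot b (by omega), Submodule.mem_bot] at hz
    simp [hz]
  · rw [map_sub, S.lam_sigma c hc _ h1, sub_self]

include b in
-- `ℓ μ` is idempotent because `μ ℓ = 1`; the exceptional index `n` would need forms of degree `n +
-- 1`.
theorem sub_ell_mu_mem {z : E ⊗[R] E'} (hz : z ∈ bidegFD 1 c) (hr : 1 + c = r) :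
    z - S.ell (mu z) ∈ S.oneP r := by
  have h1 := mu_mem hz
  refine ⟨bidegFD_cast (sub_mem hz (bidegFD_cast (S.ell_mem _ _ h1) rfl (by omega))) rfl
    (by omega), ?_⟩
  change mu _ = 0
  by_cases hc : c - 1 = n
  · rw [bidegFD_eq_bot b (by omega), Submodule.mem_bot] at hz
    simp [hz]
  · rw [map_sub, S.mu_ell _ hc _ h1, sub_self]

include b in
theorem in1_mem_sup {z : E' ⊗[R] E'} (hz : z ∈ bidegDD t c) (hr : t + c = r + 1) (ht : t ≠ 0)
    (hc : c ≠ 0) : in1 z ∈ S.MM r ⊔ S.hatN r := by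
  by_cases h : t < 0 ∨ n < t ∨ c < 0 ∨ n < c
  · rw [bidegDD_eq_bot b h, Submodule.mem_bot] at hz
    rw [hz, map_zero]; exact zero_mem _
  by_cases h1 : t = n
  · subst h1
    exact Submodule.mem_sup_right (S.in1_left_mem_hatN hz (by omega) (by omega) (by omega))
  by_cases h2 : c = n
  · subst h2
    exact Submodule.mem_sup_right (S.in1_right_mem_hatN hz (by omega) (by omega) (by omega))
  exact Submodule.mem_sup_left (S.in1_mem_MM hz hr ht h1 hc h2)

include b in
theorem in4_mem_sup {z : E' ⊗[R] E'} (hz : z ∈ bidegDD t c) (hr : t + c = r - 1)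
    (ht : t ≠ 0 ∨ c = n) (hc : c ≠ 0 ∨ t = n) : in4 z ∈ S.MM r ⊔ S.hatN r := by
  by_cases h : t < 0 ∨ n < t ∨ c < 0 ∨ n < c
  · rw [bidegDD_eq_bot b h, Submodule.mem_bot] at hz
    rw [hz, map_zero]; exact zero_mem _
  by_cases h1 : t = n
  · subst h1
    exact Submodule.mem_sup_right (S.in4_left_mem_hatN hz (by omega) (by omega) (by omega))
  by_cases h2 : c = n
  · subst h2
    exact Submodule.mem_sup_right (S.in4_right_mem_hatN hz (by omega) (by omega) (by omega))
  exact Submodule.mem_sup_left (S.in4_mem_MM hz hr (by omega) h1 (by omega) h2)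

include b in
theorem lam_eq_zero_of_top {z : E ⊗[R] E'} (hz : z ∈ bidegFD (n - 1) (n : ℤ)) : S.lam z = 0 :=
  eq_zero_of_mem_gt b.dualBasis (by omega) (S.lam_mem n z hz)

include b in
theorem in2_mem_sup {z : E ⊗[R] E'} (hz : z ∈ bidegFD t c) (hr : t + c = r)
    (ht : t = n - 1 → c = n) (ht' : t ≠ n) : in2 z ∈ S.MM r ⊔ S.hatN r := by
  by_cases h : t < 0 ∨ n < t ∨ c < 0 ∨ n < c
  · rw [bidegFD_eq_bot b h, Submodule.mem_bot] at hz
    rw [hz, map_zero]; exact zero_mem _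
  by_cases h0 : t = 0
  · subst h0
    exact Submodule.mem_sup_right (S.in2_zero_mem_hatN hz (by omega) (by omega) (by omega))
  by_cases h2 : t = n - 1
  · obtain rfl := ht h2
    subst h2
    refine Submodule.mem_sup_left (S.in2_coP_mem_MM ⟨bidegFD_cast hz rfl (by omega), ?_⟩)
    exact S.lam_eq_zero_of_top b hz
  by_cases h1 : t = 1
  · subst h1
    rw [← sub_add_cancel z (S.ell (mu z)), map_add]
    refine add_mem (Submodule.mem_sup_left (S.in2_oneP_mem_MM (S.sub_ell_mu_mem b hz hr)))
      (Submodule.mem_sup_right ?_)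
    rcases eq_zero_or_mem_Icc b (mu_mem hz) with h0 | h0
    · rw [h0, map_zero, map_zero]; exact zero_mem _
    exact S.in2_ell_mem_hatN (mu_mem hz) (by omega) (by omega) (by omega)
  exact Submodule.mem_sup_left (S.in2_mid_mem_MM hz hr (by omega) (by omega))

include b in
-- In contrast to the second summand, the third one keeps the four exceptional pieces of `𝕄`: hence
-- the weaker condition for `t = n - 1` and the admission of bidegree `(n, n)`.
theorem in3_mem_sup (hn : 3 ≤ n) {z : E ⊗[R] E'} (hz : z ∈ bidegFD t c) (hr : t + c = r)
    (ht : t = n - 1 → n - 1 ≤ c) (ht' : t = n → c = n) : in3 z ∈ S.MM r ⊔ S.hatN r := by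
  by_cases h : t < 0 ∨ n < t ∨ c < 0 ∨ n < c
  · rw [bidegFD_eq_bot b h, Submodule.mem_bot] at hz
    rw [hz, map_zero]; exact zero_mem _
  by_cases h0 : t = 0
  · subst h0
    by_cases hc : c = 0
    · obtain rfl : r = 0 := by omega
      subst hc
      exact Submodule.mem_sup_left (S.in3_zero_mem_MM hz)
    · exact Submodule.mem_sup_right (S.in3_zero_mem_hatN hz (by omega) (by omega) (by omega))
  by_cases h3 : t = n
  · obtain rfl := ht' h3
    subst h3
    obtain rfl : r = 2 * n := by omega
    exact Submodule.mem_sup_left (S.in3_top_mem_MM hn hz)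
  by_cases h2 : t = n - 1
  · subst h2
    have hc := ht rfl
    by_cases hc' : c = n
    · subst hc'
      refine Submodule.mem_sup_left (S.in3_coP_mem_MM ⟨bidegFD_cast hz rfl (by omega), ?_⟩)
      exact S.lam_eq_zero_of_top b hz
    · obtain rfl : r = 2 * n - 2 := by omega
      rw [← sub_add_cancel z (D.sigma (S.lam z)), map_add]
      exact Submodule.mem_sup_left (add_mem (S.in3_coP_mem_MM (S.sub_sigma_lam_mem b hz hr))
        (S.in3_sigma_mem_MM hn (extPow_cast (S.lam_mem c z hz) (by omega))))
  by_cases h1 : t = 1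
  · subst h1
    rw [← sub_add_cancel z (S.ell (mu z)), map_add]
    refine add_mem (Submodule.mem_sup_left (S.in3_oneP_mem_MM (S.sub_ell_mu_mem b hz hr))) ?_
    rcases eq_zero_or_mem_Icc b (mu_mem hz) with h0 | h0
    · rw [h0, map_zero, map_zero]; exact zero_mem _
    by_cases hc : c = 1
    · obtain rfl : r = 2 := by omega
      exact Submodule.mem_sup_left (S.in3_ell_mem_MM (extPow_cast (mu_mem hz) (by omega)))
    · exact Submodule.mem_sup_right
        (S.in3_ell_mem_hatN (mu_mem hz) (by omega) (by omega) (by omega))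
  exact Submodule.mem_sup_left (S.in3_mid_mem_MM hz hr (by omega) (by omega))

include b in
/-- The module `𝔽_r` is generated by `𝕄_r`, `N̂_r` and the generators of `𝕃_r`. -/
theorem FF_le (hn : 3 ≤ n) {P : Submodule R (Total R F)} (hMN : S.MM r ⊔ S.hatN r ≤ P)
    (h1 : -1 ≤ r → r ≤ n - 1 → ∀ β ∈ Λ (r + 1), in1 (1 ⊗ₜ β) ∈ P)
    (h1' : 0 ≤ r → r ≤ n - 1 → ∀ β ∈ Λ (r + 1), in1 (β ⊗ₜ 1) ∈ P)
    (h2 : ∀ s : ℤ, 1 ≤ s → s ≤ n → r = n - 2 + s → ∀ β ∈ Λ s, in2 (D.sigma β) ∈ P)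
    (h2' : ∀ s : ℤ, 0 ≤ s → s ≤ n → r = n + s → ∀ β ∈ Λ s, in2 (D.eta ⊗ₜ β) ∈ P)
    (h3 : ∀ s : ℤ, 1 ≤ s → s ≤ n - 1 → r = n - 2 + s → ∀ β ∈ Λ s, in3 (D.sigma β) ∈ P)
    (h3' : ∀ s : ℤ, 0 ≤ s → s ≤ n - 1 → r = n + s → ∀ β ∈ Λ s, in3 (D.eta ⊗ₜ β) ∈ P)
    (h4 : 1 ≤ r → r ≤ n → ∀ β ∈ Λ (r - 1), in4 (1 ⊗ₜ β) ∈ P)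
    (h4' : 2 ≤ r → r ≤ n → ∀ β ∈ Λ (r - 1), in4 (β ⊗ₜ 1) ∈ P) : FF R F r ≤ P := by
  refine FF_le_of_bideg ?_ ?_ ?_ ?_ <;> intro t c htc z hz
  · by_cases h : t < 0 ∨ n < t ∨ c < 0 ∨ n < c
    · rw [bidegDD_eq_bot b h, Submodule.mem_bot] at hz
      rw [hz, map_zero]; exact zero_mem _
    by_cases h0 : t = 0
    · subst h0
      obtain ⟨β, hβ, rfl⟩ := exists_one_tmul hz
      exact h1 (by omega) (by omega) β (extPow_cast hβ (by omega))
    by_cases hc : c = 0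
    · subst hc
      obtain ⟨β, hβ, rfl⟩ := exists_tmul_one hz
      exact h1' (by omega) (by omega) β (extPow_cast hβ (by omega))
    exact hMN (S.in1_mem_sup b hz htc h0 hc)
  · by_cases h : t < 0 ∨ n < t ∨ c < 0 ∨ n < c
    · rw [bidegFD_eq_bot b h, Submodule.mem_bot] at hz
      rw [hz, map_zero]; exact zero_mem _
    by_cases h0 : t = n
    · subst h0
      obtain ⟨β, hβ, rfl⟩ := D.exists_eta_tmul b hz
      exact h2' c (by omega) (by omega) (by omega) β hβ
    by_cases ht : t = n - 1 ∧ c ≠ n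
    · obtain ⟨rfl, hc⟩ := ht
      rw [← sub_add_cancel z (D.sigma (S.lam z)), map_add]
      exact add_mem (hMN (Submodule.mem_sup_left
        (S.in2_coP_mem_MM (S.sub_sigma_lam_mem b hz htc))))
        (h2 (c + 1) (by omega) (by omega) (by omega) _ (S.lam_mem c z hz))
    exact hMN (S.in2_mem_sup b hz htc (by omega) h0)
  · by_cases h : t < 0 ∨ n < t ∨ c < 0 ∨ n < c
    · rw [bidegFD_eq_bot b h, Submodule.mem_bot] at hz
      rw [hz, map_zero]; exact zero_mem _
    by_cases h0 : t = n ∧ c ≠ n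
    · obtain ⟨rfl, hc⟩ := h0
      obtain ⟨β, hβ, rfl⟩ := D.exists_eta_tmul b hz
      exact h3' c (by omega) (by omega) (by omega) β hβ
    by_cases ht : t = n - 1 ∧ c < n - 1
    · obtain ⟨rfl, hc⟩ := ht
      rw [← sub_add_cancel z (D.sigma (S.lam z)), map_add]
      exact add_mem (hMN (Submodule.mem_sup_left
        (S.in3_coP_mem_MM (S.sub_sigma_lam_mem b hz htc))))
        (h3 (c + 1) (by omega) (by omega) (by omega) _ (S.lam_mem c z hz))
    exact hMN (S.in3_mem_sup b hn hz htc (by omega) (by omega))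
  · by_cases h : t < 0 ∨ n < t ∨ c < 0 ∨ n < c
    · rw [bidegDD_eq_bot b h, Submodule.mem_bot] at hz
      rw [hz, map_zero]; exact zero_mem _
    by_cases h0 : t = 0 ∧ c ≠ n
    · obtain ⟨rfl, h0⟩ := h0
      obtain ⟨β, hβ, rfl⟩ := exists_one_tmul hz
      exact h4 (by omega) (by omega) β (extPow_cast hβ (by omega))
    by_cases hc : c = 0 ∧ t ≠ n
    · obtain ⟨rfl, hc⟩ := hc
      obtain ⟨β, hβ, rfl⟩ := exists_tmul_one hz
      exact h4' (by omega) (by omega) β (extPow_cast hβ (by omega))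
    exact hMN (S.in4_mem_sup b hz htc (by omega) (by omega))

end Decomposition

end BasicData.Splittings
end Summands

/-! ### The three identities for `τ`. -/

section Contraction

variable {R : Type uR} [CommRing R] {F : Type uF} [AddCommGroup F] [Module R F] {n : ℕ}

local notation "E" => ExteriorAlgebra R F
local notation "E'" => ExteriorAlgebra R (Module.Dual R F)
local notation "ι" => ExteriorAlgebra.ι R
local notation "sp" => scalarPart R (Module.Dual R F)
local notation "Λ" => extPow R (Module.Dual R F)

theorem BasicData.coact_eps_mem (D : BasicData R F n) (w : F) :
    coact (ι w) D.eps ∈ Λ (n - 1) := coact_ι_mem w D.eps_mem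

namespace BasicData.Splittings

variable {D : BasicData R F n} (S : D.Splittings) (b : Module.Basis (Fin n) R F)

section TauValues

variable {r t c : ℤ}

theorem scalarPart_smul_of_zero {β : E'} (hβ : β ∈ Λ c) (hc : c = 0) : sp β • (1 : E') = β := by
  subst hc; exact (eq_smul_one_of_mem hβ).symm

include b in
theorem tau_one_in1 {β : E'} (hβ : β ∈ Λ (r + 1)) :
    S.tau r (in1 (1 ⊗ₜ β)) = (r + 1).negOnePow • in2 (1 ⊗ₜ β) := by
  rw [tau_in1, S.tau1_tmul b (zero_add _) one_mem_extPow hβ]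
  split_ifs with h
  · simp
  · simp [scalarPart_of_mem_ne (show r + 1 ≠ 0 by omega) hβ]

include b in
theorem tau_in1_one {β : E'} (hr : r ≠ -1) (hβ : β ∈ Λ (r + 1)) :
    S.tau r (in1 (β ⊗ₜ 1)) = r.negOnePow • in3 (1 ⊗ₜ β) := by
  rw [tau_in1, S.tau1_tmul b (add_zero _) hβ one_mem_extPow, if_neg hr]
  simp [scalarPart_of_mem_ne (show r + 1 ≠ 0 by omega) hβ]

include b in
theorem tau_one_in4 {β : E'} (hβ : β ∈ Λ (r - 1)) : S.tau r (in4 (1 ⊗ₜ β)) = in2 (S.ell β) := by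
  rw [tau_in4, S.tau4_tmul b (zero_add _) one_mem_extPow hβ]
  split_ifs with h
  · simp
  · simp [scalarPart_of_mem_ne (show r - 1 ≠ 0 by omega) hβ]

include b in
theorem tau_in4_one {β : E'} (hr : r ≠ 1) (hβ : β ∈ Λ (r - 1)) :
    S.tau r (in4 (β ⊗ₜ 1)) = -in3 (S.ell β) := by
  rw [tau_in4, S.tau4_tmul b (add_zero _) hβ one_mem_extPow, if_neg hr]
  simp [scalarPart_of_mem_ne (show r - 1 ≠ 0 by omega) hβ]

include b in
theorem tau_in1_left {α β : E'} (hα : α ∈ Λ t) (hβ : β ∈ Λ c) (hr : t + c = r + 1) (ht : 0 < t) :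
    S.tau r (in1 (α ⊗ₜ β)) = r.negOnePow • sp β • in3 (1 ⊗ₜ α) := by
  rw [tau_in1, S.tau1_tmul b hr hα hβ, scalarPart_of_mem_ne ht.ne' hα]
  split_ifs with h
  · simp [scalarPart_of_mem_ne (show c ≠ 0 by omega) hβ]
  · simp

include b in
theorem tau_in1_right {α β : E'} (hα : α ∈ Λ t) (hβ : β ∈ Λ c) (hr : t + c = r + 1) (hc : 0 < c) :
    S.tau r (in1 (α ⊗ₜ β)) = (r + 1).negOnePow • sp α • in2 (1 ⊗ₜ β) := by
  rw [tau_in1, S.tau1_tmul b hr hα hβ, scalarPart_of_mem_ne hc.ne' hβ]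
  simp

include b in
theorem tau_in4_left {α β : E'} (hα : α ∈ Λ t) (hβ : β ∈ Λ c) (hr : t + c = r - 1) (ht : 0 < t) :
    S.tau r (in4 (α ⊗ₜ β)) = -(sp β • in3 (S.ell α)) := by
  rw [tau_in4, S.tau4_tmul b hr hα hβ, scalarPart_of_mem_ne ht.ne' hα]
  split_ifs with h
  · simp [scalarPart_of_mem_ne (show c ≠ 0 by omega) hβ]
  · simp

include b in
theorem tau_in4_right {α β : E'} (hα : α ∈ Λ t) (hβ : β ∈ Λ c) (hr : t + c = r - 1) (hc : 0 < c) :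
    S.tau r (in4 (α ⊗ₜ β)) = sp α • in2 (S.ell β) := by
  rw [tau_in4, S.tau4_tmul b hr hα hβ, scalarPart_of_mem_ne hc.ne' hβ]
  simp

end TauValues

include b in
theorem tau_MM (hn : 3 ≤ n) (r : ℤ) (x : Total R F) (hx : x ∈ S.MM r) : S.tau r x = 0 := by
  suffices h : S.MM r ≤ LinearMap.ker (S.tau r) from h hx
  refine S.MM_le ?_ ?_ ?_ ?_ ?_ ?_ ?_ ?_ ?_ ?_ ?_ ?_ <;> simp only [LinearMap.mem_ker]
  · intro t c h ht _ hc _ z hz; rw [tau_in1, S.tau1_eq_zero b h ht hc hz]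
  · intro z hz; rw [tau_in2, S.tau2_coP hz]
  · intro t c h ht _ z hz; rw [tau_in2, S.tau2_eq_zero (by omega) (by omega) hz]
  · intro z hz; rw [tau_in2, S.tau2_eq_zero (by omega) (by omega) hz.1]
  · intro z hz; rw [tau_in3, S.tau3_coP hz]
  · intro t c h ht _ z hz; rw [tau_in3, S.tau3_eq_zero (by omega) (by omega) hz]
  · intro z hz; rw [tau_in3, S.tau3_eq_zero (by omega) (by omega) hz.1]
  · intro t c h ht _ hc _ z hz; rw [tau_in4, S.tau4_eq_zero b h (by omega) (by omega) hz]
  · intro h z hz; rw [tau_in3, S.tau3_eq_zero (by omega) (by omega) hz]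
  · intro h β hβ; rw [tau_in3, S.tau3_eq_zero (by omega) (by omega) (S.ell_mem _ _ hβ)]
  · intro h β hβ; rw [tau_in3, S.tau3_eq_zero (by omega) (by omega) (D.sigma_mem b hβ)]
  · intro h z hz; rw [tau_in3, S.tau3_eq_zero (by omega) (by omega) hz]

include b in
theorem tau_hatN (hn : 3 ≤ n) (r : ℤ) (x : Total R F) (hx : x ∈ S.hatN r) : S.tau r x = 0 := by
  suffices h : S.hatN r ≤ LinearMap.ker (S.tau r) from h hx
  refine S.hatN_le b ?_ ?_ ?_ ?_ ?_ ?_ ?_ ?_ <;> simp only [LinearMap.mem_ker]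
  · intro s _ _ _ β hβ
    rw [tau_in1, S.tau1_eq_zero b (t := n) (by omega) (by omega) (by omega)
      (tmul_mem_bideg D.eps_mem hβ)]
  · intro s _ _ _ β hβ
    rw [tau_in1, S.tau1_eq_zero b (c := n) (by omega) (by omega) (by omega)
      (tmul_mem_bideg hβ D.eps_mem)]
  · intro _ _ β hβ
    rw [tau_in2, S.tau2_eq_zero (by omega) (by omega) (tmul_mem_bideg one_mem_extPow hβ)]
  · intro s _ _ _ β hβ
    rw [tau_in2, S.tau2_eq_zero (by omega) (by omega) (S.ell_mem _ _ hβ)]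
  · intro _ _ β hβ
    rw [tau_in3, S.tau3_eq_zero (by omega) (by omega) (tmul_mem_bideg one_mem_extPow hβ)]
  · intro s _ _ _ β hβ
    rw [tau_in3, S.tau3_eq_zero (by omega) (by omega) (S.ell_mem _ _ hβ)]
  · intro s _ _ _ β hβ
    rw [tau_in4, S.tau4_eq_zero b (t := n) (by omega) (by omega) (by omega)
      (tmul_mem_bideg D.eps_mem hβ)]
  · intro s _ _ _ β hβ
    rw [tau_in4, S.tau4_eq_zero b (c := n) (by omega) (by omega) (by omega)
      (tmul_mem_bideg hβ D.eps_mem)]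

include b in
theorem tau_mem (hn : 3 ≤ n) (r : ℤ) (x : Total R F) (hx : x ∈ FF R F r) :
    S.tau r x ∈ S.hatN (r + 1) := by
  suffices h : FF R F r ≤ (S.hatN (r + 1)).comap (S.tau r) from h hx
  refine S.FF_le b hn (sup_le ?_ ?_) ?_ ?_ ?_ ?_ ?_ ?_ ?_ ?_ <;>
    try simp only [Submodule.mem_comap]
  · intro x hx
    rw [Submodule.mem_comap, S.tau_MM b hn r x hx]; exact zero_mem _
  · intro x hx
    rw [Submodule.mem_comap, S.tau_hatN b hn r x hx]; exact zero_mem _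
  · intro _ _ β hβ
    rw [S.tau_one_in1 b hβ]
    exact units_smul_mem _ _ (S.in2_zero_mem_hatN (tmul_mem_bideg one_mem_extPow hβ)
      (by omega) (by omega) rfl)
  · intro _ _ β hβ
    rw [S.tau_in1_one b (by omega) hβ]
    exact units_smul_mem _ _ (S.in3_zero_mem_hatN (tmul_mem_bideg one_mem_extPow hβ)
      (by omega) (by omega) rfl)
  · intro s _ _ hr β hβ
    rw [tau_in2, S.tau2_sigma b hr (by omega) hβ]
    refine add_mem (S.in1_left_mem_hatN (tmul_mem_bideg D.eps_mem hβ) (by omega) (by omega)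
      (by omega)) (units_smul_mem _ _ ?_)
    by_cases hs : s = 1
    · exact Submodule.smul_mem _ _ (S.in3_zero_mem_hatN (tmul_mem_bideg one_mem_extPow D.eps_mem)
        (by omega) (by omega) (by omega))
    · rw [scalarPart_of_mem_ne (show s - 1 ≠ 0 by omega) (coact_ι_mem D.v hβ), zero_smul]
      exact zero_mem _
  · intro s _ _ hr β hβ
    rw [tau_in2, S.tau2_eta b hr hβ]
    refine add_mem (units_smul_mem _ _ (S.in4_left_mem_hatN (tmul_mem_bideg D.eps_mem hβ)
      (by omega) (by omega) (by omega))) ?_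
    by_cases hs : s = 0
    · exact Submodule.smul_mem _ _ (S.in3_ell_mem_hatN (D.coact_eps_mem D.u)
        (by omega) (by omega) (by omega))
    · rw [scalarPart_of_mem_ne hs hβ, zero_smul]
      exact zero_mem _
  · intro s _ _ hr β hβ
    rw [tau_in3, S.tau3_sigma b hr (by omega) (by omega) hβ]
    refine sub_mem (S.in1_right_mem_hatN (tmul_mem_bideg hβ D.eps_mem) (by omega) (by omega)
      (by omega)) ?_
    by_cases hs : s = 1
    · exact Submodule.smul_mem _ _ (S.in2_zero_mem_hatN (tmul_mem_bideg one_mem_extPow D.eps_mem)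
        (by omega) (by omega) (by omega))
    · rw [scalarPart_of_mem_ne (show s - 1 ≠ 0 by omega) (coact_ι_mem D.u hβ), zero_smul]
      exact zero_mem _
  · intro s _ _ hr β hβ
    rw [tau_in3, S.tau3_eta b hr (by omega) hβ]
    refine add_mem (units_smul_mem _ _ (S.in4_right_mem_hatN (tmul_mem_bideg hβ D.eps_mem)
      (by omega) (by omega) (by omega))) (units_smul_mem _ _ ?_)
    by_cases hs : s = 0
    · exact Submodule.smul_mem _ _ (S.in2_ell_mem_hatN (D.coact_eps_mem D.v)
        (by omega) (by omega) (by omega))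
    · rw [scalarPart_of_mem_ne hs hβ, zero_smul]
      exact zero_mem _
  · intro _ _ β hβ
    rw [S.tau_one_in4 b hβ]
    exact S.in2_ell_mem_hatN hβ (by omega) (by omega) (by omega)
  · intro _ _ β hβ
    rw [S.tau_in4_one b (by omega) hβ]
    exact neg_mem (S.in3_ell_mem_hatN hβ (by omega) (by omega) (by omega))

theorem mu_ell_of_mem {s : ℤ} (hs : s ≠ n) {β : E'} (hβ : β ∈ Λ s) : mu (S.ell β) = β :=
  S.mu_ell s hs β hβ

set_option maxHeartbeats 2000000 in
include b in
-- For each generator of `N̂`, one component of `f` is the unit component, from which `τ` returns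
-- the generator. Any other component on which `τ` does not vanish is cancelled by a delta term or
-- killed by `ℓ_n = 0`.
theorem tau_f (hn : 3 ≤ n) (r : ℤ) (x : Total R F) (hx : x ∈ S.hatN (r + 1)) :
    S.tau r (D.f (r + 1) x) = x := by
  suffices h : S.hatN (r + 1) ≤ LinearMap.eqLocus (S.tau r ∘ₗ D.f (r + 1)) LinearMap.id from h hx
  have s1 : (r + 1).negOnePow = -r.negOnePow := Int.negOnePow_succ r
  have s2 : (r + 1 + 1).negOnePow = r.negOnePow := by rw [Int.negOnePow_succ, s1, neg_neg]
  refine S.hatN_le b ?_ ?_ ?_ ?_ ?_ ?_ ?_ ?_ <;>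
    simp only [LinearMap.mem_eqLocus, LinearMap.comp_apply, LinearMap.id_apply]
  · intro s _ _ hr β hβ
    rw [D.f_eps_in1 b]
    simp only [map_add, map_units_smul]
    rw [S.tau_in1_left b D.eps_mem (coact_ι_mem D.v hβ) (by omega) (by omega),
      tau_in1, S.tau1_eq_zero b (t := n - 1) (c := s) (by omega) (by omega) (by omega)
        (tmul_mem_bideg (D.coact_eps_mem _) hβ),
      tau_in2, S.tau2_sigma b (s := s) (by omega) (by omega) hβ,
      tau_in3, S.tau3_eq_zero (by omega) (by omega)
        (cas_mem b (D.mapAT_mem D.X (tmul_mem_bideg hβ D.eps_mem)))]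
    -- For `s = 1` the form `v(β)` is a scalar, so `τ` is also nonzero on `ε ⊗ v(β)`; the delta term
    -- cancels that value, because here `n = r + 1`.
    by_cases hs : s = 1
    · have : (n : ℤ).negOnePow = -r.negOnePow := by rw [← s1]; congr 1; omega
      rw [this, Units.neg_smul]; simp
    · rw [scalarPart_of_mem_ne (show s - 1 ≠ 0 by omega) (coact_ι_mem D.v hβ)]; simp
  · intro s _ _ hr β hβ
    rw [D.f_in1_eps b]
    simp only [map_add, map_units_smul]
    rw [S.tau_in1_right b (coact_ι_mem D.u hβ) D.eps_mem (by omega) (by omega),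
      tau_in1, S.tau1_eq_zero b (t := s) (c := n - 1) (by omega) (by omega) (by omega)
        (tmul_mem_bideg hβ (D.coact_eps_mem _)),
      tau_in3, S.tau3_sigma b (s := s) (by omega) (by omega) (by omega) hβ,
      tau_in2, S.tau2_eq_zero (by omega) (by omega)
        (cas_mem b (D.mapAT_mem D.Xs (tmul_mem_bideg hβ D.eps_mem))),
      smul_smul, Int.units_mul_self]
    simp
  · intro _ _ β hβ
    rw [D.f_one_in2 b]
    simp only [map_add, map_units_smul]
    rw [S.tau_one_in1 b hβ, tau_in2, S.tau2_eq_zero (by omega) (by omega)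
      (tmul_mem_bideg one_mem_extPow (coact_ι_mem D.v hβ)), smul_smul, Int.units_mul_self]
    simp
  · intro s _ _ hr β hβ
    have hz := S.ell_mem s β hβ
    rw [D.f_in2_of_mem_one b _ hz, S.mu_ell_of_mem (by omega) hβ]
    simp only [map_add, map_units_smul]
    rw [S.tau_one_in4 b (extPow_cast hβ (by omega)),
      tau_in1, S.tau1_eq_zero b (t := 1) (c := s + 1) (by omega) (by omega) (by omega)
        (mapX_mem D.X hz),
      tau_in2, tau_in2, S.tau2_eq_zero (by omega) (by omega) (conR_memFD D.v hz),
      S.tau2_eq_zero (by omega) (by omega) (conF_mem (D.Xs D.u) hz)]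
    simp
  · intro _ _ β hβ
    rw [D.f_one_in3 b]
    simp only [map_add, map_units_smul]
    rw [S.tau_in1_one b (by omega) hβ, tau_in3, S.tau3_eq_zero (by omega) (by omega)
      (tmul_mem_bideg one_mem_extPow (coact_ι_mem D.u hβ)), s2, smul_smul, Int.units_mul_self]
    simp
  · intro s _ _ hr β hβ
    have hz := S.ell_mem s β hβ
    rw [D.f_in3_of_mem_one b _ hz, S.mu_ell_of_mem (by omega) hβ]
    simp only [map_add, map_sub, map_units_smul]
    rw [S.tau_in4_one b (by omega) (extPow_cast hβ (by omega)),
      tau_in1, S.tau1_eq_zero b (t := s + 1) (c := 1) (by omega) (by omega) (by omega)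
        (swap_mem (mapX_mem D.Xs hz)),
      tau_in3, tau_in3, S.tau3_eq_zero (by omega) (by omega) (conR_memFD D.u hz),
      S.tau3_eq_zero (by omega) (by omega) (conF_mem (D.X D.v) hz)]
    simp
  · intro s _ _ hr β hβ
    rw [D.f_eps_in4 b]
    simp only [map_add, map_units_smul]
    -- The term `ε ⊗ v(β)` contributes nothing since `ℓ(ε) = 0`. The term `u(ε) ⊗ β` contributes a
    -- multiple of `ℓ(u(ε))` when `β` is a scalar, which the delta term removes.
    rw [S.tau_in4_left b D.eps_mem (coact_ι_mem D.v hβ) (by omega) (by omega),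
      S.tau_in4_left b (D.coact_eps_mem D.u) hβ (by omega) (by omega),
      tau_in2, S.tau2_eta b (s := s) (by omega) hβ,
      tau_in3, S.tau3_eq_zero (by omega) (by omega)
        (D.mapAT_mem D.X (tmul_mem_bideg hβ D.eps_mem)), S.ell_top _ D.eps_mem,
      smul_add, smul_smul, Int.units_mul_self]
    simp
  · intro s _ _ hr β hβ
    rw [D.f_in4_eps b]
    simp only [map_add, map_units_smul]
    rw [S.tau_in4_right b (coact_ι_mem D.u hβ) D.eps_mem (by omega) (by omega),
      S.tau_in4_right b hβ (D.coact_eps_mem D.v) (by omega) (by omega),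
      tau_in3, S.tau3_eta b (s := s) (by omega) (by omega) hβ,
      tau_in2, S.tau2_eq_zero (by omega) (by omega)
        (D.mapAT_mem D.Xs (tmul_mem_bideg hβ D.eps_mem)), S.ell_top _ D.eps_mem,
      smul_add, smul_smul, Int.units_mul_self]
    -- For a scalar `β` the terms with `ℓ(v(ε))` cancel, by comparison of signs for `r = n`-parity:
    -- `n` and `r` agree here.
    by_cases hs : s = 0
    · have : (n : ℤ).negOnePow = r.negOnePow := by congr 1; omega
      rw [this, s1]
      rcases Int.units_eq_one_or r.negOnePow with h | h <;> simp [h]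
    · rw [scalarPart_of_mem_ne hs hβ]; simp

set_option maxHeartbeats 2000000 in
include b in
-- On a generator `x` of `𝕃` the element `f (τ x)` is `x` plus terms outside `𝕃`. The delta terms of
-- `τ` are chosen to remove those components of `f (τ x)` that would fall into `𝕃` again.
theorem sub_f_tau_mem (hn : 3 ≤ n) (r : ℤ) (x : Total R F) (hx : x ∈ FF R F r) :
    x - D.f (r + 1) (S.tau r x) ∈ S.MM r ⊔ S.hatN r := by
  suffices h : FF R F r ≤ (S.MM r ⊔ S.hatN r).comap (LinearMap.id - D.f (r + 1) ∘ₗ S.tau r) from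
    h hx
  have s1 : (r + 1).negOnePow = -r.negOnePow := Int.negOnePow_succ r
  have s2 : (r + 1 + 1).negOnePow = r.negOnePow := by rw [Int.negOnePow_succ, s1, neg_neg]
  refine S.FF_le b hn ?_ ?_ ?_ ?_ ?_ ?_ ?_ ?_ ?_ <;>
    try simp only [Submodule.mem_comap, LinearMap.sub_apply, LinearMap.comp_apply, LinearMap.id_apply]
  · intro x hx
    rw [Submodule.mem_comap, LinearMap.sub_apply, LinearMap.comp_apply, LinearMap.id_apply]
    have : S.tau r x = 0 := by
      obtain ⟨y, hy, z, hz, rfl⟩ := Submodule.mem_sup.1 hx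
      rw [map_add, S.tau_MM b hn r y hy, S.tau_hatN b hn r z hz, add_zero]
    simpa [this] using hx
  · intro _ _ β hβ
    rw [S.tau_one_in1 b hβ, map_units_smul, D.f_one_in2 b, smul_add, smul_smul,
      Int.units_mul_self, one_smul, sub_add_eq_sub_sub, sub_self, zero_sub]
    exact neg_mem (units_smul_mem _ _ (S.in2_mem_sup b
      (tmul_mem_bideg one_mem_extPow (coact_ι_mem D.v hβ)) (by omega) (by omega) (by omega)))
  · intro _ _ β hβ
    rw [S.tau_in1_one b (by omega) hβ, map_units_smul, D.f_one_in3 b, s2, smul_add, smul_smul,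
      Int.units_mul_self, one_smul, sub_add_eq_sub_sub, sub_self, zero_sub]
    exact neg_mem (units_smul_mem _ _ (units_smul_mem _ _ (S.in3_mem_sup b hn
      (tmul_mem_bideg one_mem_extPow (coact_ι_mem D.u hβ)) (by omega) (by omega) (by omega))))
  · intro s _ _ hr β hβ
    have m1 := S.in1_mem_sup b (r := r) (tmul_mem_bideg (D.coact_eps_mem D.u) hβ) (by omega)
      (by omega) (by omega)
    have m2 := S.in3_mem_sup b hn (r := r)
      (cas_mem b (D.mapAT_mem D.X (tmul_mem_bideg hβ D.eps_mem))) (by omega) (by omega) (by omega)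
    rw [tau_in2, S.tau2_sigma b hr (by omega) hβ, map_add, map_units_smul, map_smul,
      D.f_eps_in1 b, D.f_one_in3 b]
    have hv := coact_ι_mem D.v hβ
    -- Here `v(β)` is a scalar and `ε ⊗ v(β)` lies in `𝕃`; it cancels against the unit component of
    -- `f` on `[1 ⊗ ε]_3`.
    by_cases hs : s = 1
    · have m3 := S.in3_mem_sup b hn (r := r) (tmul_mem_bideg one_mem_extPow (D.coact_eps_mem D.u))
        (by omega) (by omega) (by omega)
      have e : in1 (D.eps ⊗ₜ coact (ι D.v) β) = sp (coact (ι D.v) β) • in1 (D.eps ⊗ₜ (1 : E')) := by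
        rw [← map_smul, ← TensorProduct.tmul_smul, scalarPart_smul_of_zero hv (by omega)]
      have e' : (n : ℤ).negOnePow = -r.negOnePow := by rw [← s1]; congr 1; omega
      rw [e, e', s2]
      have := neg_mem (add_mem (add_mem (units_smul_mem _ (r + 1).negOnePow m1) m2)
        (units_smul_mem _ (-r.negOnePow) (Submodule.smul_mem _ (sp (coact (ι D.v) β))
          (units_smul_mem _ r.negOnePow m3))))
      convert this using 1
      rcases Int.units_eq_one_or r.negOnePow with h | h <;>
      · simp only [h, smul_add, one_smul, Units.neg_smul, neg_neg, smul_neg]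
        abel
    · rw [scalarPart_of_mem_ne (show s - 1 ≠ 0 by omega) hv]
      have m4 := S.in1_mem_sup b (r := r) (tmul_mem_bideg D.eps_mem hv) (by omega)
        (by omega) (by omega)
      have := neg_mem (add_mem (add_mem (units_smul_mem _ (r + 1).negOnePow m1) m2) m4)
      convert this using 1
      simp only [zero_smul, smul_zero]
      abel
  · intro s _ _ hr β hβ
    have m1 := S.in3_mem_sup b hn (r := r) (D.mapAT_mem D.X (tmul_mem_bideg hβ D.eps_mem))
      (by omega) (by omega) (by omega)
    have m2 := S.in4_mem_sup b (r := r) (tmul_mem_bideg D.eps_mem (coact_ι_mem D.v hβ)) (by omega)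
      (by omega) (by omega)
    have hz := S.ell_mem _ _ (D.coact_eps_mem D.u)
    rw [tau_in2, S.tau2_eta b hr hβ, map_add, map_units_smul, map_smul,
      D.f_eps_in4 b, D.f_in3_of_mem_one b _ hz, S.mu_ell_of_mem (by omega) (D.coact_eps_mem D.u)]
    -- For a scalar `β` the term `u(ε) ⊗ β` lies in `𝕃` and cancels against `μ(ℓ(u(ε))) ⊗ 1 = u(ε) ⊗
    -- 1`.
    by_cases hs : s = 0
    · have m3 := S.in1_mem_sup b (r := r) (swap_mem (mapX_mem D.Xs hz)) (by omega) (by omega)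
        (by omega)
      have m4 := S.in3_mem_sup b hn (r := r) (conR_memFD D.u hz) (by omega) (by omega) (by omega)
      have m5 := S.in3_mem_sup b hn (r := r) (conF_mem (D.X D.v) hz) (by omega) (by omega) (by omega)
      have e : in4 (coact (ι D.u) D.eps ⊗ₜ β) = sp β • in4 (coact (ι D.u) D.eps ⊗ₜ (1 : E')) := by
        rw [← map_smul, ← TensorProduct.tmul_smul, scalarPart_smul_of_zero hβ hs]
      rw [e]
      have := neg_mem (add_mem (add_mem m1 (units_smul_mem _ (r + 1).negOnePow m2))
        (Submodule.smul_mem _ (sp β) (add_mem (add_mem (units_smul_mem _ (r + 1 + 1).negOnePow m3)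
          (units_smul_mem _ (r + 1 + 1).negOnePow m4)) m5)))
      convert this using 1
      rcases Int.units_eq_one_or (r + 1).negOnePow with h | h <;>
      · simp only [h, smul_add, smul_sub, one_smul, Units.neg_smul, neg_neg, smul_neg]
        abel
    · rw [scalarPart_of_mem_ne hs hβ]
      have m3 := S.in4_mem_sup b (r := r) (tmul_mem_bideg (D.coact_eps_mem D.u) hβ) (by omega)
        (by omega) (by omega)
      have := neg_mem (add_mem (add_mem m1 (units_smul_mem _ (r + 1).negOnePow m2)) m3)
      convert this using 1
      rcases Int.units_eq_one_or (r + 1).negOnePow with h | h <;>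
      · simp only [h, smul_add, one_smul, Units.neg_smul, neg_neg, smul_neg, zero_smul]
        abel
  · intro s _ _ hr β hβ
    have m1 := S.in1_mem_sup b (r := r) (tmul_mem_bideg hβ (D.coact_eps_mem D.v)) (by omega)
      (by omega) (by omega)
    have m2 := S.in2_mem_sup b (r := r)
      (cas_mem b (D.mapAT_mem D.Xs (tmul_mem_bideg hβ D.eps_mem))) (by omega) (by omega) (by omega)
    rw [tau_in3, S.tau3_sigma b hr (by omega) (by omega) hβ, map_sub, map_smul,
      D.f_in1_eps b, D.f_one_in2 b]
    have hv := coact_ι_mem D.u hβ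
    -- Here `u(β)` is a scalar, and `u(β) ⊗ ε` cancels against the unit component of `f` on `[1 ⊗
    -- ε]_2`.
    by_cases hs : s = 1
    · have m3 := S.in2_mem_sup b (r := r) (tmul_mem_bideg one_mem_extPow (D.coact_eps_mem D.v))
        (by omega) (by omega) (by omega)
      have e : in1 (coact (ι D.u) β ⊗ₜ D.eps) = sp (coact (ι D.u) β) • in1 ((1 : E') ⊗ₜ D.eps) := by
        rw [← map_smul, TensorProduct.smul_tmul', scalarPart_smul_of_zero hv (by omega)]
      rw [e]
      have := sub_mem (Submodule.smul_mem _ (sp (coact (ι D.u) β)) m3) (add_mem m1 m2)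
      convert this using 1
      rcases Int.units_eq_one_or (r + 1).negOnePow with h | h <;>
      · simp only [h, smul_add, one_smul, Units.neg_smul, smul_neg]
        abel
    · rw [scalarPart_of_mem_ne (show s - 1 ≠ 0 by omega) hv]
      have m4 := S.in1_mem_sup b (r := r) (tmul_mem_bideg hv D.eps_mem) (by omega)
        (by omega) (by omega)
      have := neg_mem (add_mem (add_mem m1 m2) (units_smul_mem _ (r + 1).negOnePow m4))
      convert this using 1
      simp only [zero_smul]
      abel
  · intro s _ _ hr β hβ
    have m1 := S.in2_mem_sup b (r := r) (D.mapAT_mem D.Xs (tmul_mem_bideg hβ D.eps_mem))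
      (by omega) (by omega) (by omega)
    have m2 := S.in4_mem_sup b (r := r) (tmul_mem_bideg (coact_ι_mem D.u hβ) D.eps_mem) (by omega)
      (by omega) (by omega)
    have hz := S.ell_mem _ _ (D.coact_eps_mem D.v)
    rw [tau_in3, S.tau3_eta b hr (by omega) hβ, map_add, map_units_smul, map_units_smul, map_smul,
      D.f_in4_eps b, D.f_in2_of_mem_one b _ hz, S.mu_ell_of_mem (by omega) (D.coact_eps_mem D.v)]
    -- For a scalar `β` the term `β ⊗ v(ε)` cancels against `1 ⊗ μ(ℓ(v(ε)))`.
    by_cases hs : s = 0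
    · have m3 := S.in1_mem_sup b (r := r) (mapX_mem D.X hz) (by omega) (by omega) (by omega)
      have m4 := S.in2_mem_sup b (r := r) (conR_memFD D.v hz) (by omega) (by omega) (by omega)
      have m5 := S.in2_mem_sup b (r := r) (conF_mem (D.Xs D.u) hz) (by omega) (by omega) (by omega)
      have e : in4 (β ⊗ₜ coact (ι D.v) D.eps) = sp β • in4 ((1 : E') ⊗ₜ coact (ι D.v) D.eps) := by
        rw [← map_smul, TensorProduct.smul_tmul', scalarPart_smul_of_zero hβ hs]
      have e' : (n : ℤ).negOnePow = r.negOnePow := by congr 1; omega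
      rw [e, e', s1, s2]
      have := neg_mem (add_mem (add_mem m1 m2) (units_smul_mem _ r.negOnePow
        (Submodule.smul_mem _ (sp β) (add_mem (add_mem (units_smul_mem _ (-r.negOnePow) m3) m4)
          (units_smul_mem _ r.negOnePow m5)))))
      convert this using 1
      rcases Int.units_eq_one_or r.negOnePow with h | h <;>
      · simp only [h, smul_add, one_smul, Units.neg_smul, neg_neg, smul_neg]
        abel
    · rw [scalarPart_of_mem_ne hs hβ]
      have m3 := S.in4_mem_sup b (r := r) (tmul_mem_bideg hβ (D.coact_eps_mem D.v)) (by omega)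
        (by omega) (by omega)
      have := neg_mem (add_mem (add_mem m1 m2) (units_smul_mem _ (r + 1).negOnePow m3))
      convert this using 1
      rcases Int.units_eq_one_or (r + 1).negOnePow with h | h <;>
      · simp only [h, smul_add, one_smul, Units.neg_smul, neg_neg, smul_neg, zero_smul, smul_zero]
        abel
  · intro _ _ β hβ
    have hz := S.ell_mem _ _ hβ
    rw [S.tau_one_in4 b hβ, D.f_in2_of_mem_one b _ hz, S.mu_ell_of_mem (by omega) hβ,
      sub_add_cancel_right]
    exact neg_mem (add_mem (add_mem
      (units_smul_mem _ _ (S.in1_mem_sup b (mapX_mem D.X hz) (by omega) (by omega) (by omega)))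
      (S.in2_mem_sup b (conR_memFD D.v hz) (by omega) (by omega) (by omega)))
      (units_smul_mem _ _
        (S.in2_mem_sup b (conF_mem (D.Xs D.u) hz) (by omega) (by omega) (by omega))))
  · intro _ _ β hβ
    have hz := S.ell_mem _ _ hβ
    rw [S.tau_in4_one b (by omega) hβ, map_neg, D.f_in3_of_mem_one b _ hz,
      S.mu_ell_of_mem (by omega) hβ, sub_neg_eq_add, add_sub_cancel]
    exact add_mem (add_mem
      (units_smul_mem _ _ (S.in1_mem_sup b (swap_mem (mapX_mem D.Xs hz)) (by omega) (by omega)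
        (by omega)))
      (units_smul_mem _ _
        (S.in3_mem_sup b hn (conR_memFD D.u hz) (by omega) (by omega) (by omega))))
      (S.in3_mem_sup b hn (conF_mem (D.X D.v) hz) (by omega) (by omega) (by omega))

end BasicData.Splittings
end Contraction

/-! ### The projection onto `𝕄`, its consequences, and the elimination data. -/

section Projection

variable {R : Type uR} [CommRing R] {F : Type uF} [AddCommGroup F] [Module R F] {n : ℕ}

local notation "E" => ExteriorAlgebra R F
local notation "E'" => ExteriorAlgebra R (Module.Dual R F)
local notation "ι" => ExteriorAlgebra.ι R
local notation "Λ" => extPow R (Module.Dual R F)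

variable (n) in
/-- The degrees `t` in the description of `𝕄_r ∩ 𝔽_r(i)`, for `i = 1, 4`. -/
def innerDegrees (k : ℤ) : Finset ℤ :=
  (Finset.Icc (0 : ℤ) n).filter (fun t : ℤ => t ≠ 0 ∧ t ≠ n ∧ t ≠ k ∧ t ≠ k - n)

variable (R F n) in
/-- The projection onto the sum of the modules `⋀^t F^* ⊗ ⋀^c F^*` with `t + c = k` and
`0 < t, c < n`. -/
def innerProj (k : ℤ) : E' ⊗[R] E' →ₗ[R] E' ⊗[R] E' :=
  ∑ t ∈ innerDegrees n k, projDD t (k - t)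

theorem innerProj_of_mem (b : Module.Basis (Fin n) R F) {k t c : ℤ} (hk : t + c = k) (h1 : t ≠ 0)
    (h2 : t ≠ n) (h3 : c ≠ 0) (h4 : c ≠ n) {z : E' ⊗[R] E'} (hz : z ∈ bidegDD t c) :
    innerProj R F n k z = z := by
  by_cases h : t < 0 ∨ n < t ∨ c < 0 ∨ n < c
  · rw [bidegDD_eq_bot b h, Submodule.mem_bot] at hz
    rw [hz, map_zero]
  rw [innerProj, LinearMap.sum_apply, Finset.sum_eq_single t]
  · exact bproj_of_mem (bidegDD_cast hz rfl (by omega))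
  · intro t' _ ht'
    exact bproj_of_mem_ne hz (Or.inl ht'.symm)
  · intro ht
    refine absurd ?_ ht
    simp only [innerDegrees, Finset.mem_filter, Finset.mem_Icc]
    omega

theorem innerProj_eq_zero {k t c : ℤ} (hk : t + c = k) (h : t = 0 ∨ t = n ∨ c = 0 ∨ c = n)
    {z : E' ⊗[R] E'} (hz : z ∈ bidegDD t c) : innerProj R F n k z = 0 := by
  rw [innerProj, LinearMap.sum_apply]
  refine Finset.sum_eq_zero fun t' ht' => bproj_of_mem_ne hz (Or.inl ?_)
  simp only [innerDegrees, Finset.mem_filter, Finset.mem_Icc] at ht'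
  omega

namespace BasicData.Splittings

variable {D : BasicData R F n} (S : D.Splittings) (b : Module.Basis (Fin n) R F)

/-- The part of `π_r` on `𝔽_r(3)` which is special to certain `r`. -/
def projExtra (r : ℤ) : E ⊗[R] E' →ₗ[R] E ⊗[R] E' :=
  if r = 0 then projFD 0 0
  else if r = 2 then S.projOnePP 2
  else if r = 2 * n - 2 then S.projCoPP (2 * n - 2)
  else if r = 2 * n then projFD n n
  else 0

theorem projM_eq (r : ℤ) : S.projM r = in1 ∘ₗ innerProj R F n (r + 1) ∘ₗ out1 +
    in2 ∘ₗ S.projMid r ∘ₗ out2 + in3 ∘ₗ (S.projMid r + S.projExtra r) ∘ₗ out3 +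
    in4 ∘ₗ innerProj R F n (r - 1) ∘ₗ out4 := rfl

theorem projM_in1 (r : ℤ) (z : E' ⊗[R] E') : S.projM r (in1 z) = in1 (innerProj R F n (r + 1) z) := by
  simp [projM_eq, in1, out1, out2, out3, out4]

theorem projM_in2 (r : ℤ) (z : E ⊗[R] E') : S.projM r (in2 z) = in2 (S.projMid r z) := by
  simp [projM_eq, in2, out1, out2, out3, out4]

theorem projM_in3 (r : ℤ) (z : E ⊗[R] E') :
    S.projM r (in3 z) = in3 (S.projMid r z + S.projExtra r z) := by
  simp [projM_eq, in3, out1, out2, out3, out4]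

theorem projM_in4 (r : ℤ) (z : E' ⊗[R] E') : S.projM r (in4 z) = in4 (innerProj R F n (r - 1) z) := by
  simp [projM_eq, in4, out1, out2, out3, out4]

section Values

variable {r t c : ℤ}

theorem projCoP_eq_zero {z : E ⊗[R] E'} (hz : z ∈ bidegFD t c) (ht : t ≠ n - 1) : S.projCoP r z = 0 := by
  have : projFD (n - 1) (r + 1 - n) z = 0 := bproj_of_mem_ne hz (Or.inl ht)
  simp [projCoP, projCoPP, this]

theorem projOneP_eq_zero {z : E ⊗[R] E'} (hz : z ∈ bidegFD t c) (ht : t ≠ 1) : S.projOneP r z = 0 := by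
  have : projFD 1 (r - 1) z = 0 := bproj_of_mem_ne hz (Or.inl ht)
  simp [projOneP, projOnePP, this]

theorem sum_projFD_eq_zero {z : E ⊗[R] E'} (hz : z ∈ bidegFD t c) (ht : t < 2 ∨ n - 2 < t) :
    (∑ t' ∈ Finset.Icc (2 : ℤ) (n - 2), projFD t' (r - t')) z = 0 := by
  rw [LinearMap.sum_apply]
  refine Finset.sum_eq_zero fun t' ht' => bproj_of_mem_ne hz (Or.inl ?_)
  rw [Finset.mem_Icc] at ht'
  omega

theorem projMid_eq_zero {z : E ⊗[R] E'} (hz : z ∈ bidegFD t c) (ht : t < 1 ∨ n ≤ t) (hn : 3 ≤ n) :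
    S.projMid r z = 0 := by
  rw [projMid, LinearMap.add_apply, LinearMap.add_apply, S.projCoP_eq_zero hz (by omega),
    S.projOneP_eq_zero hz (by omega), sum_projFD_eq_zero hz (by omega), add_zero, add_zero]

theorem projMid_mid {z : E ⊗[R] E'} (hz : z ∈ bidegFD t c) (hr : t + c = r) (ht : 2 ≤ t) (ht' : t ≤ n - 2) :
    S.projMid r z = z := by
  rw [projMid, LinearMap.add_apply, LinearMap.add_apply, S.projCoP_eq_zero hz (by omega),
    S.projOneP_eq_zero hz (by omega), zero_add, add_zero, LinearMap.sum_apply,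
    Finset.sum_eq_single t]
  · exact bproj_of_mem (bidegFD_cast hz rfl (by omega))
  · intro t' _ h
    exact bproj_of_mem_ne hz (Or.inl h.symm)
  · intro h; exact absurd (Finset.mem_Icc.2 ⟨ht, ht'⟩) h

theorem projMid_one {z : E ⊗[R] E'} (hn : 3 ≤ n) (hz : z ∈ bidegFD 1 c) (hr : 1 + c = r) :
    S.projMid r z = z - S.ell (mu z) := by
  have : projFD 1 (r - 1) z = z := bproj_of_mem (bidegFD_cast hz rfl (by omega))
  rw [projMid, LinearMap.add_apply, LinearMap.add_apply, S.projCoP_eq_zero hz (by omega),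
    sum_projFD_eq_zero hz (by omega), projOneP, projOnePP]
  simp [this]

theorem projMid_co {z : E ⊗[R] E'} (hn : 3 ≤ n) (hz : z ∈ bidegFD (n - 1) c) (hr : n - 1 + c = r) :
    S.projMid r z = z - D.sigma (S.lam z) := by
  have : projFD (n - 1) (r + 1 - n) z = z := bproj_of_mem (bidegFD_cast hz rfl (by omega))
  rw [projMid, LinearMap.add_apply, LinearMap.add_apply, S.projOneP_eq_zero hz (by omega),
    sum_projFD_eq_zero hz (by omega), projCoP, projCoPP]
  simp [this]

theorem projMid_oneP {z : E ⊗[R] E'} (hn : 3 ≤ n) (hz : z ∈ S.oneP r) : S.projMid r z = z := by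
  have h : mu z = 0 := hz.2
  rw [S.projMid_one hn hz.1 (by omega), h, map_zero, sub_zero]

theorem projMid_coP {z : E ⊗[R] E'} (hn : 3 ≤ n) (hz : z ∈ S.coP r) : S.projMid r z = z := by
  have h : S.lam z = 0 := hz.2
  rw [S.projMid_co hn hz.1 (by omega), h, map_zero, sub_zero]

theorem projMid_ell (hn : 3 ≤ n) {s : ℤ} (hr : r = s + 2) {β : E'} (hβ : β ∈ Λ s) :
    S.projMid r (S.ell β) = 0 := by
  by_cases hs : s = n
  · subst hs
    rw [S.ell_top β hβ, map_zero]
  · rw [S.projMid_one hn (S.ell_mem s β hβ) (by omega), S.mu_ell s hs β hβ, sub_self]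

theorem projExtra_eq_zero {z : E ⊗[R] E'} (_hn : 3 ≤ n) (hz : z ∈ bidegFD t c) (h0 : r = 0 → t ≠ 0)
    (h2 : r = 2 → t ≠ 1 ∨ mu z = 0) (h3 : r = 2 * n - 2 → t ≠ n - 1 ∨ S.lam z = 0)
    (h4 : r = 2 * n → t ≠ n) : S.projExtra r z = 0 := by
  unfold projExtra
  split_ifs with e0 e2 e3 e4
  · exact bproj_of_mem_ne hz (Or.inl (h0 e0))
  · rw [projOnePP]
    by_cases h : t = 1 ∧ c = 1
    · obtain ⟨rfl, rfl⟩ := h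
      have h' : mu z = 0 := (h2 e2).resolve_left (by simp)
      have : projFD 1 (2 - 1) z = z := bproj_of_mem (bidegFD_cast hz rfl (by omega))
      simp only [LinearMap.comp_apply, this, h', map_zero]
    · have : projFD 1 (2 - 1) z = 0 := bproj_of_mem_ne hz (by omega)
      simp only [LinearMap.comp_apply, this, map_zero]
  · rw [projCoPP]
    by_cases h : t = n - 1 ∧ c = n - 1
    · obtain ⟨rfl, rfl⟩ := h
      have h' : S.lam z = 0 := (h3 e3).resolve_left (by simp)
      have : projFD (n - 1) (2 * n - 2 + 1 - n) z = z :=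
        bproj_of_mem (bidegFD_cast hz rfl (by omega))
      simp [this, h']
    · have : projFD (n - 1) (2 * n - 2 + 1 - n) z = 0 := bproj_of_mem_ne hz (by omega)
      simp [this]
  · exact bproj_of_mem_ne hz (Or.inl (h4 e4))
  · rfl

end Values

include b in
theorem projM_of_mem (hn : 3 ≤ n) (r : ℤ) (x : Total R F) (hx : x ∈ S.MM r) : S.projM r x = x := by
  suffices h : S.MM r ≤ LinearMap.eqLocus (S.projM r) LinearMap.id from h hx
  refine S.MM_le ?_ ?_ ?_ ?_ ?_ ?_ ?_ ?_ ?_ ?_ ?_ ?_ <;>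
    simp only [LinearMap.mem_eqLocus, LinearMap.id_apply]
  · intro t c h h1 h2 h3 h4 z hz
    rw [projM_in1, innerProj_of_mem b h h1 h2 h3 h4 hz]
  · intro z hz; rw [projM_in2, S.projMid_coP hn hz]
  · intro t c h h1 h2 z hz; rw [projM_in2, S.projMid_mid hz h h1 h2]
  · intro z hz; rw [projM_in2, S.projMid_oneP hn hz]
  · intro z hz
    rw [projM_in3, S.projMid_coP hn hz, S.projExtra_eq_zero hn hz.1 (by omega) (by omega)
      (fun _ => Or.inr hz.2) (by omega), add_zero]
  · intro t c h h1 h2 z hz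
    rw [projM_in3, S.projMid_mid hz h h1 h2, S.projExtra_eq_zero hn hz (by omega) (by omega)
      (by omega) (by omega), add_zero]
  · intro z hz
    rw [projM_in3, S.projMid_oneP hn hz, S.projExtra_eq_zero hn hz.1 (by omega)
      (fun _ => Or.inr hz.2) (by omega) (by omega), add_zero]
  · intro t c h h1 h2 h3 h4 z hz
    rw [projM_in4, innerProj_of_mem b h h1 h2 h3 h4 hz]
  · rintro rfl z hz
    rw [projM_in3, S.projMid_eq_zero hz (by omega) hn, projExtra, if_pos rfl, projFD_eq,
      bproj_of_mem hz, zero_add]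
  · rintro rfl β hβ
    have hz := S.ell_mem 0 β hβ
    rw [projM_in3, S.projMid_ell hn (by omega) hβ, projExtra, if_neg (by omega), if_pos rfl,
      projOnePP]
    have : projFD 1 (2 - 1) (S.ell β) = S.ell β := bproj_of_mem (bidegFD_cast hz rfl (by omega))
    simp only [LinearMap.comp_apply, this, S.mu_ell_of_mem (show (0 : ℤ) ≠ n by omega) hβ, zero_add]
  · rintro rfl β hβ
    have hz := D.sigma_mem b hβ
    have h1 := S.lam_sigma_of_mem (show (n : ℤ) ≠ 0 by omega) hβ
    rw [projM_in3, S.projMid_co hn hz (by omega), h1, sub_self, projExtra, if_neg (by omega),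
      if_neg (by omega), if_pos rfl, projCoPP]
    have : projFD (n - 1) (2 * n - 2 + 1 - n) (D.sigma β) = D.sigma β :=
      bproj_of_mem (bidegFD_cast hz rfl (by omega))
    simp [this, h1]
  · rintro rfl z hz
    rw [projM_in3, S.projMid_eq_zero hz (by omega) hn, projExtra, if_neg (by omega),
      if_neg (by omega), if_neg (by omega), if_pos rfl, projFD_eq, bproj_of_mem hz, zero_add]

include b in
theorem projM_hatN (hn : 3 ≤ n) (r : ℤ) (x : Total R F) (hx : x ∈ S.hatN r) : S.projM r x = 0 := by
  suffices h : S.hatN r ≤ LinearMap.ker (S.projM r) from h hx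
  refine S.hatN_le b ?_ ?_ ?_ ?_ ?_ ?_ ?_ ?_ <;> simp only [LinearMap.mem_ker]
  · intro s _ _ _ β hβ
    rw [projM_in1, innerProj_eq_zero (by omega) (by omega) (tmul_mem_bideg D.eps_mem hβ), map_zero]
  · intro s _ _ _ β hβ
    rw [projM_in1, innerProj_eq_zero (by omega) (by omega) (tmul_mem_bideg hβ D.eps_mem), map_zero]
  · intro _ _ β hβ
    rw [projM_in2, S.projMid_eq_zero (tmul_mem_bideg one_mem_extPow hβ) (by omega) hn, map_zero]
  · intro s _ _ hr β hβ
    rw [projM_in2, S.projMid_ell hn hr hβ, map_zero]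
  · intro _ _ β hβ
    have hz := tmul_mem_bideg one_mem_extPow hβ (R := R) (V := F)
    rw [projM_in3, S.projMid_eq_zero hz (by omega) hn,
      S.projExtra_eq_zero hn hz (by omega) (by omega) (by omega) (by omega), add_zero, map_zero]
  · intro s _ _ hr β hβ
    rw [projM_in3, S.projMid_ell hn hr hβ, S.projExtra_eq_zero hn (S.ell_mem s β hβ)
      (by omega) (by omega) (by omega) (by omega), add_zero, map_zero]
  · intro s _ _ _ β hβ
    rw [projM_in4, innerProj_eq_zero (by omega) (by omega) (tmul_mem_bideg D.eps_mem hβ), map_zero]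
  · intro s _ _ _ β hβ
    rw [projM_in4, innerProj_eq_zero (by omega) (by omega) (tmul_mem_bideg hβ D.eps_mem), map_zero]

theorem innerProj_mem {k : ℤ} (z : E' ⊗[R] E') {P : Submodule R (E' ⊗[R] E')}
    (h : ∀ t c : ℤ, t + c = k → t ≠ 0 → t ≠ n → c ≠ 0 → c ≠ n → bidegDD t c ≤ P) :
    innerProj R F n k z ∈ P := by
  rw [innerProj, LinearMap.sum_apply]
  refine sum_mem fun t ht => ?_
  simp only [innerDegrees, Finset.mem_filter, Finset.mem_Icc] at ht
  exact h t (k - t) (by omega) (by omega) (by omega) (by omega) (by omega) (bproj_mem _ _ z)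

include b in
theorem projMid_mem {r : ℤ} (z : E ⊗[R] E') {P : Submodule R (E ⊗[R] E')} (h1 : S.coP r ≤ P)
    (h2 : ∀ t c : ℤ, t + c = r → 2 ≤ t → t ≤ n - 2 → bidegFD t c ≤ P) (h3 : S.oneP r ≤ P) :
    S.projMid r z ∈ P := by
  rw [projMid, LinearMap.add_apply, LinearMap.add_apply, LinearMap.sum_apply]
  refine add_mem (add_mem (h1 ?_) (sum_mem fun t ht => ?_)) (h3 ?_)
  · exact S.sub_sigma_lam_mem b (bproj_mem (R := R) (V := F) _ _ z) (by omega)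
  · rw [Finset.mem_Icc] at ht
    exact h2 t (r - t) (by omega) ht.1 ht.2 (bproj_mem _ _ z)
  · exact S.sub_ell_mu_mem b (bproj_mem (R := R) (V := F) _ _ z) (by omega)

include b in
-- With `projM_of_mem` this shows that `π_r`, defined on the whole ambient module, is a retraction
-- onto `𝕄_r`.
theorem projM_mem (hn : 3 ≤ n) (r : ℤ) (x : Total R F) : S.projM r x ∈ S.MM r := by
  rw [total_eq x]
  simp only [map_add]
  refine add_mem (add_mem (add_mem ?_ ?_) ?_) ?_
  · rw [projM_in1]
    exact innerProj_mem (P := (S.MM r).comap in1) _ fun t c h h1 h2 h3 h4 z hz =>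
      S.in1_mem_MM hz h h1 h2 h3 h4
  · rw [projM_in2]
    exact S.projMid_mem b (P := (S.MM r).comap in2) _ (fun z hz => S.in2_coP_mem_MM hz)
      (fun t c h h1 h2 z hz => S.in2_mid_mem_MM hz h h1 h2) (fun z hz => S.in2_oneP_mem_MM hz)
  · rw [projM_in3, map_add]
    refine add_mem (S.projMid_mem b (P := (S.MM r).comap in3) _ (fun z hz => S.in3_coP_mem_MM hz)
      (fun t c h h1 h2 z hz => S.in3_mid_mem_MM hz h h1 h2) (fun z hz => S.in3_oneP_mem_MM hz)) ?_
    unfold projExtra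
    split_ifs with e0 e2 e3 e4
    · subst e0; exact S.in3_zero_mem_MM (bproj_mem _ _ _)
    · subst e2
      exact S.in3_ell_mem_MM (extPow_cast (mu_mem (bproj_mem (R := R) (V := F) _ _ _)) (by omega))
    · subst e3
      exact S.in3_sigma_mem_MM hn
        (extPow_cast (S.lam_mem _ _ (bproj_mem (R := R) (V := F) _ _ _)) (by omega))
    · subst e4; exact S.in3_top_mem_MM hn (bproj_mem _ _ _)
    · rw [LinearMap.zero_apply, map_zero]; exact zero_mem _
  · rw [projM_in4]
    exact innerProj_mem (P := (S.MM r).comap in4) _ fun t c h h1 h2 h3 h4 z hz =>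
      S.in4_mem_MM hz h h1 h2 h3 h4

include b in
theorem MM_le_FF (r : ℤ) : S.MM r ≤ FF R F r := by
  refine S.MM_le ?_ ?_ ?_ ?_ ?_ ?_ ?_ ?_ ?_ ?_ ?_ ?_
  · intro t c h _ _ _ _ z hz; exact in1_mem_FF h hz
  · intro z hz; exact in2_mem_FF (by omega) hz.1
  · intro t c h _ _ z hz; exact in2_mem_FF h hz
  · intro z hz; exact in2_mem_FF (by omega) hz.1
  · intro z hz; exact in3_mem_FF (by omega) hz.1
  · intro t c h _ _ z hz; exact in3_mem_FF h hz
  · intro z hz; exact in3_mem_FF (by omega) hz.1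
  · intro t c h _ _ _ _ z hz; exact in4_mem_FF h hz
  · intro h z hz; exact in3_mem_FF (by omega) hz
  · intro h β hβ; exact in3_mem_FF (by omega) (S.ell_mem _ _ hβ)
  · intro h β hβ; exact in3_mem_FF (by omega) (D.sigma_mem b hβ)
  · intro h z hz; exact in3_mem_FF (by omega) hz

include b in
theorem hatN_le_FF (r : ℤ) : S.hatN r ≤ FF R F r := by
  refine S.hatN_le b ?_ ?_ ?_ ?_ ?_ ?_ ?_ ?_
  · intro s _ _ _ β hβ; exact in1_mem_FF (by omega) (tmul_mem_bideg D.eps_mem hβ)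
  · intro s _ _ _ β hβ; exact in1_mem_FF (by omega) (tmul_mem_bideg hβ D.eps_mem)
  · intro _ _ β hβ; exact in2_mem_FF (by omega) (tmul_mem_bideg one_mem_extPow hβ)
  · intro s _ _ _ β hβ; exact in2_mem_FF (by omega) (S.ell_mem _ _ hβ)
  · intro _ _ β hβ; exact in3_mem_FF (by omega) (tmul_mem_bideg one_mem_extPow hβ)
  · intro s _ _ _ β hβ; exact in3_mem_FF (by omega) (S.ell_mem _ _ hβ)
  · intro s _ _ _ β hβ; exact in4_mem_FF (by omega) (tmul_mem_bideg D.eps_mem hβ)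
  · intro s _ _ _ β hβ; exact in4_mem_FF (by omega) (tmul_mem_bideg hβ D.eps_mem)

include b in
theorem elimination (hn : 3 ≤ n) :
    Elimination (FF R F) S.MM S.hatN S.NN D.f S.tau S.projM S.psi S.m where
  d_d := D.f_f b
  d_mem := D.f_mem b
  M_le := S.MM_le_FF b
  N'_le := S.hatN_le_FF b
  N_eq _ := rfl
  psi_eq _ _ := by rw [psi, LinearMap.sub_apply, LinearMap.comp_apply, LinearMap.comp_apply]
  m_eq _ _ := by rw [m, LinearMap.comp_apply]
  tau_mem := S.tau_mem b hn
  tau_M := S.tau_MM b hn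
  tau_N' := S.tau_hatN b hn
  tau_d := S.tau_f b hn
  res := S.sub_f_tau_mem b hn
  pi_M := S.projM_of_mem b hn
  pi_N' := S.projM_hatN b hn

include b in
theorem MM_eq_bot {r : ℤ} (hr : r < 0 ∨ 2 * (n : ℤ) < r) : S.MM r = ⊥ := by
  rw [eq_bot_iff]
  -- A nonzero piece of this kind has both degrees strictly between 0 and `n`, which absorbs the
  -- shift by one in the first and fourth summands.
  have hDD : ∀ {t c : ℤ}, t + c = r - 1 ∨ t + c = r + 1 → t ≠ 0 → t ≠ n → c ≠ 0 → c ≠ n →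
      (bidegDD t c : Submodule R (E' ⊗[R] E')) = ⊥ := fun _ _ _ _ _ =>
    bidegDD_eq_bot b (by omega)
  have hFD : ∀ {t c : ℤ}, t + c = r → (bidegFD t c : Submodule R (E ⊗[R] E')) = ⊥ := fun _ =>
    bidegFD_eq_bot b (by omega)
  refine S.MM_le ?_ ?_ ?_ ?_ ?_ ?_ ?_ ?_ ?_ ?_ ?_ ?_
  · intro t c h h1 h2 h3 h4 z hz
    rw [hDD (Or.inr h) h1 h2 h3 h4, Submodule.mem_bot] at hz; rw [hz, map_zero]; exact zero_mem _
  · intro z hz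
    have hz : z ∈ bidegFD _ _ := hz.1
    rw [hFD (by omega), Submodule.mem_bot] at hz; rw [hz, map_zero]; exact zero_mem _
  · intro t c h _ _ z hz
    rw [hFD h, Submodule.mem_bot] at hz; rw [hz, map_zero]; exact zero_mem _
  · intro z hz
    have hz : z ∈ bidegFD _ _ := hz.1
    rw [hFD (by omega), Submodule.mem_bot] at hz; rw [hz, map_zero]; exact zero_mem _
  · intro z hz
    have hz : z ∈ bidegFD _ _ := hz.1
    rw [hFD (by omega), Submodule.mem_bot] at hz; rw [hz, map_zero]; exact zero_mem _
  · intro t c h _ _ z hz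
    rw [hFD h, Submodule.mem_bot] at hz; rw [hz, map_zero]; exact zero_mem _
  · intro z hz
    have hz : z ∈ bidegFD _ _ := hz.1
    rw [hFD (by omega), Submodule.mem_bot] at hz; rw [hz, map_zero]; exact zero_mem _
  · intro t c h h1 h2 h3 h4 z hz
    rw [hDD (Or.inl h) h1 h2 h3 h4, Submodule.mem_bot] at hz; rw [hz, map_zero]; exact zero_mem _
  · intro h z hz
    rw [hFD (by omega), Submodule.mem_bot] at hz; rw [hz, map_zero]; exact zero_mem _
  · intro h β hβ
    have hz := S.ell_mem _ _ hβ
    rw [hFD (by omega), Submodule.mem_bot] at hz; rw [hz, map_zero]; exact zero_mem _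
  · intro h β hβ
    have hz := D.sigma_mem b hβ
    rw [hFD (by omega), Submodule.mem_bot] at hz; rw [hz, map_zero]; exact zero_mem _
  · intro h z hz
    rw [hFD (by omega), Submodule.mem_bot] at hz; rw [hz, map_zero]; exact zero_mem _

include b in
theorem finite_projective_MM (hn : 3 ≤ n) (r : ℤ) :
    Module.Finite R (S.MM r) ∧ Module.Projective R (S.MM r) := by
  have : Module.Free R F := .of_basis b
  have : Module.Finite R F := .of_basis b
  have : Module.Free R (ExteriorAlgebra R F) := .of_basis b.ExteriorAlgebra
  have : Module.Finite R (ExteriorAlgebra R F) := .of_basis b.ExteriorAlgebra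
  have : Module.Free R (ExteriorAlgebra R (Module.Dual R F)) := .of_basis b.dualBasis.ExteriorAlgebra
  have : Module.Finite R (ExteriorAlgebra R (Module.Dual R F)) :=
    .of_basis b.dualBasis.ExteriorAlgebra
  -- Finiteness and projectivity descend along this retraction from the ambient module, which is
  -- finite and free.
  let p : Total R F →ₗ[R] S.MM r := (S.projM r).codRestrict (S.MM r) (S.projM_mem b hn r)
  have hp : p ∘ₗ (S.MM r).subtype = LinearMap.id :=
    LinearMap.ext fun x => Subtype.ext (S.projM_of_mem b hn r x x.2)
  exact ⟨Module.Finite.of_surjective p fun x => ⟨x, congrArg (fun g => g x) hp⟩,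
    Module.Projective.of_split _ p hp⟩

end BasicData.Splittings
end Projection

/-! ### Entries of the differential of `𝕄`. -/

section Entries

variable {R : Type uR} [CommRing R] {F : Type uF} [AddCommGroup F] [Module R F] {n : ℕ}

local notation "E" => ExteriorAlgebra R F
local notation "E'" => ExteriorAlgebra R (Module.Dual R F)
local notation "ι" => ExteriorAlgebra.ι R
local notation "Λ" => extPow R (Module.Dual R F)

theorem apply_mem_smul_top {M N : Type*} [AddCommGroup M] [Module R M] [AddCommGroup N] [Module R N]
    {J : Ideal R} (g : M →ₗ[R] N) {x : M} (hx : x ∈ (J • ⊤ : Submodule R M)) :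
    g x ∈ (J • ⊤ : Submodule R N) :=
  (Submodule.map_smul'' J ⊤ g).trans_le (Submodule.smul_mono le_rfl le_top)
    (Submodule.mem_map_of_mem hx)

theorem mem_smul_top_of_coord {κ : Type*} [Finite κ] {M : Type*} [AddCommGroup M] [Module R M]
    (b : Module.Basis κ R M) {J : Ideal R} {x : M} (h : ∀ i, b.repr x i ∈ J) :
    x ∈ (J • ⊤ : Submodule R M) := by
  have := Fintype.ofFinite κ
  rw [← b.sum_repr x]
  exact sum_mem fun i _ => Submodule.smul_mem_smul (h i) trivial

/-- A product of positive degree contributes at least one factor `Y(a)`; in degree 0 the map `⋀Y` is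
the identity on scalars. -/
theorem map_mem_smul_top {J : Ideal R} {Y : F →ₗ[R] Module.Dual R F}
    (hY : ∀ a, Y a ∈ (J • ⊤ : Submodule R (Module.Dual R F))) {t : ℤ} (ht : t ≠ 0) {x : E}
    (hx : x ∈ extPow R F t) : ExteriorAlgebra.map Y x ∈ (J • ⊤ : Submodule R E') := by
  revert ht
  induction hx using extPow_induction with
  | zero t => intro _; rw [map_zero]; exact zero_mem _
  | scalar c => intro h; exact absurd rfl h
  | add t x y _ _ hx hy => intro h; rw [map_add]; exact add_mem (hx h) (hy h)
  | ι_mul a t x _ _ =>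
    intro _
    rw [map_mul, ExteriorAlgebra.map_apply_ι]
    exact apply_mem_smul_top (LinearMap.mulRight R (ExteriorAlgebra.map Y x) ∘ₗ ι) (hY a)

/-- Lying in `J • ⊤` of the ambient module and in `C (r - 1)` does not by itself give `J • ⊤` of `C
(r - 1)`; the retraction `p` carries the one into the other. -/
theorem IsComplex.range_diff_le {T : Type*} [AddCommGroup T] [Module R T]
    {C : ℤ → Submodule R T} {d : ℤ → T →ₗ[R] T} (h : IsComplex C d) {r : ℤ} {J : Ideal R}
    (p : T →ₗ[R] T) (hp : ∀ x, p x ∈ C (r - 1)) (hp' : ∀ x ∈ C (r - 1), p x = x)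
    (hd : ∀ x ∈ C r, d r x ∈ (J • ⊤ : Submodule R T)) :
    LinearMap.range (h.diff r) ≤ (J • ⊤ : Submodule R (C (r - 1))) := by
  rintro _ ⟨x, rfl⟩
  have hx : p.codRestrict (C (r - 1)) hp (d r x) = h.diff r x :=
    Subtype.ext (hp' _ (h.mapsTo r x x.2))
  rw [← hx]
  exact apply_mem_smul_top _ (hd x x.2)

theorem I1_le {M N : Type*} [AddCommGroup M] [Module R M] [AddCommGroup N] [Module R N]
    {J : Ideal R} {g : M →ₗ[R] N} (hg : LinearMap.range g ≤ (J • ⊤ : Submodule R N)) :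
    I1 g ≤ J := by
  refine Ideal.span_le.2 ?_
  rintro _ ⟨x, φ, rfl⟩
  have := apply_mem_smul_top φ (hg ⟨x, rfl⟩)
  rwa [smul_eq_mul, Ideal.mul_top] at this

section Operators

variable {J : Ideal R} {w : F}

theorem conR_mem_smul_top {A : Type*} [AddCommGroup A] [Module R A]
    (hw : w ∈ (J • ⊤ : Submodule R F)) (z : A ⊗[R] E') :
    conR w z ∈ (J • ⊤ : Submodule R (A ⊗[R] E')) :=
  apply_mem_smul_top (LinearMap.applyₗ z ∘ₗ LinearMap.lTensorHom A ∘ₗ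
    (coact : E →ₐ[R] Module.End R E').toLinearMap ∘ₗ ι) hw

theorem conL_mem_smul_top (hw : w ∈ (J • ⊤ : Submodule R F)) (z : E' ⊗[R] E') :
    conL w z ∈ (J • ⊤ : Submodule R (E' ⊗[R] E')) :=
  apply_mem_smul_top (LinearMap.applyₗ z ∘ₗ LinearMap.rTensorHom E' ∘ₗ
    (coact : E →ₐ[R] Module.End R E').toLinearMap ∘ₗ ι) hw

theorem conF_mem_smul_top {φ : Module.Dual R F} (hφ : φ ∈ (J • ⊤ : Submodule R (Module.Dual R F)))
    (z : E ⊗[R] E') : conF φ z ∈ (J • ⊤ : Submodule R (E ⊗[R] E')) :=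
  apply_mem_smul_top (LinearMap.applyₗ z ∘ₗ LinearMap.rTensorHom E' ∘ₗ
    (act : E' →ₐ[R] Module.End R E).toLinearMap ∘ₗ ι) hφ

variable {Y : F →ₗ[R] Module.Dual R F}
  (hY : ∀ a, Y a ∈ (J • ⊤ : Submodule R (Module.Dual R F)))

include hY

theorem mapX_mem_smul_top {t c : ℤ} (ht : t ≠ 0) {z : E ⊗[R] E'} (hz : z ∈ bidegFD t c) :
    mapX Y z ∈ (J • ⊤ : Submodule R (E' ⊗[R] E')) := by
  have : bidegFD t c ≤ (J • ⊤ : Submodule R (E' ⊗[R] E')).comap (mapX Y) :=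
    bideg_le fun x hx y _ => apply_mem_smul_top ((TensorProduct.mk R E' E').flip y)
      (map_mem_smul_top hY ht hx)
  exact this hz

/-- `α(η)` has degree `n - t`, so `⋀Y` of it has entries in `J` as soon as `t ≠ n`; for `t = n` one
has the unit `A_Y(ε) = η`. -/
theorem BasicData.mapAT_mem_smul_top (D : BasicData R F n) {t c : ℤ} (ht : t ≠ n)
    {z : E' ⊗[R] E'} (hz : z ∈ bidegDD t c) :
    D.mapAT Y z ∈ (J • ⊤ : Submodule R (E ⊗[R] E')) := by
  have : bidegDD t c ≤ (J • ⊤ : Submodule R (E ⊗[R] E')).comap (D.mapAT Y) :=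
    bideg_le fun x hx y _ => apply_mem_smul_top ((TensorProduct.mk R E E').flip y)
      (apply_mem_smul_top (act.toLinearMap.flip D.eta)
        (map_mem_smul_top hY (show (n : ℤ) - t ≠ 0 by omega) (act_mem hx D.eta_mem)))
  exact this hz

end Operators

namespace BasicData

variable (D : BasicData R F n) (b : Module.Basis (Fin n) R F)

/-- The data `u`, `v`, `X` have entries in the ideal `J`. -/
structure EntriesIn (J : Ideal R) : Prop where
  u_mem : D.u ∈ (J • ⊤ : Submodule R F)
  v_mem : D.v ∈ (J • ⊤ : Submodule R F)
  X_mem : ∀ a, D.X a ∈ (J • ⊤ : Submodule R (Module.Dual R F))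
  Xs_mem : ∀ a, D.Xs a ∈ (J • ⊤ : Submodule R (Module.Dual R F))

include b in
theorem entriesIn {J : Ideal R} (h : I1 (LinearMap.toSpanSingleton R F D.u) ⊔
    I1 (LinearMap.toSpanSingleton R F D.v) ⊔ I1 D.X ≤ J) : D.EntriesIn J := by
  have hX : ∀ (a : F) (φ : Module.Dual R (Module.Dual R F)), φ (D.X a) ∈ J := fun a φ =>
    h (le_sup_right (a := I1 (LinearMap.toSpanSingleton R F D.u) ⊔ _)
      (Ideal.subset_span ⟨a, φ, rfl⟩))
  refine ⟨mem_smul_top_of_coord b fun i => ?_, mem_smul_top_of_coord b fun i => ?_,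
    fun a => mem_smul_top_of_coord b.dualBasis fun i => ?_,
    fun a => mem_smul_top_of_coord b.dualBasis fun i => ?_⟩
  · refine h (Submodule.mem_sup_left (Submodule.mem_sup_left (Ideal.subset_span ⟨1, b.coord i, ?_⟩)))
    simp
  · refine h (Submodule.mem_sup_left (Submodule.mem_sup_right (Ideal.subset_span ⟨1, b.coord i, ?_⟩)))
    simp
  · exact hX a (b.dualBasis.coord i)
  -- The coordinates of `X^*(a)` are the values `X(e_i)(a)`, hence given by evaluation forms on
  -- `F^*` applied to `X(e_i)`.
  · rw [Module.Basis.dualBasis_repr]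
    exact hX (b i) (Module.Dual.eval R F a)

variable {D} {J : Ideal R} (h : D.EntriesIn J) (r : ℤ) {t c : ℤ}

include h

include b in
theorem EntriesIn.f_in1 {z : E' ⊗[R] E'} (hz : z ∈ bidegDD t c) (ht : t ≠ n) (hc : c ≠ n) :
    D.f r (in1 z) ∈ (J • ⊤ : Submodule R (Total R F)) := by
  rw [D.f_in1, D.f1_apply b]
  refine add_mem (add_mem (apply_mem_smul_top _ (add_mem (conR_mem_smul_top h.v_mem _)
    (units_smul_mem _ _ (conL_mem_smul_top h.u_mem _)))) (apply_mem_smul_top _ ?_))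
    (apply_mem_smul_top _ ?_)
  · exact apply_mem_smul_top _ (D.mapAT_mem_smul_top h.Xs_mem ht hz)
  · exact apply_mem_smul_top _ (D.mapAT_mem_smul_top h.X_mem hc (swap_mem hz))

theorem EntriesIn.f_in4 {z : E' ⊗[R] E'} (hz : z ∈ bidegDD t c) (ht : t ≠ n) (hc : c ≠ n) :
    D.f r (in4 z) ∈ (J • ⊤ : Submodule R (Total R F)) := by
  rw [D.f_in4, D.f4_apply]
  refine add_mem (add_mem (apply_mem_smul_top _ (units_smul_mem _ _ ?_))
    (apply_mem_smul_top _ (units_smul_mem _ _ ?_)))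
    (apply_mem_smul_top _ (add_mem (conR_mem_smul_top h.v_mem _)
    (units_smul_mem _ _ (conL_mem_smul_top h.u_mem _))))
  · exact D.mapAT_mem_smul_top h.Xs_mem ht hz
  · exact D.mapAT_mem_smul_top h.X_mem hc (swap_mem hz)

include b in
-- The two unit components on this summand are `⋀X` in degree `t = 0` and the contraction `μ` in
-- degree `t = 1`; the hypotheses exclude both.
theorem EntriesIn.f_in2 {z : E ⊗[R] E'} (hz : z ∈ bidegFD t c) (ht : t ≠ 0)
    (ht' : t ≠ 1 ∨ mu z = 0) : D.f r (in2 z) ∈ (J • ⊤ : Submodule R (Total R F)) := by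
  rw [D.f_in2, D.f2_apply b]
  refine add_mem (add_mem (apply_mem_smul_top _ (units_smul_mem _ _
    (mapX_mem_smul_top h.X_mem ht hz))) (apply_mem_smul_top _ (add_mem
      (conR_mem_smul_top h.v_mem _) (units_smul_mem _ _ (conF_mem_smul_top (h.Xs_mem _) _)))))
    (apply_mem_smul_top _ ?_)
  by_cases h1 : t = 1
  · subst h1
    rw [mapX_cas_of_mem_one b _ hz, ht'.resolve_left (by simp), TensorProduct.tmul_zero]
    exact zero_mem _
  · exact mapX_mem_smul_top h.X_mem (show t - 1 ≠ 0 by omega) (cas_mem b hz)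

include b in
theorem EntriesIn.f_in3 {z : E ⊗[R] E'} (hz : z ∈ bidegFD t c) (ht : t ≠ 0)
    (ht' : t ≠ 1 ∨ mu z = 0) : D.f r (in3 z) ∈ (J • ⊤ : Submodule R (Total R F)) := by
  rw [D.f_in3, D.f3_apply b]
  refine sub_mem (add_mem (apply_mem_smul_top _ (units_smul_mem _ _
    (apply_mem_smul_top _ (mapX_mem_smul_top h.Xs_mem ht hz)))) (apply_mem_smul_top _ (add_mem
      (units_smul_mem _ _ (conR_mem_smul_top h.u_mem _)) (conF_mem_smul_top (h.X_mem _) _))))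
    (apply_mem_smul_top _ (apply_mem_smul_top _ ?_))
  by_cases h1 : t = 1
  · subst h1
    rw [mapX_cas_of_mem_one b _ hz, ht'.resolve_left (by simp), TensorProduct.tmul_zero]
    exact zero_mem _
  · exact mapX_mem_smul_top h.Xs_mem (show t - 1 ≠ 0 by omega) (cas_mem b hz)

end BasicData

namespace BasicData.Splittings

variable {D : BasicData R F n} (S : D.Splittings) (b : Module.Basis (Fin n) R F)

theorem m_apply (r : ℤ) (x : Total R F) : S.m r x = S.psi (r - 1) (D.f r x) := by
  rw [m, LinearMap.comp_apply]

include b in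
theorem m_apply_mem (hn : 3 ≤ n) (r : ℤ) (x : Total R F) (hx : x ∈ S.MM r) :
    S.m r x ∈ S.MM (r - 1) :=
  (S.elimination b hn).psi_mem (r - 1) (D.f_mem b r x (S.MM_le_FF b r hx))

set_option maxHeartbeats 1000000 in
include b in
/-- The map `m_2` on the special summand `[𝔽_2(3)^(1)]''` of `𝕄_2`. -/
theorem m_in3_ell_mem (hn : 3 ≤ n) {J : Ideal R} (h : D.EntriesIn J) {r : ℤ} (hr : r = 2)
    {β : E'} (hβ : β ∈ Λ 0) :
    S.m r (in3 (S.ell β)) ∈ (J • ⊤ : Submodule R (Total R F)) := by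
  have hz := S.ell_mem 0 β hβ
  have hm : mu (S.ell β) = β := S.mu_ell_of_mem (show (0 : ℤ) ≠ n by omega) hβ
  have hsymm : β ⊗ₜ[R] (1 : E') = 1 ⊗ₜ β := by
    rw [eq_smul_one_of_mem hβ, TensorProduct.tmul_smul, TensorProduct.smul_tmul']
  -- The unit term is `[1 ⊗ β]_4`, as `β` is a scalar. It differs by an element `y` with entries in
  -- `J` from `f [ℓ(β)]_2`, which `ψ` kills, so `ψ` turns it into `-π y`.
  have key : S.psi (r - 1) (in4 (β ⊗ₜ 1)) ∈ (J • ⊤ : Submodule R (Total R F)) := by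
    have hβ' : β ∈ Λ ((r - 1) - 1) := extPow_cast hβ (by omega)
    have e1 : S.projM (r - 1) (in4 (1 ⊗ₜ β)) = 0 := by
      rw [projM_in4, innerProj_eq_zero (t := 0) (c := 0) (by omega) (by omega)
        (tmul_mem_bideg one_mem_extPow hβ), map_zero]
    obtain ⟨y, hy, e2⟩ : ∃ y ∈ (J • ⊤ : Submodule R (Total R F)),
        D.f (r - 1 + 1) (in2 (S.ell β)) = y + in4 (1 ⊗ₜ β) := by
      refine ⟨_, ?_, (D.f_in2_of_mem_one b _ hz).trans (by rw [hm])⟩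
      refine add_mem (add_mem ?_ ?_) ?_
      · exact units_smul_mem _ _ (apply_mem_smul_top _ (mapX_mem_smul_top h.X_mem (by omega) hz))
      · exact apply_mem_smul_top _ (conR_mem_smul_top h.v_mem _)
      · exact units_smul_mem _ _ (apply_mem_smul_top _ (conF_mem_smul_top (h.Xs_mem _) _))
    have e3 : S.psi (r - 1) (in4 (1 ⊗ₜ β)) = -S.projM (r - 1) y := by
      change S.projM (r - 1) (in4 (1 ⊗ₜ β)) -
        S.projM (r - 1) (D.f (r - 1 + 1) (S.tau (r - 1) (in4 (1 ⊗ₜ β)))) = _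
      rw [S.tau_one_in4 b hβ', e2, LinearMap.map_add, e1, zero_sub, add_zero]
    rw [hsymm, e3]
    exact neg_mem (apply_mem_smul_top _ hy)
  rw [m_apply, D.f_in3_of_mem_one b _ hz, hm, map_sub (S.psi (r - 1))]
  refine sub_mem (apply_mem_smul_top _ (add_mem (add_mem ?_ ?_) ?_)) key
  · exact units_smul_mem _ _ (apply_mem_smul_top _
      (apply_mem_smul_top _ (mapX_mem_smul_top h.Xs_mem (by omega) hz)))
  · exact units_smul_mem _ _ (apply_mem_smul_top _ (conR_mem_smul_top h.u_mem _))
  · exact apply_mem_smul_top _ (conF_mem_smul_top (h.X_mem _) _)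

include b in
theorem m_mem_smul_top (hn : 3 ≤ n) {J : Ideal R} (h : D.EntriesIn J) (r : ℤ) (x : Total R F)
    (hx : x ∈ S.MM r) : S.m r x ∈ (J • ⊤ : Submodule R (Total R F)) := by
  suffices hle : S.MM r ≤ (J • ⊤ : Submodule R (Total R F)).comap (S.m r) from hle hx
  have key : ∀ {y : Total R F}, D.f r y ∈ (J • ⊤ : Submodule R (Total R F)) →
      y ∈ (J • ⊤ : Submodule R (Total R F)).comap (S.m r) := fun {y} hy => by
    rw [Submodule.mem_comap, m_apply]; exact apply_mem_smul_top (S.psi (r - 1)) hy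
  refine S.MM_le ?_ ?_ ?_ ?_ ?_ ?_ ?_ ?_ ?_ ?_ ?_ ?_
  · intro t c _ _ h2 _ h4 z hz; exact key (h.f_in1 b r hz h2 h4)
  · intro z hz; exact key (h.f_in2 b r hz.1 (by omega) (by omega))
  · intro t c _ _ _ z hz; exact key (h.f_in2 b r hz (by omega) (by omega))
  · intro z hz; exact key (h.f_in2 b r hz.1 (by omega) (Or.inr hz.2))
  · intro z hz; exact key (h.f_in3 b r hz.1 (by omega) (by omega))
  · intro t c _ _ _ z hz; exact key (h.f_in3 b r hz (by omega) (by omega))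
  · intro z hz; exact key (h.f_in3 b r hz.1 (by omega) (Or.inr hz.2))
  · intro t c _ _ h2 _ h4 z hz; exact key (h.f_in4 r hz h2 h4)
  -- Here `f` itself has a unit component, `[1 ⊗ 1]_1`, but the target `𝕄_(-1)` is zero.
  · rintro rfl z hz
    have hm := S.m_apply_mem b hn 0 _ (S.in3_zero_mem_MM hz)
    rw [S.MM_eq_bot b (by omega), Submodule.mem_bot] at hm
    rw [Submodule.mem_comap, hm]
    exact zero_mem _
  · intro hr β hβ; exact S.m_in3_ell_mem b hn h hr hβ
  · intro _ β hβ; exact key (h.f_in3 b r (D.sigma_mem b hβ) (by omega) (by omega))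
  · intro _ z hz; exact key (h.f_in3 b r hz (by omega) (by omega))

end BasicData.Splittings
end Entries

/-! ### Zeroth homology as a cokernel. -/

section HomologyZero

open CategoryTheory

variable {R : Type uR} [CommRing R] {T : Type uT} [AddCommGroup T] [Module R T]

theorem IsComplex.nonempty_homology_zero {C : ℤ → Submodule R T} {d : ℤ → T →ₗ[R] T}
    (h : IsComplex C d) (hC : C (-1) = ⊥) {Q : Type*} [AddCommGroup Q] [Module R Q]
    (q : T →ₗ[R] Q) (hq : ∀ y, ∃ x ∈ C 0, q x = y)
    (hq' : ∀ x ∈ C 0, q x = 0 ↔ ∃ y ∈ C 1, d 1 y = x) :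
    Nonempty (h.toChainComplex.homology 0 ≃ₗ[R] Q) := by
  let K := h.toChainComplex
  let A := K.sc' 1 0 (-1)
  have e : K.homology 0 ≅ A.homology := K.homologyIsoSc' 1 0 (-1)
    (by simp) (by simp)
  have hd : ∀ x, (A.f.hom x : C 0).1 = d 1 x.1 := fun x => by
    change ((K.d 1 0).hom x : C 0).1 = _
    rw [h.toChainComplex_d (i := 1) (j := 0) (by omega)]
    rfl
  have hg : A.g.hom = 0 := by
    ext x
    have hx := (A.g.hom x : C (-1)).2
    exact Subtype.ext ((Submodule.mem_bot R).1 (hC.le hx))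
  let p : LinearMap.ker A.g.hom →ₗ[R] Q := (q ∘ₗ (C 0).subtype) ∘ₗ (LinearMap.ker A.g.hom).subtype
  have hp : Function.Surjective p := fun y => by
    obtain ⟨x, hx, rfl⟩ := hq y
    exact ⟨⟨⟨x, hx⟩, by rw [hg]; exact LinearMap.zero_apply _⟩, rfl⟩
  have hk : LinearMap.range A.moduleCatToCycles = LinearMap.ker p := by
    ext x
    constructor
    · rintro ⟨y, rfl⟩
      exact (hq' _ (A.f.hom y : C 0).2).2 ⟨y.1, y.2, (hd y).symm⟩
    · intro hx
      obtain ⟨y, hy, hyx⟩ := (hq' _ (x.1 : C 0).2).1 hx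
      exact ⟨⟨y, hy⟩, Subtype.ext (Subtype.ext ((hd ⟨y, hy⟩).trans hyx))⟩
  exact ⟨(e ≪≫ A.moduleCatHomologyIso).toLinearEquiv ≪≫ₗ
    (Submodule.quotEquivOfEq _ _ hk) ≪≫ₗ p.quotKerEquivOfSurjective hp⟩

end HomologyZero

/-! ### Reversal of wedges, Cramer's rule and determinants. -/

section Adjugate

variable {R : Type uR} [CommRing R] {V W : Type*} [AddCommGroup V] [Module R V]
  [AddCommGroup W] [Module R W]

local notation "ι" => ExteriorAlgebra.ι R

/-- Moving the first vector behind `n` others costs `(-1)^n`; the exponents add up to a triangular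
number. -/
theorem reverse_ιMulti (n : ℕ) (v : Fin n → V) :
    CliffordAlgebra.reverse (Q := (0 : QuadraticForm R V)) (ExteriorAlgebra.ιMulti R n v) =
      (-1 : ℤˣ) ^ (n * (n - 1) / 2) • ExteriorAlgebra.ιMulti R n v := by
  induction n with
  | zero => simp
  | succ n ih =>
    have hm : ExteriorAlgebra.ιMulti R n (Matrix.vecTail v) ∈ ⋀[R]^n V :=
      ExteriorAlgebra.ιMulti_range R n ⟨_, rfl⟩
    have hr : CliffordAlgebra.reverse (Q := (0 : QuadraticForm R V)) (ι (v 0)) = ι (v 0) :=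
      CliffordAlgebra.reverse_ι _
    rw [ExteriorAlgebra.ιMulti_succ_apply]
    refine (CliffordAlgebra.reverse.map_mul _ _).trans ?_
    rw [hr, ih, smul_mul_assoc]
    refine (congrArg _ (mul_ι_eq (v 0) _)).trans ?_
    rw [inv_of_mem hm, mul_smul_comm, smul_smul, ← pow_add, Nat.triangle_succ]

theorem ιMulti_rev {n : ℕ} (v : Fin n → V) :
    ExteriorAlgebra.ιMulti R n (fun i => v i.rev) =
      (-1 : ℤˣ) ^ (n * (n - 1) / 2) • ExteriorAlgebra.ιMulti R n v := by
  rw [← reverse_ιMulti, ExteriorAlgebra.ιMulti_apply, ExteriorAlgebra.ιMulti_apply]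
  have h := CliffordAlgebra.reverse_prod_map_ι (Q := (0 : QuadraticForm R V)) (List.ofFn v)
  rw [List.map_ofFn] at h
  refine Eq.trans ?_ h.symm
  congr 1
  refine List.ext_getElem (by simp) fun i hi hi' => ?_
  rw [List.getElem_reverse, List.getElem_ofFn, List.getElem_ofFn]
  refine congrArg (fun j => ι (v j)) (Fin.ext ?_)
  simp [Fin.val_rev]
  omega

/-- Cramer's rule in exterior form. The sign with which the derivation removes the `k`-th factor
equals the sign for moving `y` into the vacant place. -/
theorem ι_mul_map_contract {n : ℕ} (X : V →ₗ[R] W) (y : W) (φ : Module.Dual R V) (v : Fin n → V) :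
    ι y * ExteriorAlgebra.map X (act (ι φ) (ExteriorAlgebra.ιMulti R n v)) =
      ∑ k, φ (v k) • ExteriorAlgebra.ιMulti R n (Function.update (fun i => X (v i)) k y) := by
  induction n with
  | zero =>
    have := act_ι_algebraMap φ (1 : R)
    rw [map_one] at this
    simp [this]
  | succ n ih =>
    rw [Fin.sum_univ_succ, ExteriorAlgebra.ιMulti_succ_apply, act_ι_ι_mul, map_sub, map_smul,
      map_mul, ExteriorAlgebra.map_apply_ι, mul_sub, mul_smul_comm, ExteriorAlgebra.map_apply_ιMulti,
      ← mul_assoc, ι_mul_ι_swap, neg_mul, mul_assoc, ih, sub_neg_eq_add, Finset.mul_sum]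
    congr 1
    · rw [ExteriorAlgebra.ιMulti_succ_apply]
      rfl
    · refine Finset.sum_congr rfl fun k _ => ?_
      have hk : Matrix.vecTail (Function.update (fun i => X (v i)) k.succ y) =
          Function.update (fun i => X (Matrix.vecTail v i)) k y := by
        funext i
        simp only [Matrix.vecTail, Function.comp_apply, Function.update_apply, Fin.succ_inj]
      rw [mul_smul_comm, ExteriorAlgebra.ιMulti_succ_apply, hk,
        Function.update_of_ne (Fin.succ_ne_zero k).symm]
      rfl

/-- Two alternating maps of `n` arguments agree once they agree on permutations of the basis. -/
theorem ιMulti_eq_det_smul {n : ℕ} (b : Module.Basis (Fin n) R V) (v : Fin n → V) :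
    ExteriorAlgebra.ιMulti R n v =
      (Matrix.of fun i j => b.repr (v i) j).det • ExteriorAlgebra.ιMulti R n b := by
  have key : ExteriorAlgebra.ιMulti R n =
      (LinearMap.toSpanSingleton R _ (ExteriorAlgebra.ιMulti R n b)).compAlternatingMap b.det := by
    refine Module.Basis.ext_alternating b fun i h => ?_
    let σ : Equiv.Perm (Fin n) := Equiv.ofBijective i (Finite.injective_iff_bijective.1 h)
    change ExteriorAlgebra.ιMulti R n (b ∘ σ) =
      (LinearMap.toSpanSingleton R _ (ExteriorAlgebra.ιMulti R n b)).compAlternatingMap b.det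
        (b ∘ σ)
    rw [AlternatingMap.map_perm, AlternatingMap.map_perm]
    simp [Module.Basis.det_self]
  refine (congrArg (fun g => g v) key).trans ?_
  rw [LinearMap.compAlternatingMap_apply, LinearMap.toSpanSingleton_apply, Module.Basis.det_apply,
    ← Matrix.det_transpose]
  rfl

end Adjugate

/-! ### Linear forms on `𝔽_0` and the values of `f_1`. -/

section HomologyZeroOfMM

variable {R : Type uR} [CommRing R] {F : Type uF} [AddCommGroup F] [Module R F] {n : ℕ}

local notation "E" => ExteriorAlgebra R F
local notation "E'" => ExteriorAlgebra R (Module.Dual R F)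
local notation "ι" => ExteriorAlgebra.ι R
local notation "sp" => scalarPart R (Module.Dual R F)
local notation "Λ" => extPow R (Module.Dual R F)

theorem basis_mem {κ M V : Type*} [AddCommGroup V] [Module R V] [AddCommGroup M] [Module R M]
    (b : Module.Basis κ R V) (P : Submodule R M) (g : V →ₗ[R] M) (h : ∀ i, g (b i) ∈ P) (x : V) :
    g x ∈ P := by
  have : Submodule.span R (Set.range b) ≤ P.comap g :=
    Submodule.span_le.2 (Set.range_subset_iff.2 h)
  exact this (b.mem_span x)

section Combination

variable {M N : Type*} [AddCommGroup M] [Module R M] [AddCommGroup N] [Module R N]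
  (g : M →ₗ[R] N)

theorem map_add_units_smul (s : ℤˣ) (x y : M) : g (x + s • y) = g x + s • g y := by
  rw [map_add, map_units_smul]

theorem map_add_add (x y z : M) : g (x + y + z) = g x + g y + g z := by
  rw [map_add, map_add]

theorem map_combination_left (s t : ℤˣ) (x y z w : M) :
    g (s • x + y + t • z + w) = s • g x + g y + t • g z + g w := by
  rw [map_add, map_add, map_add, map_units_smul, map_units_smul]

theorem map_combination_right (s t : ℤˣ) (x y z w : M) :
    g (s • x + t • y + z - w) = s • g x + t • g y + g z - g w := by
  rw [map_sub, map_add, map_add, map_units_smul, map_units_smul]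

end Combination

namespace BasicData

variable (D : BasicData R F n) {b : Module.Basis (Fin n) R F}

/-- The left side is `[ε_i ∧ (⋀X)(ε_j(η))](η)`. By Cramer's rule the wedge is `X(e_1) ∧ ⋯ ∧ X(e_n)`
with the `j`-th factor replaced by `ε_i`, and its determinant is a cofactor. -/
theorem scalarPart_act_mapA (hb : IsAdapted D b) (i j : Fin n) :
    scalarPart R F (act (ι (b.coord i)) (mapA D.X D.eta (ι (b.coord j)))) =
      (-1 : R) ^ (n * (n - 1) / 2) * (matrixOf D b).adjugate j i := by
  have hs : ∀ x : E', (-1 : ℤˣ) ^ (n * (n - 1) / 2) • x = (-1 : R) ^ (n * (n - 1) / 2) • x := by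
    intro x
    rcases Nat.even_or_odd (n * (n - 1) / 2) with h | h <;> simp [h.neg_one_pow]
  -- The orientation `ε` is the dual wedge in reversed order, which is the source of the sign.
  have hc : ExteriorAlgebra.ιMulti R n b.dualBasis =
      (-1 : R) ^ (n * (n - 1) / 2) • D.eps := by
    have h := hb.dual_wedge_eq
    rw [← Module.Basis.coe_dualBasis, ιMulti_rev (R := R) b.dualBasis, hs] at h
    rw [← h, smul_smul, ← mul_pow]
    simp
  have hcol : Matrix.of (fun k l => b.dualBasis.repr
      (Function.update (fun k => D.X (b k)) j (b.coord i) k) l) =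
      (matrixOf D b).transpose.updateRow j (Pi.single i 1) := by
    ext k l
    rw [Matrix.of_apply, Module.Basis.dualBasis_repr, Matrix.updateRow_apply, Function.update_apply]
    split_ifs with h
    · simp [Pi.single_apply, Finsupp.single_apply, eq_comm]
    · rfl
  rw [mapA_apply, ← act_mul, ← hb.wedge_eq, ι_mul_map_contract, Finset.sum_eq_single j]
  · rw [ιMulti_eq_det_smul b.dualBasis, hcol, ← Matrix.adjugate_apply, ← Matrix.adjugate_transpose,
      Matrix.transpose_apply, hc, hb.wedge_eq]
    simp only [map_smul, LinearMap.smul_apply, D.act_eps_eta b]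
    simp [mul_comm]
  · intro k _ hk
    simp [hk]
  · simp

end BasicData

variable (R F) in
/-- The coefficient of `[1 ⊗ 1]` in the third summand. -/
def unitCoeff : Total R F →ₗ[R] R :=
  (TensorProduct.lid R R).toLinearMap ∘ₗ
    TensorProduct.map (scalarPart R F) (scalarPart R (Module.Dual R F)) ∘ₗ out3

theorem unitCoeff_in3 (x : E) (y : E') :
    unitCoeff R F (in3 (x ⊗ₜ y)) = scalarPart R F x * sp y := by
  simp [unitCoeff, out3, in3]

theorem bidegFD_zero_eq {z : E ⊗[R] E'} (hz : z ∈ bidegFD 0 0) :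
    in3 z = unitCoeff R F (in3 z) • in3 (1 ⊗ₜ 1) := by
  refine eqOn_bideg (a := 0) (b := 0) in3
    ((unitCoeff R F ∘ₗ in3).smulRight (in3 (1 ⊗ₜ 1))) (fun x hx y hy => ?_) hz
  rw [LinearMap.smulRight_apply, LinearMap.comp_apply, unitCoeff_in3]
  conv_lhs => rw [eq_smul_one_of_mem hy, eq_scalarPart_of_mem hx, Algebra.algebraMap_eq_smul_one]
  rw [TensorProduct.tmul_smul, ← TensorProduct.smul_tmul', smul_smul, map_smul, mul_comm]

namespace BasicData

/-- A linear form on `𝔽_0` which extends the coefficient of `[1 ⊗ 1]_3` and vanishes on the part of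
`ℕ_0` which comes from the second summand and from `[1 ⊗ ⋀^1 F^*]_2` and `[1 ⊗ ⋀^1 F^*]_3`. -/
structure IsAugmentation (D : BasicData R F n) (p : Total R F →ₗ[R] R) : Prop where
  in2 : ∀ z ∈ bidegFD 0 0, p (in2 z) = 0
  in3 : ∀ z ∈ bidegFD 0 0, p (in3 z) = unitCoeff R F (in3 z)
  f_in2 : ∀ β : Module.Dual R F, p (D.f 1 (TwoSequences.in2 (1 ⊗ₜ ι β))) = 0
  f_in3 : ∀ α : Module.Dual R F, p (D.f 1 (TwoSequences.in3 (1 ⊗ₜ ι α))) = 0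

namespace IsAugmentation

variable {D : BasicData R F n} {p : Total R F →ₗ[R] R} (hp : D.IsAugmentation p)
  (b : Module.Basis (Fin n) R F)

include b hp

theorem in1_one (β : Module.Dual R F) : p (in1 (1 ⊗ₜ ι β)) = 0 := by
  have h := hp.f_in2 β
  rw [D.f_one_in2 b, map_add p, hp.in2 _
    (tmul_mem_bideg one_mem_extPow (coact_ι_mem D.v (ι_mem_extPow β))), add_zero,
    map_units_smul p, smul_eq_zero_iff_eq] at h
  exact h

/-- `f [1 ⊗ α]_3 = [α ⊗ 1]_1 + [1 ⊗ u(α)]_3` in degree 1, and the form vanishes on the left side. -/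
theorem in1_ι (α : Module.Dual R F) : p (in1 (ι α ⊗ₜ 1)) = -α D.u := by
  have h := hp.f_in3 α
  rw [D.f_one_in3 b, map_add p, map_units_smul p, map_units_smul p, hp.in3 _
    (tmul_mem_bideg one_mem_extPow (coact_ι_mem D.u (ι_mem_extPow α))), coact_ι_ι, unitCoeff_in3,
    scalarPart_algebraMap, ← smul_add, smul_eq_zero_iff_eq] at h
  rw [eq_neg_of_add_eq_zero_left h]
  simp

theorem in1_conR (α β : Module.Dual R F) :
    p (in1 (conR D.v (ι α ⊗ₜ ι β))) = -(β D.v * α D.u) := by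
  rw [LinearMap.lTensor_tmul, coact_ι_ι, Algebra.algebraMap_eq_smul_one,
    TensorProduct.tmul_smul, LinearMap.map_smul, LinearMap.map_smul, hp.in1_ι b]
  simp

theorem in1_conL (α β : Module.Dual R F) : p (in1 (conL D.u (ι α ⊗ₜ ι β))) = 0 := by
  rw [LinearMap.rTensor_tmul, coact_ι_ι, Algebra.algebraMap_eq_smul_one,
    ← TensorProduct.smul_tmul', LinearMap.map_smul, LinearMap.map_smul, hp.in1_one b, smul_zero]

omit hp in
theorem unitCoeff_cas (x : E) (i : Fin n) : unitCoeff R F (TwoSequences.in3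
    (cas b (x ⊗ₜ ι (b.coord i)))) = scalarPart R F (act (ι (b.coord i)) x) := by
  rw [cas_tmul, map_sum (TwoSequences.in3 (R := R) (F := F)), map_sum (unitCoeff R F), Finset.sum_eq_single i]
  · rw [unitCoeff_in3, coact_ι_ι, scalarPart_algebraMap]
    simp
  · intro k _ hk
    rw [unitCoeff_in3, coact_ι_ι, scalarPart_algebraMap]
    simp [hk]
  · simp

/-- The cofactor comes from the third component of `f`, the product of coordinates from contraction
by `v` in the first component; the other two contributions vanish. -/
theorem f_in1 (hb : IsAdapted D b) (i j : Fin n) :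
    p (D.f 1 (in1 (ι (b.coord i) ⊗ₜ ι (b.coord j)))) =
      (-1 : R) ^ (n * (n - 1) / 2) * (matrixOf D b).adjugate j i - b.repr D.v j * b.repr D.u i := by
  obtain ⟨z, e⟩ : ∃ z : E' ⊗[R] E', z = ι (b.coord i) ⊗ₜ ι (b.coord j) := ⟨_, rfl⟩
  have hz : z ∈ bidegDD (R := R) (F := F) 1 1 :=
    e ▸ tmul_mem_bideg (ι_mem_extPow _) (ι_mem_extPow _)
  have e1 : p (in1 (conR D.v z)) = -(b.repr D.v j * b.repr D.u i) :=
    e ▸ hp.in1_conR b (b.coord i) (b.coord j)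
  have e2 : p (in1 (conL D.u z)) = 0 := e ▸ hp.in1_conL b (b.coord i) (b.coord j)
  have e3 : unitCoeff R F (TwoSequences.in3 (cas b (D.mapAT D.X (swap R F z)))) =
      (-1 : R) ^ (n * (n - 1) / 2) * (matrixOf D b).adjugate j i := by
    rw [← D.scalarPart_act_mapA hb i j, e]
    exact unitCoeff_cas b _ i
  have e4 := hp.in2 _ (bidegFD_cast (cas_mem b (D.mapAT_mem D.Xs hz)) (sub_self 1) (sub_self 1))
  have e5 := hp.in3 _ (bidegFD_cast (cas_mem b (D.mapAT_mem D.X (swap_mem hz))) (sub_self 1)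
    (sub_self 1))
  rw [← e, D.f_in1, D.f1_apply b, map_add_add p, map_add_units_smul TwoSequences.in1,
    map_add_units_smul p, e4, e5, e1, e2, e3, smul_zero]
  ring

theorem f_in2_ι (a : F) : p (D.f 1 (TwoSequences.in2 (ι a ⊗ₜ 1))) = D.X a D.u := by
  have hz : ι a ⊗ₜ 1 ∈ bidegFD (R := R) (F := F) 1 0 :=
    tmul_mem_bideg (ι_mem_extPow _) one_mem_extPow
  have h1 : ∀ w : F, coact (ι w) (1 : E') = 0 := fun w => by
    simpa using coact_ι_algebraMap w (1 : R)
  have hm : mu (ι a ⊗ₜ 1) = (0 : E') := h1 a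
  have e1 : p (in1 (mapX D.X (ι a ⊗ₜ 1))) = -D.X a D.u := by
    rw [LinearMap.rTensor_tmul, AlgHom.toLinearMap_apply, ExteriorAlgebra.map_apply_ι]
    exact hp.in1_ι b _
  have e2 : conR D.v (ι a ⊗ₜ[R] (1 : E')) = 0 := by
    rw [LinearMap.lTensor_tmul, h1, TensorProduct.tmul_zero]
  have e3 := hp.in2 _ (bidegFD_cast (conF_mem (D.Xs D.u) hz) (sub_self 1) rfl)
  rw [D.f_in2_of_mem_one b _ hz, map_combination_left p, e1, e2, e3, hm, TensorProduct.tmul_zero,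
    LinearMap.map_zero, LinearMap.map_zero, LinearMap.map_zero, LinearMap.map_zero]
  simp

theorem f_in3_ι (a : F) : p (D.f 1 (TwoSequences.in3 (ι a ⊗ₜ 1))) = D.X D.v a := by
  have hz : ι a ⊗ₜ 1 ∈ bidegFD (R := R) (F := F) 1 0 :=
    tmul_mem_bideg (ι_mem_extPow _) one_mem_extPow
  have h1 : ∀ w : F, coact (ι w) (1 : E') = 0 := fun w => by
    simpa using coact_ι_algebraMap w (1 : R)
  have hm : mu (ι a ⊗ₜ 1) = (0 : E') := h1 a
  have e1 : p (in1 (swap R F (mapX D.Xs (ι a ⊗ₜ 1)))) = 0 := by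
    rw [LinearMap.rTensor_tmul, AlgHom.toLinearMap_apply, ExteriorAlgebra.map_apply_ι]
    exact hp.in1_one b _
  have e2 : conR D.u (ι a ⊗ₜ[R] (1 : E')) = 0 := by
    rw [LinearMap.lTensor_tmul, h1, TensorProduct.tmul_zero]
  have e3 : p (TwoSequences.in3 (conF (D.X D.v) (ι a ⊗ₜ 1))) = D.X D.v a := by
    rw [hp.in3 _ (bidegFD_cast (conF_mem (D.X D.v) hz) (sub_self 1) rfl), LinearMap.rTensor_tmul, act_ι_ι, unitCoeff_in3,
      scalarPart_algebraMap, ← map_one (algebraMap R E'), scalarPart_algebraMap, mul_one]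
  rw [D.f_in3_of_mem_one b _ hz, map_combination_right p, e1, e2, e3, hm, TensorProduct.zero_tmul,
    LinearMap.map_zero, LinearMap.map_zero, LinearMap.map_zero, LinearMap.map_zero]
  simp

end IsAugmentation
end BasicData

end HomologyZeroOfMM

/-! ### Zeroth homology of a complex with cyclic last module. -/

section CyclicHomology

variable {R : Type uR} [CommRing R] {T : Type uT} [AddCommGroup T] [Module R T]

theorem Elimination.psi_d_of_eq {C M N' N : ℤ → Submodule R T} {d τ π ψ m : ℤ → T →ₗ[R] T}
    (h : Elimination C M N' N d τ π ψ m) {r s : ℤ} (hrs : r - 1 = s) {x : T} (hx : x ∈ N' r) :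
    ψ s (d r x) = 0 := hrs ▸ h.psi_d_N' r hx

theorem IsComplex.nonempty_homology_zero_of_cyclic {C : ℤ → Submodule R T} {d : ℤ → T →ₗ[R] T}
    (h : IsComplex C d) (hC : C (-1) = ⊥) {ω : T} (hω : ω ∈ C 0) (p : T →ₗ[R] R) (hp : p ω = 1)
    (hp' : ∀ x ∈ C 0, x = p x • ω) {H : Ideal R} (hH : (C 1).map (p ∘ₗ d 1) = H) :
    Nonempty (h.toChainComplex.homology 0 ≃ₗ[R] R ⧸ H) := by
  have hd : ∀ x ∈ C 1, d 1 x ∈ C 0 := h.mapsTo' (zero_add 1)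
  refine h.nonempty_homology_zero hC ((Ideal.Quotient.mkₐ R H).toLinearMap ∘ₗ p) ?_ ?_
  · intro y
    obtain ⟨c, rfl⟩ := Ideal.Quotient.mk_surjective y
    exact ⟨c • ω, Submodule.smul_mem _ _ hω, by
      rw [LinearMap.comp_apply, map_smul, hp, smul_eq_mul, mul_one]; rfl⟩
  · intro x hx
    refine (Ideal.Quotient.eq_zero_iff_mem (I := H) (a := p x)).trans ?_
    rw [← hH]
    constructor
    · rintro ⟨y, hy, hyx⟩
      refine ⟨y, hy, ?_⟩
      rw [hp' _ (hd y hy), hp' x hx, ← hyx]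
      rfl
    · rintro ⟨y, hy, rfl⟩
      exact ⟨y, hy, rfl⟩

end CyclicHomology

/-! ### The modules `𝕄_0`, `𝕄_1` and the zeroth homology of `𝕄`. -/

section HomologyZeroOfMM

variable {R : Type uR} [CommRing R] {F : Type uF} [AddCommGroup F] [Module R F] {n : ℕ}

local notation "E" => ExteriorAlgebra R F
local notation "E'" => ExteriorAlgebra R (Module.Dual R F)
local notation "ι" => ExteriorAlgebra.ι R

theorem eq_zero_of_mem_bidegDD {t c : ℤ} {z : ExteriorAlgebra R (Module.Dual R F) ⊗[R]
    ExteriorAlgebra R (Module.Dual R F)} (hz : z ∈ bidegDD t c) (h : t < 0 ∨ c < 0) : z = 0 := by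
  rcases h with h | h
  · exact (Submodule.mem_bot R).1 ((bideg_eq_bot_left (extPow_of_neg h)).le hz)
  · exact (Submodule.mem_bot R).1 ((bideg_eq_bot_right (extPow_of_neg h)).le hz)

theorem eq_zero_of_mem_bidegFD {t c : ℤ} {z : ExteriorAlgebra R F ⊗[R]
    ExteriorAlgebra R (Module.Dual R F)} (hz : z ∈ bidegFD t c) (h : c < 0) : z = 0 :=
  (Submodule.mem_bot R).1 ((bideg_eq_bot_right (extPow_of_neg h)).le hz)

namespace BasicData.Splittings

variable {D : BasicData R F n} (S : D.Splittings) (b : Module.Basis (Fin n) R F)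

theorem MM_zero_le (hn : 3 ≤ n) {P : Submodule R (Total R F)}
    (h : ∀ z ∈ bidegFD 0 0, in3 z ∈ P) : S.MM 0 ≤ P := by
  have k1 : ∀ (t c : ℤ), c < 0 → ∀ z ∈ bidegFD t c, in2 (R := R) (F := F) z ∈ P :=
    fun t c hc z hz => by
      rw [eq_zero_of_mem_bidegFD hz hc, LinearMap.map_zero]; exact zero_mem _
  have k2 : ∀ (t c : ℤ), c < 0 → ∀ z ∈ bidegFD t c, in3 (R := R) (F := F) z ∈ P :=
    fun t c hc z hz => by
      rw [eq_zero_of_mem_bidegFD hz hc, LinearMap.map_zero]; exact zero_mem _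
  refine S.MM_le ?_ ?_ ?_ ?_ ?_ ?_ ?_ ?_ ?_ ?_ ?_ ?_
  · intro t c _ _ _ _ _ z hz
    rw [eq_zero_of_mem_bidegDD hz (by omega), LinearMap.map_zero]; exact zero_mem _
  · intro z hz; exact k1 _ _ (by omega) z hz.1
  · intro t c _ _ _ z hz; exact k1 t c (by omega) z hz
  · intro z hz; exact k1 _ _ (by omega) z hz.1
  · intro z hz; exact k2 _ _ (by omega) z hz.1
  · intro t c _ _ _ z hz; exact k2 t c (by omega) z hz
  · intro z hz; exact k2 _ _ (by omega) z hz.1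
  · intro t c _ _ _ _ _ z hz
    rw [eq_zero_of_mem_bidegDD hz (by omega), LinearMap.map_zero]; exact zero_mem _
  · intro _ z hz; exact h z hz
  · intro h; omega
  · intro h; omega
  · intro h; omega

theorem MM_one_le (hn : 3 ≤ n) {P : Submodule R (Total R F)}
    (h1 : ∀ z ∈ bidegDD 1 1, in1 z ∈ P) (h2 : ∀ z ∈ bidegFD 1 0, in2 z ∈ P)
    (h3 : ∀ z ∈ bidegFD 1 0, in3 z ∈ P) : S.MM 1 ≤ P := by
  have k1 : ∀ (t c : ℤ), c < 0 → ∀ z ∈ bidegFD t c, in2 (R := R) (F := F) z ∈ P :=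
    fun t c hc z hz => by
      rw [eq_zero_of_mem_bidegFD hz hc, LinearMap.map_zero]; exact zero_mem _
  have k2 : ∀ (t c : ℤ), c < 0 → ∀ z ∈ bidegFD t c, in3 (R := R) (F := F) z ∈ P :=
    fun t c hc z hz => by
      rw [eq_zero_of_mem_bidegFD hz hc, LinearMap.map_zero]; exact zero_mem _
  refine S.MM_le ?_ ?_ ?_ ?_ ?_ ?_ ?_ ?_ ?_ ?_ ?_ ?_
  · intro t c _ _ _ _ _ z hz
    rcases (by omega : t = 1 ∧ c = 1 ∨ (t < 0 ∨ c < 0)) with ⟨rfl, rfl⟩ | h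
    · exact h1 z hz
    · rw [eq_zero_of_mem_bidegDD hz h, LinearMap.map_zero]; exact zero_mem _
  · intro z hz; exact k1 _ _ (by omega) z hz.1
  · intro t c _ _ _ z hz; exact k1 t c (by omega) z hz
  · intro z hz; exact h2 z (bidegFD_cast hz.1 rfl (sub_self 1))
  · intro z hz; exact k2 _ _ (by omega) z hz.1
  · intro t c _ _ _ z hz; exact k2 t c (by omega) z hz
  · intro z hz; exact h3 z (bidegFD_cast hz.1 rfl (sub_self 1))
  · intro t c _ _ _ _ _ z hz
    rw [eq_zero_of_mem_bidegDD hz (by omega), LinearMap.map_zero]; exact zero_mem _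
  · intro h; omega
  · intro h; omega
  · intro h; omega
  · intro h; omega

theorem mem_oneP_one (a : F) : ι a ⊗ₜ 1 ∈ S.oneP 1 := by
  have h1 : coact (ι a) (1 : E') = 0 := by simpa using coact_ι_algebraMap a (1 : R)
  exact ⟨bidegFD_cast (tmul_mem_bideg (ι_mem_extPow _) one_mem_extPow) rfl (sub_self 1).symm, h1⟩

theorem eq_unitCoeff_smul (hn : 3 ≤ n) {x : Total R F} (hx : x ∈ S.MM 0) :
    x = unitCoeff R F x • in3 (1 ⊗ₜ 1) := by
  have : S.MM 0 ≤ LinearMap.eqLocus LinearMap.id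
      ((unitCoeff R F).smulRight (in3 (1 ⊗ₜ 1))) :=
    S.MM_zero_le hn fun z hz => bidegFD_zero_eq hz
  exact this hx

include b in
-- `ψ_0` is the identity on `𝕄_0` and kills `N̂_0` and `f(N̂_1)`, so its explicit formula is never
-- needed.
theorem isAugmentation (hn : 3 ≤ n) : D.IsAugmentation (unitCoeff R F ∘ₗ S.psi 0) where
  in2 z hz := by
    rw [LinearMap.comp_apply, (S.elimination b hn).psi_N' 0
      (S.in2_zero_mem_hatN hz le_rfl (by omega) rfl), LinearMap.map_zero]
  in3 z hz := by
    rw [LinearMap.comp_apply, (S.elimination b hn).psi_M 0 (S.in3_zero_mem_MM hz)]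
  f_in2 β := by
    rw [LinearMap.comp_apply, (S.elimination b hn).psi_d_of_eq (sub_self 1) (S.in2_zero_mem_hatN
      (tmul_mem_bideg one_mem_extPow (ι_mem_extPow β)) zero_le_one (by omega) rfl),
      LinearMap.map_zero]
  f_in3 α := by
    rw [LinearMap.comp_apply, (S.elimination b hn).psi_d_of_eq (sub_self 1) (S.in3_zero_mem_hatN
      (tmul_mem_bideg one_mem_extPow (ι_mem_extPow α)) le_rfl (by omega) rfl), LinearMap.map_zero]

theorem m_eq {r s : ℤ} (h : r - 1 = s) : S.m r = S.psi s ∘ₗ D.f r := h ▸ rfl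

variable {b} in
/-- The image of `𝕄_1` in `𝕄_0 ≅ R`. -/
theorem map_MM_one (hn : 3 ≤ n) (hb : IsAdapted D b) :
    (S.MM 1).map (unitCoeff R F ∘ₗ S.psi 0 ∘ₗ D.f 1) =
      idealH (b.repr D.u) (matrixOf D b) ((-1 : R) ^ (n * (n - 1) / 2) • ⇑(b.repr D.v)) := by
  have hp := S.isAugmentation b hn
  -- From here on only the defining properties of an augmentation are used for this form.
  obtain ⟨p, e⟩ : ∃ p, p = unitCoeff R F ∘ₗ S.psi 0 := ⟨_, rfl⟩
  rw [← e] at hp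
  rw [← LinearMap.comp_assoc, ← e]
  -- The sign `s` is its own inverse, so rescaling generators by `s` changes no ideal, and the image
  -- may be expressed in terms of `w = s v`.
  have hs : (-1 : R) ^ (n * (n - 1) / 2) * (-1 : R) ^ (n * (n - 1) / 2) = 1 := by
    rw [← mul_pow]; simp
  obtain ⟨s, es⟩ : ∃ s, s = (-1 : R) ^ (n * (n - 1) / 2) := ⟨_, rfl⟩
  rw [← es] at hs
  have v1 : ∀ i j, p (D.f 1 (in1 (ι (b.coord i) ⊗ₜ ι (b.coord j)))) =
      -(s * (Matrix.vecMulVec (s • ⇑(b.repr D.v)) (b.repr D.u) -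
        (matrixOf D b).adjugate) j i) := fun i j => by
    rw [hp.f_in1 b hb, ← es, Matrix.sub_apply, Matrix.vecMulVec_apply, Pi.smul_apply, smul_eq_mul]
    linear_combination (b.repr D.v j * b.repr D.u i) * hs
  have hsum : ∀ (φ : Module.Dual R F) (w : F), φ w = ∑ i, b.repr w i * φ (b i) := fun φ w => by
    conv_lhs => rw [← b.sum_repr w, map_sum]
    simp only [map_smul, smul_eq_mul]
  have v2 : ∀ j, p (D.f 1 (in2 (ι (b j) ⊗ₜ 1))) =
      Matrix.vecMul (b.repr D.u) (matrixOf D b) j := fun j => by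
    rw [hp.f_in2_ι b, hsum]; rfl
  have v3 : ∀ i, p (D.f 1 (in3 (ι (b i) ⊗ₜ 1))) =
      s * (matrixOf D b).mulVec (s • ⇑(b.repr D.v)) i := fun i => by
    rw [hp.f_in3_ι b, Matrix.mulVec_smul, Pi.smul_apply, smul_eq_mul, ← mul_assoc, hs, one_mul]
    exact (hsum (Module.Dual.eval R F (b i) ∘ₗ D.X) D.v).trans
      (Finset.sum_congr rfl fun _ _ => mul_comm _ _)
  rw [← es]
  refine le_antisymm (Submodule.map_le_iff_le_comap.2 (S.MM_one_le hn ?_ ?_ ?_))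
    (sup_le (sup_le (Ideal.span_le.2 ?_) (Ideal.span_le.2 ?_)) (Ideal.span_le.2 ?_))
  · have key : ∀ α β : Module.Dual R F, p (D.f 1 (in1 (ι α ⊗ₜ ι β))) ∈
        idealH (b.repr D.u) (matrixOf D b) (s • ⇑(b.repr D.v)) := fun α β => by
      refine basis_mem b.dualBasis _ (p ∘ₗ D.f 1 ∘ₗ in1 ∘ₗ (TensorProduct.mk R E' E').flip (ι β) ∘ₗ ι)
        (fun i => ?_) α
      refine basis_mem b.dualBasis _ (p ∘ₗ D.f 1 ∘ₗ in1 ∘ₗ TensorProduct.mk R E' E'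
        (ι (b.dualBasis i)) ∘ₗ ι) (fun j => ?_) β
      rw [Module.Basis.coe_dualBasis]
      refine (v1 i j).symm ▸ neg_mem (Ideal.mul_mem_left _ _ ?_)
      exact Submodule.mem_sup_right (Ideal.subset_span ⟨j, i, rfl⟩)
    refine fun z hz => (bideg_le (P := Submodule.comap ((p ∘ₗ D.f 1) ∘ₗ in1) _) ?_ : _ ≤ _) hz
    intro x hx y hy
    obtain ⟨α, rfl⟩ := exists_ι_of_mem hx
    obtain ⟨β, rfl⟩ := exists_ι_of_mem hy
    exact key α β
  · have key : ∀ a : F, p (D.f 1 (in2 (ι a ⊗ₜ 1))) ∈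
        idealH (b.repr D.u) (matrixOf D b) (s • ⇑(b.repr D.v)) := fun a => by
      refine basis_mem b _ (p ∘ₗ D.f 1 ∘ₗ in2 ∘ₗ (TensorProduct.mk R E E').flip 1 ∘ₗ ι)
        (fun i => ?_) a
      refine (v2 i).symm ▸ Submodule.mem_sup_left (Submodule.mem_sup_left
        (Ideal.subset_span ⟨i, rfl⟩))
    refine fun z hz => (bideg_le (P := Submodule.comap ((p ∘ₗ D.f 1) ∘ₗ in2) _) ?_ : _ ≤ _) hz
    intro x hx y hy
    obtain ⟨a, rfl⟩ := exists_ι_of_mem hx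
    rw [eq_smul_one_of_mem hy, TensorProduct.tmul_smul]
    exact Submodule.smul_mem _ _ (key a)
  · have key : ∀ a : F, p (D.f 1 (in3 (ι a ⊗ₜ 1))) ∈
        idealH (b.repr D.u) (matrixOf D b) (s • ⇑(b.repr D.v)) := fun a => by
      refine basis_mem b _ (p ∘ₗ D.f 1 ∘ₗ in3 ∘ₗ (TensorProduct.mk R E E').flip 1 ∘ₗ ι)
        (fun i => ?_) a
      refine (v3 i).symm ▸ Ideal.mul_mem_left _ _
        (Submodule.mem_sup_left (Submodule.mem_sup_right (Ideal.subset_span ⟨i, rfl⟩)))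
    refine fun z hz => (bideg_le (P := Submodule.comap ((p ∘ₗ D.f 1) ∘ₗ in3) _) ?_ : _ ≤ _) hz
    intro x hx y hy
    obtain ⟨a, rfl⟩ := exists_ι_of_mem hx
    rw [eq_smul_one_of_mem hy, TensorProduct.tmul_smul]
    exact Submodule.smul_mem _ _ (key a)
  · rintro _ ⟨j, rfl⟩
    exact ⟨_, S.in2_oneP_mem_MM (S.mem_oneP_one (b j)), v2 j⟩
  · rintro _ ⟨i, rfl⟩
    have h := Ideal.mul_mem_left ((S.MM 1).map (p ∘ₗ D.f 1)) s
      ⟨_, S.in3_oneP_mem_MM (S.mem_oneP_one (b i)), v3 i⟩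
    rwa [← mul_assoc, hs, one_mul] at h
  · rintro _ ⟨j, i, rfl⟩
    have h := Ideal.mul_mem_left ((S.MM 1).map (p ∘ₗ D.f 1)) (-s)
      ⟨_, S.in1_mem_MM (tmul_mem_bideg (ι_mem_extPow (b.coord i)) (ι_mem_extPow (b.coord j)))
        rfl one_ne_zero (by omega) one_ne_zero (by omega), v1 i j⟩
    rwa [neg_mul_neg, ← mul_assoc, hs, one_mul] at h

variable {b} in
theorem nonempty_homology_zero (hn : 3 ≤ n) (hb : IsAdapted D b) (cM : IsComplex S.MM S.m) :
    Nonempty (cM.toChainComplex.homology 0 ≃ₗ[R] R ⧸ idealH (b.repr D.u) (matrixOf D b)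
      ((-1 : R) ^ (n * (n - 1) / 2) • ⇑(b.repr D.v))) := by
  have hone : unitCoeff R F (in3 (1 ⊗ₜ 1)) = 1 := by
    rw [unitCoeff_in3, ← map_one (algebraMap R E), ← map_one (algebraMap R E'),
      scalarPart_algebraMap, scalarPart_algebraMap, mul_one]
  have hm : S.m 1 = S.psi 0 ∘ₗ D.f 1 := S.m_eq (sub_self 1)
  have hω : in3 (1 ⊗ₜ 1) ∈ S.MM 0 :=
    S.in3_zero_mem_MM (tmul_mem_bideg one_mem_extPow one_mem_extPow)
  have hC : S.MM (-1) = ⊥ := S.MM_eq_bot b (Or.inl neg_one_lt_zero)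
  have hH := S.map_MM_one hn hb
  rw [← hm] at hH
  exact cM.nonempty_homology_zero_of_cyclic hC hω (unitCoeff R F) hone
    (fun x hx => S.eq_unitCoeff_smul hn hx) hH

end BasicData.Splittings
end HomologyZeroOfMM

end TwoSequences

end

theorem theorem3p1
    {R : Type*} [CommRing R] [IsNoetherianRing R]
    {F : Type*} [AddCommGroup F] [Module R F]
    (n : ℕ) (hn : 3 ≤ n) (hF : Nonempty (Module.Basis (Fin n) R F))
    (D : TwoSequences.BasicData R F n) (S : D.Splittings) :
    -- `𝔽` is a complex, `ℕ` is a subcomplex of it, and `𝕄` is a complex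
    ∃ (cF : TwoSequences.IsComplex (TwoSequences.FF R F) D.f)
      (cN : TwoSequences.IsComplex S.NN D.f)
      (cM : TwoSequences.IsComplex S.MM S.m),
      -- the modules of `ℕ` and `𝕄` are submodules of those of `𝔽`, and those of `𝕄` are finitely
      -- generated and projective, and zero outside of the degrees `0, …, 2n`
      (∀ r, S.NN r ≤ TwoSequences.FF R F r) ∧
      (∀ r, S.MM r ≤ TwoSequences.FF R F r) ∧
      (∀ r, Module.Finite R (S.MM r) ∧ Module.Projective R (S.MM r)) ∧
      (∀ r : ℤ, r < 0 ∨ 2 * (n : ℤ) < r → S.MM r = ⊥) ∧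
      -- `ℕ` is split exact
      Nonempty (Homotopy (CategoryTheory.CategoryStruct.id cN.toChainComplex) 0) ∧
      -- `ψ` is a map of complexes `𝔽 → 𝕄` with kernel `ℕ`, it is the identity on `𝕄`, and it
      -- induces isomorphisms `H_r(𝔽) ≅ H_r(𝕄)`
      (∃ cψ : TwoSequences.IsChainMap (TwoSequences.FF R F) D.f S.MM S.m S.psi,
        (∀ r, ∀ x ∈ S.MM r, S.psi r x = x) ∧
        (∀ r, ∀ x ∈ TwoSequences.FF R F r, S.psi r x = 0 ↔ x ∈ S.NN r) ∧
        (∀ r, CategoryTheory.IsIso (HomologicalComplex.homologyMap (cψ.toHom cF cM) r))) ∧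
      -- the zeroth homology of `𝕄`
      (∀ b : Module.Basis (Fin n) R F, TwoSequences.IsAdapted D b →
        Nonempty (cM.toChainComplex.homology 0 ≃ₗ[R]
          R ⧸ TwoSequences.idealH (b.repr D.u) (TwoSequences.matrixOf D b)
            ((-1 : R) ^ (n * (n - 1) / 2) • ⇑(b.repr D.v)))) ∧
      -- the entries of the maps of `𝕄`
      (∀ r, TwoSequences.I1 (cM.diff r) ≤
        TwoSequences.I1 (LinearMap.toSpanSingleton R F D.u) ⊔
        TwoSequences.I1 (LinearMap.toSpanSingleton R F D.v) ⊔
        TwoSequences.I1 D.X) ∧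
      -- minimality of `𝕄` with respect to every ideal which contains the entries of the data
      (∀ 𝔪 : Ideal R,
        TwoSequences.I1 (LinearMap.toSpanSingleton R F D.u) ⊔
          TwoSequences.I1 (LinearMap.toSpanSingleton R F D.v) ⊔
          TwoSequences.I1 D.X ≤ 𝔪 →
        ∀ r, LinearMap.range (cM.diff r) ≤ (𝔪 • ⊤ : Submodule R (S.MM (r - 1)))) := by
  obtain ⟨b⟩ := hF
  have hE := S.elimination b hn
  -- The proof that `𝕄` is a complex becomes a variable, so that the statements about its homology
  -- and differential do not carry that proof term.
  obtain ⟨cM, hM⟩ : ∃ cM : TwoSequences.IsComplex S.MM S.m, cM = hE.isComplex_M := ⟨_, rfl⟩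
  refine ⟨hE.isComplex_C, hE.isComplex_N, cM, hE.N_le, hE.M_le, S.finite_projective_MM b hn,
    fun r hr => S.MM_eq_bot b hr, hE.nonempty_homotopy_N _,
    ⟨hE.isChainMap_psi, fun r x hx => hE.psi_M r hx, fun r x hx => hE.psi_eq_zero_iff r hx,
      hE.isIso_homologyMap _ _ _⟩, fun b' hb' => S.nonempty_homology_zero hn hb' cM, ?_, ?_⟩
  · intro r
    have h := S.m_mem_smul_top b hn (D.entriesIn b le_rfl) r
    refine TwoSequences.I1_le ?_
    refine cM.range_diff_le (S.projM (r - 1)) ?_ ?_ ?_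
    · exact S.projM_mem b hn (r - 1)
    · exact S.projM_of_mem b hn (r - 1)
    · exact h
  · intro 𝔪 h𝔪 r
    have h := S.m_mem_smul_top b hn (D.entriesIn b h𝔪) r
    refine cM.range_diff_le (S.projM (r - 1)) ?_ ?_ ?_
    · exact S.projM_mem b hn (r - 1)
    · exact S.projM_of_mem b hn (r - 1)
    · exact h
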